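/- **Setting.** A binary pairwise MRF on $n\ge 2$ variables has energy $E(x)=-\sum_i\theta_i x_i-\sum_{(i,j)\in\mathcal E}W_{ij}x_ix_j$ with real $\theta_i$ and $W_{ij}\neq 0$ on the edges. Assume that its graph is connected and that it is associative ($W_{ij}>0$ on all edges). Write $N(i)$ for the neighbours and $z_i$ for the degree of $i$, $\alpha_{ij}=e^{W_{ij}}-1$, $W_i=\sum_{j\in N(i)}W_{ij}$, $\sigma(x)=1/(1+e^{-x})$. For $q\in[0,1]^n$ let $\xi_{ij}$ be the lower root of $\alpha_{ij}\xi^2-(1+\alpha_{ij}(q_i+q_j))\xi+(1+\alpha_{ij})q_iq_j=0$, let $S_{ij}$ be the entropy of the distribution $(1+\xi_{ij}-q_i-q_j,\ q_j-\xi_{ij},\ q_i-\xi_{ij},\ \xi_{ij})$, $S_i$ the entropy of $(q_i,1-q_i)$, $f_{ij}(q_i,q_j)=-W_{ij}\xi_{ij}-S_{ij}$, and let $$F(q)=\sum_{(i,j)\in\mathcal E}f_{ij}(q_i,q_j)+\sum_i\big(-\theta_iq_i+(z_i-1)S_i\big)$$ be the Bethe free energy. *Bethe box.* Start from $A_i=\sigma(\theta_i)$,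 $B_i=1-\sigma(\theta_i+W_i)$ and apply a fixed number $k\ge0$ of simultaneous rounds of Bethe bound propagation, $A_i\leftarrow 1/(1+e^{-\theta_i}/L_i)$, $B_i\leftarrow1/(1+e^{\theta_i+W_i}/U_i)$, with $$L_i=\prod_{j\in N(i)}\Big(1+\tfrac{\alpha_{ij}A_j}{1+\alpha_{ij}(1-B_i)(1-A_j)}\Big),\qquad U_i=\prod_{j\in N(i)}\Big(1+\tfrac{\alpha_{ij}B_j}{1+\alpha_{ij}(1-A_i)(1-B_j)}\Big).$$ The Bethe box is $\prod_i[A_i,1-B_i]$. Put $\eta_i=\min(A_i,B_i)$, $$a=\max_{(i,j)\in\mathcal E}\frac{\alpha_{ij}(\alpha_{ij}+1)}{4(2\alpha_{ij}+1)\eta_i\eta_j(1-\eta_i)(1-\eta_j)},\quad b=\max_i\frac{1}{\eta_i(1-\eta_i)}\Big(1-z_i+\sum_{j\in N(i)}\frac{(\alpha_{ij}+1)^2}{2\alpha_{ij}+1}\Big),$$ $\Omega=\max(a,b)$, and $\Sigma=(n+2|\mathcal E|)/n^2$ (the proportion of non-zero entries of the Hessian of $F$ inside the box). **Claim.** Let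 $k\ge 0$ be fixed. 1. Let each $D_i$ be a finite non-empty subset of $[A_i,1-B_i]$. Then every $f_{ij}$, $(i,j)\in\mathcal E$, is submodular on $D_i\times D_j$, and minimizing $F$ over $\prod_iD_i$ is a multi-label graph cut problem: on a network with a source, a sink and one node for each pair $(i,d)$, $d\in D_i$, there are non-negative capacities for which the cut with source side $\{\text{source}\}\cup\{(i,d):d\le q_i\}$ has value $F(q)+\text{const}$ for all $q\in\prod_i D_i$, and all minimum cuts are of this form. If moreover $\varepsilon>0$, every point of $[A_i,1-B_i]$ is within distance $\gamma$ of $D_i$ for each $i$, and $n\gamma^2\le 2\varepsilon/(n\Omega\sqrt\Sigma)$, then every minimizer $q$ of $F$ over $\prod_iD_i$ satisfies $F(q)\le\min_{[0,1]^n}F+\varepsilon$ (the minimum exists). 2. There are one program for a real RAM and a constant $C$ (both depending only on $k$) such that on every such model and every $\varepsilon>0$ the program, given $n,\varepsilon,(\theta_i),(W_{ij})$, halts with a minimizer $q$ of $F$ over the mesh in the Bethe box whose $i$-th factor consists of the $N_i$ equally spaced points $A_i+r(1-B_i-A_i)/(N_i+1)$, $1\le r\le N_i$, where $N_i$ is the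 least positive integer with $(1-B_i-A_i)/(N_i+1)\le\gamma$ and $\gamma$ is given by $n\gamma^2=2\varepsilon/(n\Omega\sqrt\Sigma)$; it satisfies $F(q)\le\min_{[0,1]^n}F+\varepsilon$; and if $\gamma\le1$, i.e. $2\varepsilon\le n^2\Omega\sqrt\Sigma$ (in particular whenever $\varepsilon\le1$), the program halts within $C\,n^6\,\Sigma^{3/4}\,\Omega^{3/2}\,\varepsilon^{-3/2}$ steps. The real RAM has memories for natural and real numbers with indirect addressing; arithmetic on natural numbers ($+,-,\times$), arithmetic on real numbers ($+,-,\times,/,\exp,\log,\sqrt{\ }$), comparisons, memory accesses, assignments and branchings cost one step each. 3. For all reals $c,W^*,\theta^*$ there are $K$ and a natural number $e$ such that for every such model with $z_i\le c\log n$ for all $i$, $W_{ij}\le W^*$ for all edges, and $|\theta_i|\le\theta^*$ for all $i$ or $|\theta_i+W_i/2|\le\theta^*$ for all $i$ (potentials bounded after the unbiased reparameterization), and all $\varepsilon>0$, $n^6\,\Sigma^{3/4}\,\Omega^{3/2}\,\varepsilon^{-3/2}\le K\,n^{e}\,\varepsilon^{-3/2}$; so under these conditions the running time is polynomial in $n$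 and $1/\varepsilon$. -/

import Mathlib

noncomputable section

namespace Bethe

/-! ### Binary pairwise Markov random fields and the Bethe free energy -/

/-- A binary pairwise MRF on `n` variables with energy
`E(x) = - ∑ᵢ θᵢ xᵢ - ∑_{(i,j) ∈ 𝓔} Wᵢⱼ xᵢ xⱼ`; the edges are the pairs with `Wᵢⱼ ≠ 0`. -/
structure MRF (n : ℕ) where
  θ : Fin n → ℝ
  W : Fin n → Fin n → ℝ
  symm : ∀ i j, W i j = W j i
  diag : ∀ i, W i i = 0

namespace MRF

variable {n : ℕ} (M : MRF n)

/-- The topology of the model. -/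
def graph : SimpleGraph (Fin n) :=
  SimpleGraph.fromRel fun i j => M.W i j ≠ 0

/-- All edges are associative. -/
def Associative : Prop := ∀ i j, M.graph.Adj i j → 0 < M.W i j

/-- The set of neighbours `N(i)`. -/
def nbrs (i : Fin n) : Finset (Fin n) := Finset.univ.filter fun j => M.W i j ≠ 0

/-- The degree `zᵢ`. -/
def deg (i : Fin n) : ℕ := (M.nbrs i).card

/-- The set of edges, each listed once as `(i, j)` with `i < j`. -/
def edges : Finset (Fin n × Fin n) :=
  Finset.univ.filter fun p => p.1 < p.2 ∧ M.W p.1 p.2 ≠ 0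

/-- `αᵢⱼ = exp Wᵢⱼ - 1`. -/
def α (i j : Fin n) : ℝ := Real.exp (M.W i j) - 1

/-- `Wᵢ`, the sum of the weights of the edges at `i` (for an associative model). -/
def Wsum (i : Fin n) : ℝ := ∑ j ∈ M.nbrs i, M.W i j

/-- The root `ξ` of `α ξ² - (1 + α (x + y)) ξ + (1 + α) x y = 0` that minimizes the Bethe free
energy: the lower root for `α > 0`, the higher one for `α < 0`. -/
def xi (a x y : ℝ) : ℝ :=
  if a = 0 then x * y
  else ((1 + a * (x + y)) - √((1 + a * (x + y)) ^ 2 - 4 * a * (1 + a) * (x * y))) / (2 * a)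

/-- The entropy of the pseudo-marginal with `p(1,1) = ξ`, `p(1,0) = x - ξ`, `p(0,1) = y - ξ`,
`p(0,0) = 1 + ξ - x - y`. -/
def pairEntropy (ξ x y : ℝ) : ℝ :=
  Real.negMulLog (1 + ξ - x - y) + Real.negMulLog (x - ξ) + Real.negMulLog (y - ξ)
    + Real.negMulLog ξ

/-- The pairwise terms `fᵢⱼ(qᵢ, qⱼ) = - Wᵢⱼ ξᵢⱼ - Sᵢⱼ`. -/
def edgeTerm (i j : Fin n) (x y : ℝ) : ℝ :=
  -(M.W i j * xi (M.α i j) x y) - pairEntropy (xi (M.α i j) x y) x y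

/-- The Bethe free energy as a function of the singleton pseudo-marginals `qᵢ = p(Xᵢ = 1)`. -/
def F (q : Fin n → ℝ) : ℝ :=
  ∑ p ∈ M.edges, M.edgeTerm p.1 p.2 (q p.1) (q p.2)
    + ∑ i, (-(M.θ i * q i) + ((M.deg i : ℝ) - 1) * Real.binEntropy (q i))

/-- The Bethe free energy of `q` is within `ε` of its global minimum over `[0,1]ⁿ`
(which in particular exists). -/
def WithinOfMin (q : Fin n → ℝ) (ε : ℝ) : Prop :=
  ∃ qmin ∈ Set.Icc (0 : Fin n → ℝ) 1,
    IsMinOn M.F (Set.Icc 0 1) qmin ∧ M.F q ≤ M.F qmin + ε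

/-! ### The Bethe box and the constants `Ω`, `Σ` -/

/-- The lower bounds `(A, B)` for `qᵢ` and `1 - qᵢ`: `Aᵢ = σ(θᵢ)`, `Bᵢ = 1 - σ(θᵢ + Wᵢ)` for
`k = 0`, and then improved by `k` rounds of Bethe bound propagation. -/
def bounds : ℕ → (Fin n → ℝ) × (Fin n → ℝ)
  | 0 => (fun i => Real.sigmoid (M.θ i), fun i => 1 - Real.sigmoid (M.θ i + M.Wsum i))
  | k + 1 =>
    let A := (bounds k).1
    let B := (bounds k).2
    let L : Fin n → ℝ := fun i => ∏ j ∈ M.nbrs i,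
      (1 + M.α i j * A j / (1 + M.α i j * (1 - B i) * (1 - A j)))
    let U : Fin n → ℝ := fun i => ∏ j ∈ M.nbrs i,
      (1 + M.α i j * B j / (1 + M.α i j * (1 - A i) * (1 - B j)))
    (fun i => 1 / (1 + Real.exp (-M.θ i) / L i),
      fun i => 1 / (1 + Real.exp (M.θ i + M.Wsum i) / U i))

/-- `Aᵢ` after `k` rounds. -/
def A (k : ℕ) (i : Fin n) : ℝ := (M.bounds k).1 i

/-- `Bᵢ` after `k` rounds. -/
def B (k : ℕ) (i : Fin n) : ℝ := (M.bounds k).2 i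

/-- The `i`-th side `[Aᵢ, 1 - Bᵢ]` of the Bethe box. -/
def side (k : ℕ) (i : Fin n) : Set ℝ := Set.Icc (M.A k i) (1 - M.B k i)

/-- `ηᵢ = min(Aᵢ, Bᵢ)`. -/
def η (k : ℕ) (i : Fin n) : ℝ := min (M.A k i) (M.B k i)

/-- The bound `a = max_{(i,j) ∈ 𝓔} α(α+1) / (4(2α+1) ηᵢ ηⱼ (1-ηᵢ)(1-ηⱼ))`. -/
def aBound (k : ℕ) : ℝ :=
  ⨆ p : {p : Fin n × Fin n // p ∈ M.edges},
    M.α p.1.1 p.1.2 * (M.α p.1.1 p.1.2 + 1) /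
      (4 * (2 * M.α p.1.1 p.1.2 + 1) * M.η k p.1.1 * M.η k p.1.2
        * (1 - M.η k p.1.1) * (1 - M.η k p.1.2))

/-- The bound `b = maxᵢ (1 - zᵢ + ∑_{j ∈ N(i)} (α+1)²/(2α+1)) / (ηᵢ(1-ηᵢ))`. -/
def bBound (k : ℕ) : ℝ :=
  ⨆ i : Fin n, 1 / (M.η k i * (1 - M.η k i)) *
    (1 - (M.deg i : ℝ) + ∑ j ∈ M.nbrs i, (M.α i j + 1) ^ 2 / (2 * M.α i j + 1))

/-- `Ω = max(a, b)`. -/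
def Ω (k : ℕ) : ℝ := max (M.aBound k) (M.bBound k)

/-- `Σ`, the proportion of non-zero entries of the `n × n` Hessian of the Bethe free energy inside
the box: the main diagonal and two entries for each edge. -/
def density : ℝ := ((n : ℝ) + 2 * (M.edges.card : ℝ)) / (n : ℝ) ^ 2

/-! ### Meshes and multi-label graph cuts -/

/-- The mesh width `γ` for accuracy `ε`, i.e. `n γ² = 2 ε / (n Ω √Σ)`. -/
def meshWidth (k : ℕ) (ε : ℝ) : ℝ := √(2 * ε / ((n : ℝ) ^ 2 * M.Ω k * √M.density))

/-- The number `Nᵢ` of mesh points in dimension `i`: the least positive integer with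
`(1 - Bᵢ - Aᵢ) / (Nᵢ + 1) ≤ γ`. -/
def meshCount (k : ℕ) (ε : ℝ) (i : Fin n) : ℕ :=
  max 1 (⌈(1 - M.B k i - M.A k i) / M.meshWidth k ε⌉₊ - 1)

/-- The `Nᵢ` equally spaced mesh points `Aᵢ + r (1 - Bᵢ - Aᵢ) / (Nᵢ + 1)`, `r = 1, …, Nᵢ`. -/
def mesh (k : ℕ) (ε : ℝ) (i : Fin n) (r : Fin (M.meshCount k ε i)) : ℝ :=
  M.A k i + ((r : ℕ) + 1 : ℝ) * ((1 - M.B k i - M.A k i) / ((M.meshCount k ε i : ℝ) + 1))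

/-- The claimed running time `n⁶ Σ^(3/4) Ω^(3/2) ε^(-3/2)`, up to a constant. -/
def timeBound (k : ℕ) (ε : ℝ) : ℝ :=
  (n : ℝ) ^ 6 * M.density ^ (3 / 4 : ℝ) * M.Ω k ^ (3 / 2 : ℝ) * ε ^ (-(3 / 2) : ℝ)

end MRF

/-- The nodes of the flow network of a multi-label problem with `Nᵢ` labels for variable `i`: one
node for each variable and label, the source `inl true` and the sink `inl false`. -/
abbrev CutNode {n : ℕ} (N : Fin n → ℕ) : Type := Bool ⊕ (Σ i : Fin n, Fin (N i))

/-- Total capacity of the arcs that leave `S`. -/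
def cutValue {V : Type*} [Fintype V] [DecidableEq V] (cap : V → V → ℝ) (S : Finset V) : ℝ :=
  ∑ u ∈ S, ∑ v ∈ Sᶜ, cap u v

/-- `S` is a source-sink cut of least capacity. -/
def IsMinCut {n : ℕ} {N : Fin n → ℕ} (cap : CutNode N → CutNode N → ℝ)
    (S : Finset (CutNode N)) : Prop :=
  (Sum.inl true ∈ S ∧ Sum.inl false ∉ S) ∧
    ∀ T : Finset (CutNode N), Sum.inl true ∈ T → Sum.inl false ∉ T →
      cutValue cap S ≤ cutValue cap T

/-- The cut that belongs to a labelling `x`: the source side holds the source and the nodes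
`(i, r)` with `r ≤ xᵢ`. -/
def labelCut {n : ℕ} {N : Fin n → ℕ} (x : ∀ i, Fin (N i)) : Finset (CutNode N) :=
  insert (Sum.inl true)
    ((Finset.univ.filter fun p : Σ i : Fin n, Fin (N i) => p.2 ≤ x p.1).image Sum.inr)

/-- Minimization of `E` over labellings is a multi-label graph cut problem: for some non-negative
capacities the value of the cut of a labelling is its cost `E` up to an additive constant, and
every minimum cut is the cut of a labelling. -/
def IsGraphCutProblem {n : ℕ} (N : Fin n → ℕ) (E : (∀ i, Fin (N i)) → ℝ) : Prop :=
  ∃ cap : CutNode N → CutNode N → ℝ, (∀ u v, 0 ≤ cap u v) ∧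
    (∃ c : ℝ, ∀ x, cutValue cap (labelCut x) = E x + c) ∧
    ∀ S, IsMinCut cap S → ∃ x, S = labelCut x

/-- A function of two ordered labels is submodular. -/
def Submodular {K L : ℕ} (f : Fin K → Fin L → ℝ) : Prop :=
  ∀ a a' b b', f (min a a') (min b b') + f (max a a') (max b b') ≤ f a b + f a' b'

/-! ### A real RAM with step count

A program works on two unbounded memories, one with natural numbers (for indices and counters)
and one with real numbers, both with indirect addressing by natural numbers. The operations are
`+`, `-`, `*` on natural numbers, `+`, `-`, `*`, `/`, `exp`, `log`, `√` on real numbers, the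
embedding of the natural numbers into the real numbers, comparisons, branching and loops. Each
evaluation of an operation, a literal, a memory access or a comparison costs one step, and so does
each assignment, branching and pass through a loop. There are no real literals and no rounding. -/

/-- Contents of the two memories. -/
structure Mem where
  nat : ℕ → ℕ
  real : ℕ → ℝ

/-- Expressions with values in the natural numbers; `cell a` is the content of the cell with
address `a`, and `sub` is truncated. -/
inductive NExp : Type
  | lit (c : ℕ)
  | cell (a : NExp)
  | add (a b : NExp)
  | sub (a b : NExp)
  | mul (a b : NExp)

/-- Expressions with values in the real numbers. -/
inductive RExp : Type
  | ofNat (a : NExp)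
  | cell (a : NExp)
  | add (a b : RExp)
  | sub (a b : RExp)
  | mul (a b : RExp)
  | div (a b : RExp)
  | exp (a : RExp)
  | log (a : RExp)
  | sqrt (a : RExp)

/-- Boolean expressions. -/
inductive BExp : Type
  | natLt (a b : NExp)
  | natEq (a b : NExp)
  | realLt (a b : RExp)
  | realEq (a b : RExp)
  | neg (c : BExp)
  | conj (c d : BExp)

/-- Programs. -/
inductive Prog : Type
  | skip
  | setNat (addr val : NExp)
  | setReal (addr : NExp) (val : RExp)
  | seq (P Q : Prog)
  | branch (c : BExp) (P Q : Prog)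
  | loop (c : BExp) (P : Prog)

def NExp.eval (m : Mem) : NExp → ℕ
  | .lit c => c
  | .cell a => m.nat (a.eval m)
  | .add a b => a.eval m + b.eval m
  | .sub a b => a.eval m - b.eval m
  | .mul a b => a.eval m * b.eval m

def NExp.cost : NExp → ℕ
  | .lit _ => 1
  | .cell a => a.cost + 1
  | .add a b => a.cost + b.cost + 1
  | .sub a b => a.cost + b.cost + 1
  | .mul a b => a.cost + b.cost + 1

def RExp.eval (m : Mem) : RExp → ℝ
  | .ofNat a => (a.eval m : ℝ)
  | .cell a => m.real (a.eval m)
  | .add a b => a.eval m + b.eval m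
  | .sub a b => a.eval m - b.eval m
  | .mul a b => a.eval m * b.eval m
  | .div a b => a.eval m / b.eval m
  | .exp a => Real.exp (a.eval m)
  | .log a => Real.log (a.eval m)
  | .sqrt a => √(a.eval m)

def RExp.cost : RExp → ℕ
  | .ofNat a => a.cost + 1
  | .cell a => a.cost + 1
  | .add a b => a.cost + b.cost + 1
  | .sub a b => a.cost + b.cost + 1
  | .mul a b => a.cost + b.cost + 1
  | .div a b => a.cost + b.cost + 1
  | .exp a => a.cost + 1
  | .log a => a.cost + 1
  | .sqrt a => a.cost + 1

def BExp.Holds (m : Mem) : BExp → Prop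
  | .natLt a b => a.eval m < b.eval m
  | .natEq a b => a.eval m = b.eval m
  | .realLt a b => a.eval m < b.eval m
  | .realEq a b => a.eval m = b.eval m
  | .neg c => ¬ c.Holds m
  | .conj c d => c.Holds m ∧ d.Holds m

def BExp.cost : BExp → ℕ
  | .natLt a b => a.cost + b.cost + 1
  | .natEq a b => a.cost + b.cost + 1
  | .realLt a b => a.cost + b.cost + 1
  | .realEq a b => a.cost + b.cost + 1
  | .neg c => c.cost + 1
  | .conj c d => c.cost + d.cost + 1

/-- `Exec P m t m'`: started with memory `m`, the program `P` halts after `t` steps with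
memory `m'`. -/
inductive Exec : Prog → Mem → ℕ → Mem → Prop
  | skip (m : Mem) : Exec .skip m 1 m
  | setNat (a e : NExp) (m : Mem) :
      Exec (.setNat a e) m (a.cost + e.cost + 1)
        { m with nat := Function.update m.nat (a.eval m) (e.eval m) }
  | setReal (a : NExp) (e : RExp) (m : Mem) :
      Exec (.setReal a e) m (a.cost + e.cost + 1)
        { m with real := Function.update m.real (a.eval m) (e.eval m) }
  | seq {P Q : Prog} {m m' m'' : Mem} {t t' : ℕ} :
      Exec P m t m' → Exec Q m' t' m'' → Exec (.seq P Q) m (t + t') m''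
  | branchTrue {c : BExp} {P Q : Prog} {m m' : Mem} {t : ℕ} :
      c.Holds m → Exec P m t m' → Exec (.branch c P Q) m (c.cost + t + 1) m'
  | branchFalse {c : BExp} {P Q : Prog} {m m' : Mem} {t : ℕ} :
      ¬ c.Holds m → Exec Q m t m' → Exec (.branch c P Q) m (c.cost + t + 1) m'
  | loopStep {c : BExp} {P : Prog} {m m' m'' : Mem} {t t' : ℕ} :
      c.Holds m → Exec P m t m' → Exec (.loop c P) m' t' m'' →
        Exec (.loop c P) m (c.cost + t + t' + 1) m''
  | loopExit {c : BExp} {P : Prog} {m : Mem} :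
      ¬ c.Holds m → Exec (.loop c P) m (c.cost + 1) m

/-- The input of the algorithm in memory: the natural number `n` in cell `0`; the real numbers `ε`
in cell `0`, `θᵢ` in cell `1 + i` and `Wᵢⱼ` in cell `1 + n + (n i + j)` for `i, j < n` (so `0` for a
non-edge); all other cells are `0`. -/
def MRF.input {n : ℕ} (M : MRF n) (ε : ℝ) : Mem where
  nat := fun c => if c = 0 then n else 0
  real := fun c =>
    if c = 0 then ε
    else (∑ i : Fin n, if c = 1 + (i : ℕ) then M.θ i else 0)
      + ∑ i : Fin n, ∑ j : Fin n, if c = 1 + n + (n * (i : ℕ) + j) then M.W i j else 0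

/-- The output: the real numbers in cells `0, …, n - 1`. -/
def Mem.output (n : ℕ) (m : Mem) : Fin n → ℝ := fun i => m.real i

end Bethe

end

/-!
The theorem rests on the calculus of a single edge. The pair marginal `ξ` is determined by the cross ratio
`ξ (1 + ξ - x - y) = (1 + α) (x - ξ) (y - ξ)` (`xi_cross`), which says that an edge term is stationary in `ξ`.
Hence its partial derivative is explicit (`edgeSlope`), and so are its second derivatives
(`hasDerivAt_edgeSlope`), whose common denominator has a lower bound in terms of the variances of the two
variables (`hessDen_ge`). For an attractive edge the covariance `ξ - x y` is positive, so the mixed derivative is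
negative; this is submodularity (`edgeFn_submodular`).

Every minimizer of `F` over the cube lies in the Bethe box (`minimizer_mem_side`). In one variable an edge term
decreases at least as fast as the negative entropy and increases at least as fast as the negative entropy minus
`w x`, and so the minimizer is bounded by the two logistic values from which the bounds start. At an interior
stationary point the logit of `qᵢ` is `θᵢ + ∑ log (1 + αᵢⱼ p(Xⱼ = 1 | Xᵢ = 0))` (`logit_eq_of_grad_eq_zero`), and
bounds of the conditional probability (`condProb_ge`, `condProb_le`) turn this into a round of bound propagation.
Inside the box the diagonal entries of the Hessian are at most `Ω`, the others lie between `-Ω` and `0`, and the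
Cauchy–Schwarz inequality over the `n + 2 |E| = n² Σ` non-zero entries bounds the Hessian form by
`n Ω √Σ ∑ vᵢ²`. A Taylor expansion at the minimizer, where the gradient vanishes (`F_sub_minimizer_le`), shows
that the mesh point nearest to it is good enough (`withinOfMin_of_mesh`).

On a mesh, `F` is a sum of functions of one label and of pairwise functions. Up to functions of one label, the
latter are sums of their mixed second differences over the pairs of labels that a cut separates
(`sum_mixedDiff`), and these differences have the right sign by submodularity. So `F` is a cut value in the network
with one chain per variable, unary costs along the chains, mixed differences between the chains, and rigid arcs that
are too expensive for a minimum cut to separate (`F_eq_net`, `netCap_represents`).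

The algorithm computes the bounds, `Ω`, the mesh and the network, and finds a minimum cut with `V` nodes in
`O(V³)` steps by push-relabel, with current arcs and passes over the nodes. Nodes of height at least `V` are never
discharged; when no node is active, the nodes above a height that no node has form the source side of a minimum cut
(`Inv.isMin_of_gap`), and such a height exists by counting (`Inv.exists_gap`). The number of steps is
bounded by a potential that every step lowers (`potential_step`, `potential_le`). For the execution time it
suffices to count passes through loops, as a fixed program does a bounded amount of work in each (`Runs`). Finally
`V³` is at most a constant times the time bound if `γ ≤ 1` (`sum_meshCount_le`), and `Ω` is polynomial in `n` for
logarithmic degrees and bounded potentials and weights, because no `ηᵢ` is smaller than an inverse power of `n`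
times a constant (`timeBound_polynomial`).
-/

noncomputable section
namespace Bethe
open MRF

/-! ### The optimal pair marginal of an edge -/

theorem xi_of_pos {a : ℝ} (ha : 0 < a) (x y : ℝ) :
    xi a x y = ((1 + a * (x + y)) - √((1 + a * (x + y)) ^ 2 - 4 * a * (1 + a) * (x * y))) / (2 * a) := by
  simp [xi, ha.ne']

theorem xi_comm (a x y : ℝ) : xi a x y = xi a y x := by
  simp only [xi, add_comm x y, mul_comm x y]

/-- The discriminant of the equation for `ξ` is positive on the unit square. -/
theorem disc_pos {a x y : ℝ} (ha : 0 < a) (hx : x ∈ Set.Icc (0 : ℝ) 1) (hy : y ∈ Set.Icc (0 : ℝ) 1) :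
    0 < (1 + a * (x + y)) ^ 2 - 4 * a * (1 + a) * (x * y) := by
  have h1 : 0 ≤ x * (1 - y) := mul_nonneg hx.1 (sub_nonneg.2 hy.2)
  have h2 : 0 ≤ y * (1 - x) := mul_nonneg hy.1 (sub_nonneg.2 hx.2)
  have : (1 + a * (x + y)) ^ 2 - 4 * a * (1 + a) * (x * y)
      = 1 + 2 * a * (x * (1 - y) + y * (1 - x)) + (a * (x - y)) ^ 2 := by ring
  rw [this]; positivity

theorem sqrt_disc {a : ℝ} (ha : 0 < a) (x y : ℝ) :
    √((1 + a * (x + y)) ^ 2 - 4 * a * (1 + a) * (x * y))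
      = 1 + a * (x - xi a x y) + a * (y - xi a x y) := by
  rw [xi_of_pos ha]; field_simp; ring

/-- The conjugate form of `ξ`, which involves no division by zero and holds for `α = 0` too. -/
theorem xi_eq_conj {a x y : ℝ} (ha : 0 < a) (hx : x ∈ Set.Icc (0 : ℝ) 1) (hy : y ∈ Set.Icc (0 : ℝ) 1) :
    xi a x y = 2 * (1 + a) * (x * y)
      / (1 + a * (x + y) + √((1 + a * (x + y)) ^ 2 - 4 * a * (1 + a) * (x * y))) := by
  have hD := (disc_pos ha hx hy).le
  have hB : 0 < 1 + a * (x + y) := by have := mul_nonneg ha.le (add_nonneg hx.1 hy.1); linarith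
  have hs := Real.sqrt_nonneg ((1 + a * (x + y)) ^ 2 - 4 * a * (1 + a) * (x * y))
  rw [xi_of_pos ha, div_eq_div_iff (by positivity) (by positivity)]
  linear_combination -Real.sq_sqrt hD

/-- The cross ratio of the pair marginal is `1 + α = exp W`. -/
theorem xi_cross {a x y : ℝ} (ha : 0 < a) (hx : x ∈ Set.Icc (0 : ℝ) 1)
    (hy : y ∈ Set.Icc (0 : ℝ) 1) :
    xi a x y * (1 + xi a x y - x - y) = (1 + a) * ((x - xi a x y) * (y - xi a x y)) := by
  have h := Real.sq_sqrt (disc_pos ha hx hy).le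
  rw [sqrt_disc ha] at h
  have h' : 4 * a * (xi a x y * (1 + xi a x y - x - y)
      - (1 + a) * ((x - xi a x y) * (y - xi a x y))) = 0 := by linear_combination -h
  have := (mul_eq_zero.1 h').resolve_left (by positivity)
  linarith

/-- All four probabilities of the optimal pair marginal are positive inside the unit square. -/
theorem xi_bounds {a x y : ℝ} (ha : 0 < a) (hx : x ∈ Set.Ioo (0 : ℝ) 1)
    (hy : y ∈ Set.Ioo (0 : ℝ) 1) :
    0 < xi a x y ∧ 0 < x - xi a x y ∧ 0 < y - xi a x y ∧ 0 < 1 + xi a x y - x - y := by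
  obtain ⟨hx0, hx1⟩ := hx
  obtain ⟨hy0, hy1⟩ := hy
  have hD := disc_pos ha ⟨hx0.le, hx1.le⟩ ⟨hy0.le, hy1.le⟩
  have hs := Real.sq_sqrt hD.le
  have hs0 := Real.sqrt_pos.2 hD
  have e : 2 * a * xi a x y
      = (1 + a * (x + y)) - √((1 + a * (x + y)) ^ 2 - 4 * a * (1 + a) * (x * y)) := by
    rw [xi_of_pos ha]; field_simp
  set s := √((1 + a * (x + y)) ^ 2 - 4 * a * (1 + a) * (x * y))
  have p1 : 0 < a * x := by positivity
  have p2 : 0 < a * y := by positivity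
  have p3 : 0 < a * x * y := by positivity
  have p4 : 0 < a * (1 - x) := mul_pos ha (by linarith)
  have p5 : 0 < a * (1 - y) := mul_pos ha (by linarith)
  have p6 : 0 < a * x * (1 - y) := mul_pos p1 (by linarith)
  have p7 : 0 < a * y * (1 - x) := mul_pos p2 (by linarith)
  have p8 : 0 < (1 - x) * (1 - y) := mul_pos (by linarith) (by linarith)
  have a1 : s < 1 + a * (x + y) :=
    lt_of_pow_lt_pow_left₀ 2 (by nlinarith) (by nlinarith [mul_pos p3 ha])
  have a2 : 1 + a * (y - x) < s := by
    by_contra! hc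
    have := pow_le_pow_left₀ hs0.le hc 2
    nlinarith
  have a3 : 1 + a * (x - y) < s := by
    by_contra! hc
    have := pow_le_pow_left₀ hs0.le hc 2
    nlinarith
  have a4 : s < 1 + a * (2 - x - y) :=
    lt_of_pow_lt_pow_left₀ 2 (by nlinarith) (by nlinarith [mul_pos ha p8, mul_pos (mul_pos ha ha) p8])
  have h2a : 0 < 2 * a := by linarith
  refine ⟨?_, ?_, ?_, ?_⟩ <;> refine pos_of_mul_pos_right (a := 2 * a) ?_ h2a.le <;> nlinarith

theorem xi_zero_right {a x : ℝ} (ha : 0 < a) (hx : 0 ≤ x) : xi a x 0 = 0 := by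
  rw [xi_of_pos ha]
  have : 0 ≤ 1 + a * (x + 0) := by positivity
  simp only [mul_zero, sub_zero]
  rw [Real.sqrt_sq this]; simp

theorem xi_one_right {a x : ℝ} (ha : 0 < a) (hx : x ≤ 1) : xi a x 1 = x := by
  rw [xi_of_pos ha]
  have h0 : 0 ≤ 1 + a * (1 - x) := by nlinarith
  have : (1 + a * (x + 1)) ^ 2 - 4 * a * (1 + a) * (x * 1) = (1 + a * (1 - x)) ^ 2 := by ring
  rw [this, Real.sqrt_sq h0]; field_simp; ring

theorem continuous_xi (a : ℝ) : Continuous fun p : ℝ × ℝ => xi a p.1 p.2 := by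
  unfold xi; split_ifs
  · fun_prop
  · fun_prop

/-- The derivative of `ξ` along a curve, in terms of the pair marginal. -/
theorem hasDerivAt_xi {a : ℝ} (ha : 0 < a) {X Y : ℝ → ℝ} {X' Y' t : ℝ} (hX : HasDerivAt X X' t)
    (hY : HasDerivAt Y Y' t) (hx : X t ∈ Set.Ioo (0 : ℝ) 1) (hy : Y t ∈ Set.Ioo (0 : ℝ) 1) :
    HasDerivAt (fun t => xi a (X t) (Y t))
      (((Y t + a * (Y t - xi a (X t) (Y t))) * X' + (X t + a * (X t - xi a (X t) (Y t))) * Y') /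
        (1 + a * (X t - xi a (X t) (Y t)) + a * (Y t - xi a (X t) (Y t)))) t := by
  have hD := disc_pos ha ⟨hx.1.le, hx.2.le⟩ ⟨hy.1.le, hy.2.le⟩
  have e : (fun t => xi a (X t) (Y t)) = fun t => ((1 + a * (X t + Y t))
      - √((1 + a * (X t + Y t)) ^ 2 - 4 * a * (1 + a) * (X t * Y t))) / (2 * a) := by
    funext t; exact xi_of_pos ha _ _
  have h1 : HasDerivAt (fun t => 1 + a * (X t + Y t)) (a * (X' + Y')) t :=
    ((hX.add hY).const_mul a).const_add 1
  have h2 : HasDerivAt (fun t => (1 + a * (X t + Y t)) ^ 2 - 4 * a * (1 + a) * (X t * Y t))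
      (2 * (1 + a * (X t + Y t)) * (a * (X' + Y')) - 4 * a * (1 + a) * (X' * Y t + X t * Y')) t := by
    refine ((h1.pow 2).sub ((hX.mul hY).const_mul (4 * a * (1 + a)))).congr_deriv ?_
    simp
  have h3 := (h1.sub (h2.sqrt hD.ne')).div_const (2 * a)
  rw [e]
  refine h3.congr_deriv ?_
  have hs : 0 < 1 + a * (X t - xi a (X t) (Y t)) + a * (Y t - xi a (X t) (Y t)) := by
    rw [← sqrt_disc ha]; exact Real.sqrt_pos.2 hD
  rw [sqrt_disc ha]
  field_simp
  ring

/-- The partial derivative of an edge term in its first argument,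
`log (p(1,0) / p(0,0))`. -/
def edgeSlope (a x y : ℝ) : ℝ :=
  Real.log (x - xi a x y) - Real.log (1 + xi a x y - x - y)

/-- The denominator of the second derivatives of an edge term. -/
def hessDen (a x y : ℝ) : ℝ :=
  x * (1 - x) * (y * (1 - y)) - (xi a x y - x * y) ^ 2

theorem hasDerivAt_neg_entropy {P : ℝ → ℝ} {P' t : ℝ} (hP : HasDerivAt P P' t) (h : P t ≠ 0) :
    HasDerivAt (fun t => Real.negMulLog (P t)) (-(P' * (Real.log (P t) + 1))) t := by
  refine ((Real.hasDerivAt_negMulLog h).comp t hP).congr_deriv ?_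
  ring

/-- The envelope theorem for an edge: since `ξ` is stationary, its derivative drops out. -/
theorem hasDerivAt_edge {w : ℝ} (hw : 0 < w) {X Y : ℝ → ℝ} {X' Y' t : ℝ} (hX : HasDerivAt X X' t)
    (hY : HasDerivAt Y Y' t) (hx : X t ∈ Set.Ioo (0 : ℝ) 1) (hy : Y t ∈ Set.Ioo (0 : ℝ) 1) :
    HasDerivAt (fun t => -(w * xi (Real.exp w - 1) (X t) (Y t))
        - pairEntropy (xi (Real.exp w - 1) (X t) (Y t)) (X t) (Y t))
      (X' * edgeSlope (Real.exp w - 1) (X t) (Y t) + Y' * edgeSlope (Real.exp w - 1) (Y t) (X t)) t := by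
  have ha : 0 < Real.exp w - 1 := by have := Real.add_one_lt_exp hw.ne'; linarith
  have hc := xi_cross ha ⟨hx.1.le, hx.2.le⟩ ⟨hy.1.le, hy.2.le⟩
  obtain ⟨b1, b2, b3, b4⟩ := xi_bounds ha hx hy
  have hξ := hasDerivAt_xi ha hX hY hx hy
  set a := Real.exp w - 1 with haw
  generalize ((Y t + a * (Y t - xi a (X t) (Y t))) * X' + (X t + a * (X t - xi a (X t) (Y t))) * Y') /
        (1 + a * (X t - xi a (X t) (Y t)) + a * (Y t - xi a (X t) (Y t))) = ξ' at hξ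
  have k4 : HasDerivAt (fun t => 1 + xi a (X t) (Y t) - X t - Y t) (ξ' - X' - Y') t :=
    ((hξ.const_add 1).sub hX).sub hY
  have H := (hξ.const_mul w).neg.sub ((((hasDerivAt_neg_entropy k4 b4.ne').add
    (hasDerivAt_neg_entropy (hX.sub hξ) b2.ne')).add (hasDerivAt_neg_entropy (hY.sub hξ) b3.ne')).add
    (hasDerivAt_neg_entropy hξ b1.ne'))
  have hlog : w = Real.log (xi a (X t) (Y t)) + Real.log (1 + xi a (X t) (Y t) - X t - Y t)
      - Real.log (X t - xi a (X t) (Y t)) - Real.log (Y t - xi a (X t) (Y t)) := by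
    have := congrArg Real.log hc
    rw [Real.log_mul b1.ne' b4.ne', Real.log_mul (by positivity) (by positivity),
      Real.log_mul b2.ne' b3.ne', show 1 + a = Real.exp w by rw [haw]; ring, Real.log_exp] at this
    linarith
  refine H.congr_deriv ?_
  simp only [edgeSlope, xi_comm a (Y t) (X t), Pi.sub_apply,
    show 1 + xi a (X t) (Y t) - Y t - X t = 1 + xi a (X t) (Y t) - X t - Y t by ring]
  linear_combination (-ξ') * hlog

/-- `T = x(1-x)y(1-y) - (ξ-xy)²` written through the discriminant. -/
theorem hessDen_eq {a x y : ℝ} (ha : 0 < a) (hx : x ∈ Set.Ioo (0 : ℝ) 1) (hy : y ∈ Set.Ioo (0 : ℝ) 1) :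
    hessDen a x y = (1 + a * (x - xi a x y) + a * (y - xi a x y))
      * ((x - xi a x y) * (y - xi a x y)) := by
  have hc := xi_cross ha ⟨hx.1.le, hx.2.le⟩ ⟨hy.1.le, hy.2.le⟩
  unfold hessDen
  generalize xi a x y = z at *
  linear_combination (x + y - 2 * z) * hc

theorem hessDen_pos {a x y : ℝ} (ha : 0 < a) (hx : x ∈ Set.Ioo (0 : ℝ) 1) (hy : y ∈ Set.Ioo (0 : ℝ) 1) :
    0 < hessDen a x y := by
  obtain ⟨b1, b2, b3, b4⟩ := xi_bounds ha hx hy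
  rw [hessDen_eq ha hx hy]; positivity

/-- The second derivatives of an edge term. -/
theorem hasDerivAt_edgeSlope {a : ℝ} (ha : 0 < a) {X Y : ℝ → ℝ} {X' Y' t : ℝ}
    (hX : HasDerivAt X X' t) (hY : HasDerivAt Y Y' t) (hx : X t ∈ Set.Ioo (0 : ℝ) 1)
    (hy : Y t ∈ Set.Ioo (0 : ℝ) 1) :
    HasDerivAt (fun t => edgeSlope a (X t) (Y t))
      ((Y t * (1 - Y t) * X' - (xi a (X t) (Y t) - X t * Y t) * Y') / hessDen a (X t) (Y t)) t := by
  have hc := xi_cross ha ⟨hx.1.le, hx.2.le⟩ ⟨hy.1.le, hy.2.le⟩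
  obtain ⟨b1, b2, b3, b4⟩ := xi_bounds ha hx hy
  have hξ := hasDerivAt_xi ha hX hY hx hy
  rw [hessDen_eq ha hx hy]
  unfold edgeSlope
  have H := ((hX.sub hξ).log b2.ne').sub ((((hξ.const_add 1).sub hX).sub hY).log b4.ne')
  refine H.congr_deriv ?_
  simp only [Pi.sub_apply]
  generalize xi a (X t) (Y t) = z at *
  generalize X t = x at *
  generalize Y t = y at *
  have hs : 0 < 1 + a * (x - z) + a * (y - z) := by positivity
  have e1 : X' - ((y + a * (y - z)) * X' + (x + a * (x - z)) * Y') / (1 + a * (x - z) + a * (y - z))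
      = ((1 - y + a * (x - z)) * X' - (x + a * (x - z)) * Y') / (1 + a * (x - z) + a * (y - z)) := by
    field_simp; ring
  have e2 : ((y + a * (y - z)) * X' + (x + a * (x - z)) * Y') / (1 + a * (x - z) + a * (y - z)) - X' - Y'
      = -((1 - y + a * (x - z)) * X' + (1 - x + a * (y - z)) * Y')
        / (1 + a * (x - z) + a * (y - z)) := by
    field_simp; ring
  rw [e1, e2, div_div, div_div, div_sub_div _ _ (by positivity) (by positivity),
    div_eq_div_iff (by positivity) (by positivity)]
  linear_combination (1 + a * (x - z) + a * (y - z)) ^ 2 * (x - z)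
    * (-(1 - y) * X' + (1 + z - x - y - (y - z)) * Y') * hc
end Bethe
end

noncomputable section
namespace Bethe
open MRF

/-! ### Bounds for the second derivatives of an edge term -/

theorem exp_sub_one_pos {w : ℝ} (hw : 0 < w) : 0 < Real.exp w - 1 := by
  have := Real.add_one_lt_exp hw.ne'; linarith

/-- The covariance of the pair marginal. -/
theorem xi_sub_mul {a x y : ℝ} (ha : 0 < a) (hx : x ∈ Set.Icc (0 : ℝ) 1) (hy : y ∈ Set.Icc (0 : ℝ) 1) :
    xi a x y - x * y = a * ((x - xi a x y) * (y - xi a x y)) := by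
  linear_combination xi_cross ha hx hy

theorem xi_sub_mul_pos {a x y : ℝ} (ha : 0 < a) (hx : x ∈ Set.Ioo (0 : ℝ) 1)
    (hy : y ∈ Set.Ioo (0 : ℝ) 1) : 0 < xi a x y - x * y := by
  obtain ⟨b1, b2, b3, b4⟩ := xi_bounds ha hx hy
  rw [xi_sub_mul ha ⟨hx.1.le, hx.2.le⟩ ⟨hy.1.le, hy.2.le⟩]; positivity

/-- The covariance is at most `α / (1 + α)` times the geometric mean of the variances. -/
theorem hessDen_ge {a x y : ℝ} (ha : 0 < a) (hx : x ∈ Set.Ioo (0 : ℝ) 1) (hy : y ∈ Set.Ioo (0 : ℝ) 1) :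
    (2 * a + 1) / (a + 1) ^ 2 * (x * (1 - x) * (y * (1 - y))) ≤ hessDen a x y := by
  obtain ⟨b1, b2, b3, b4⟩ := xi_bounds ha hx hy
  have hc := xi_cross ha ⟨hx.1.le, hx.2.le⟩ ⟨hy.1.le, hy.2.le⟩
  have e : xi a x y - x * y = a / (1 + a) * (xi a x y * (1 + xi a x y - x - y)) := by
    field_simp; linear_combination hc
  have h1 : xi a x y * (1 + xi a x y - x - y) ≤ x * (1 - x) := by
    apply mul_le_mul <;> linarith [hx.1, hy.1]
  have h2 : xi a x y * (1 + xi a x y - x - y) ≤ y * (1 - y) := by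
    apply mul_le_mul <;> linarith [hx.1, hy.1]
  have h3 : (xi a x y * (1 + xi a x y - x - y)) ^ 2 ≤ x * (1 - x) * (y * (1 - y)) := by
    rw [sq]; exact mul_le_mul h1 h2 (by positivity) (by nlinarith [hx.1, hx.2])
  unfold hessDen
  rw [e, mul_pow]
  have h4 : (a / (1 + a)) ^ 2 * (xi a x y * (1 + xi a x y - x - y)) ^ 2
      ≤ (a / (1 + a)) ^ 2 * (x * (1 - x) * (y * (1 - y))) := by gcongr
  have h5 : (2 * a + 1) / (a + 1) ^ 2 = 1 - (a / (1 + a)) ^ 2 := by field_simp; ring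
  rw [h5]; linarith

/-- An edge contributes `y (1 - y) / T` to the diagonal of the Hessian; this gives the bound `b`. -/
theorem hess_diag_le {a x y : ℝ} (ha : 0 < a) (hx : x ∈ Set.Ioo (0 : ℝ) 1) (hy : y ∈ Set.Ioo (0 : ℝ) 1) :
    y * (1 - y) / hessDen a x y ≤ 1 / (x * (1 - x)) * ((a + 1) ^ 2 / (2 * a + 1)) := by
  have hX : 0 < x * (1 - x) := mul_pos hx.1 (by linarith [hx.2])
  have hY : 0 < y * (1 - y) := mul_pos hy.1 (by linarith [hy.2])
  have h := hessDen_ge ha hx hy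
  rw [div_le_iff₀ (hessDen_pos ha hx hy)]
  calc y * (1 - y) = 1 / (x * (1 - x)) * ((a + 1) ^ 2 / (2 * a + 1))
        * ((2 * a + 1) / (a + 1) ^ 2 * (x * (1 - x) * (y * (1 - y)))) := by
        have := hx.1.ne'; have := (sub_pos.2 hx.2).ne'
        field_simp
    _ ≤ _ := by gcongr

/-- The off-diagonal entries of the Hessian are `-(ξ - x y) / T`. With `ξ - x y = α / (1 + α) · p(1,1) p(0,0)`
and `p(1,1) ≤ y`, `p(0,0) ≤ 1 - y` the lower bound for `T` leaves only the variance of `x`. -/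
theorem hess_off_le {a x y : ℝ} (ha : 0 < a) (hx : x ∈ Set.Ioo (0 : ℝ) 1) (hy : y ∈ Set.Ioo (0 : ℝ) 1) :
    (xi a x y - x * y) / hessDen a x y ≤ a * (a + 1) / (2 * a + 1) / (x * (1 - x)) := by
  obtain ⟨b1, b2, b3, b4⟩ := xi_bounds ha hx hy
  have hX : 0 < x * (1 - x) := mul_pos hx.1 (by linarith [hx.2])
  have hY : 0 < y * (1 - y) := mul_pos hy.1 (by linarith [hy.2])
  have h := hessDen_ge ha hx hy
  have hc := xi_cross ha ⟨hx.1.le, hx.2.le⟩ ⟨hy.1.le, hy.2.le⟩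
  have e : xi a x y - x * y = a / (1 + a) * (xi a x y * (1 + xi a x y - x - y)) := by
    field_simp; linear_combination hc
  have h2 : xi a x y * (1 + xi a x y - x - y) ≤ y * (1 - y) := by
    apply mul_le_mul <;> linarith [hx.1, hy.1]
  rw [div_le_iff₀ (hessDen_pos ha hx hy), e]
  calc a / (1 + a) * (xi a x y * (1 + xi a x y - x - y)) ≤ a / (1 + a) * (y * (1 - y)) := by gcongr
    _ = a * (a + 1) / (2 * a + 1) / (x * (1 - x))
        * ((2 * a + 1) / (a + 1) ^ 2 * (x * (1 - x) * (y * (1 - y)))) := by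
        have := hx.1.ne'; have := (sub_pos.2 hx.2).ne'
        field_simp; ring
    _ ≤ _ := by gcongr

/-! ### Monotonicity of the slope of an edge term -/

/-- The slope of an edge term is the logit of `x` minus a term that depends on
`p(Y = 1 | X = 0)`. -/
theorem edgeSlope_eq {a x y : ℝ} (ha : 0 < a) (hx : x ∈ Set.Ioo (0 : ℝ) 1) (hy : y ∈ Set.Ioo (0 : ℝ) 1) :
    edgeSlope a x y = Real.log x - Real.log (1 - x) - Real.log (1 + a * ((y - xi a x y) / (1 - x))) := by
  obtain ⟨b1, b2, b3, b4⟩ := xi_bounds ha hx hy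
  have hc := xi_cross ha ⟨hx.1.le, hx.2.le⟩ ⟨hy.1.le, hy.2.le⟩
  have hx0 := hx.1
  have hx1 : 0 < 1 - x := by linarith [hx.2]
  have e : 1 + a * ((y - xi a x y) / (1 - x))
      = x * (1 + xi a x y - x - y) / ((1 - x) * (x - xi a x y)) := by
    field_simp; linear_combination -hc
  rw [e, Real.log_div (by positivity) (by positivity), Real.log_mul hx0.ne' b4.ne',
    Real.log_mul hx1.ne' b2.ne', edgeSlope]
  ring

/-- The quantity is `p(Y = 1 | X = 0)`. -/
theorem condProb_le_one {a x y : ℝ} (ha : 0 < a) (hx : x ∈ Set.Ioo (0 : ℝ) 1)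
    (hy : y ∈ Set.Ioo (0 : ℝ) 1) :
    0 < (y - xi a x y) / (1 - x) ∧ (y - xi a x y) / (1 - x) ≤ 1 := by
  obtain ⟨b1, b2, b3, b4⟩ := xi_bounds ha hx hy
  have hx1 : 0 < 1 - x := by linarith [hx.2]
  exact ⟨by positivity, by rw [div_le_one hx1]; linarith⟩

theorem edgeSlope_le_logit {a x y : ℝ} (ha : 0 < a) (hx : x ∈ Set.Ioo (0 : ℝ) 1)
    (hy : y ∈ Set.Ioo (0 : ℝ) 1) : edgeSlope a x y ≤ Real.log x - Real.log (1 - x) := by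
  have h := condProb_le_one ha hx hy
  rw [edgeSlope_eq ha hx hy]
  have : 0 ≤ Real.log (1 + a * ((y - xi a x y) / (1 - x))) :=
    Real.log_nonneg (by have := mul_pos ha h.1; linarith)
  linarith

theorem logit_sub_le_edgeSlope {w x y : ℝ} (hw : 0 < w) (hx : x ∈ Set.Ioo (0 : ℝ) 1)
    (hy : y ∈ Set.Ioo (0 : ℝ) 1) :
    Real.log x - Real.log (1 - x) - w ≤ edgeSlope (Real.exp w - 1) x y := by
  have ha := exp_sub_one_pos hw
  have h := condProb_le_one ha hx hy
  rw [edgeSlope_eq ha hx hy]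
  set u := (y - xi (Real.exp w - 1) x y) / (1 - x)
  have hu := mul_pos ha h.1
  have : Real.log (1 + (Real.exp w - 1) * u) ≤ w := by
    rw [← Real.log_exp w]
    apply Real.log_le_log (by rw [Real.log_exp]; linarith)
    rw [Real.log_exp]; nlinarith [h.2]
  linarith

/-- The estimate behind the lower bounds of Bethe bound propagation. -/
theorem condProb_ge {a x y : ℝ} (ha : 0 < a) (hx : x ∈ Set.Ioo (0 : ℝ) 1) (hy : y ∈ Set.Ioo (0 : ℝ) 1) :
    y / (1 + a * x * (1 - y)) ≤ (y - xi a x y) / (1 - x) := by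
  obtain ⟨b1, b2, b3, b4⟩ := xi_bounds ha hx hy
  have hc := xi_cross ha ⟨hx.1.le, hx.2.le⟩ ⟨hy.1.le, hy.2.le⟩
  have hx1 : 0 < 1 - x := by linarith [hx.2]
  have hd : 0 < 1 + a * x * (1 - y) := by
    have := mul_pos (mul_pos ha hx.1) (sub_pos.2 hy.2); linarith
  rw [div_le_div_iff₀ hd hx1]
  have e : (y - xi a x y) * (1 + a * x * (1 - y)) - y * (1 - x)
      = a ^ 2 * (x - xi a x y) * (y - xi a x y) ^ 2 := by
    linear_combination (-1 + a * (y - xi a x y)) * hc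
  have : 0 ≤ a ^ 2 * (x - xi a x y) * (y - xi a x y) ^ 2 := by positivity
  linarith

/-- The estimate behind the upper bounds of Bethe bound propagation. -/
theorem condProb_le {a x y : ℝ} (ha : 0 < a) (hx : x ∈ Set.Ioo (0 : ℝ) 1) (hy : y ∈ Set.Ioo (0 : ℝ) 1) :
    (1 + a * ((y - xi a x y) / (1 - x))) * (1 + a * (1 - y) / (1 + a * (1 - x) * y)) ≤ 1 + a := by
  obtain ⟨b1, b2, b3, b4⟩ := xi_bounds ha hx hy
  have hc := xi_cross ha ⟨hx.1.le, hx.2.le⟩ ⟨hy.1.le, hy.2.le⟩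
  have hx1 : 0 < 1 - x := by linarith [hx.2]
  have hx0 := hx.1
  have hd : 0 < 1 + a * (1 - x) * y := by have := mul_pos (mul_pos ha hx1) hy.1; linarith
  have h1 : (1 - y) / (1 + a * (1 - x) * y) ≤ (x - xi a x y) / x := by
    rw [div_le_div_iff₀ hd hx0]
    have e : (x - xi a x y) * (1 + a * (1 - x) * y) - (1 - y) * x
        = a ^ 2 * (y - xi a x y) * (x - xi a x y) ^ 2 := by
      linear_combination (-1 + a * (x - xi a x y)) * hc
    have : 0 ≤ a ^ 2 * (y - xi a x y) * (x - xi a x y) ^ 2 := by positivity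
    linarith
  have h2 : (1 + a * ((y - xi a x y) / (1 - x))) * (1 + a * ((x - xi a x y) / x)) = 1 + a := by
    field_simp; linear_combination (-a) * hc
  rw [← h2, mul_div_assoc]
  have := (condProb_le_one ha hx hy).1
  gcongr

/-- The mixed derivative of an edge term is `-(ξ - x y) / T`, and the covariance `ξ - x y` of the pair
marginal is positive for an attractive edge. -/
theorem edgeSlope_antitoneOn {a x : ℝ} (ha : 0 < a) (hx : x ∈ Set.Ioo (0 : ℝ) 1) :
    AntitoneOn (edgeSlope a x) (Set.Ioo 0 1) := by
  have hd : ∀ y ∈ Set.Ioo (0 : ℝ) 1, HasDerivAt (edgeSlope a x)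
      ((y * (1 - y) * 0 - (xi a x y - x * y) * 1) / hessDen a x y) y := fun y hy =>
    hasDerivAt_edgeSlope ha (hasDerivAt_const y x) (hasDerivAt_id y) hx hy
  refine antitoneOn_of_deriv_nonpos (convex_Ioo 0 1)
    (fun y hy => (hd y hy).continuousAt.continuousWithinAt)
    (fun y hy => (hd y (interior_subset hy)).differentiableAt.differentiableWithinAt) fun y hy => ?_
  have hy := interior_subset hy
  rw [(hd y hy).deriv]
  have := (xi_sub_mul_pos ha hx hy).le
  exact div_nonpos_of_nonpos_of_nonneg (by linarith) (hessDen_pos ha hx hy).le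

/-! ### The edge terms -/

/-- The pairwise term `-w ξ - S` of an edge of weight `w`. -/
def edgeFn (w x y : ℝ) : ℝ :=
  -(w * xi (Real.exp w - 1) x y) - pairEntropy (xi (Real.exp w - 1) x y) x y

theorem edgeFn_comm (w x y : ℝ) : edgeFn w x y = edgeFn w y x := by
  unfold edgeFn pairEntropy
  rw [xi_comm _ x y, show 1 + xi (Real.exp w - 1) y x - x - y = 1 + xi (Real.exp w - 1) y x - y - x by ring]
  ring

theorem continuous_edgeFn (w : ℝ) : Continuous fun p : ℝ × ℝ => edgeFn w p.1 p.2 := by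
  have := continuous_xi (Real.exp w - 1)
  unfold edgeFn pairEntropy
  fun_prop

theorem edgeFn_zero_right {w x : ℝ} (hw : 0 < w) (hx : 0 ≤ x) : edgeFn w x 0 = -Real.binEntropy x := by
  unfold edgeFn pairEntropy
  rw [xi_zero_right (exp_sub_one_pos hw) hx, Real.binEntropy_eq_negMulLog_add_negMulLog_one_sub]
  simp; ring

theorem edgeFn_one_right {w x : ℝ} (hw : 0 < w) (hx : x ≤ 1) :
    edgeFn w x 1 = -Real.binEntropy x - w * x := by
  unfold edgeFn pairEntropy
  rw [xi_one_right (exp_sub_one_pos hw) hx, Real.binEntropy_eq_negMulLog_add_negMulLog_one_sub]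
  simp; ring

theorem hasDerivAt_edgeFn_left {w x y : ℝ} (hw : 0 < w) (hx : x ∈ Set.Ioo (0 : ℝ) 1)
    (hy : y ∈ Set.Ioo (0 : ℝ) 1) :
    HasDerivAt (fun x => edgeFn w x y) (edgeSlope (Real.exp w - 1) x y) x := by
  have := hasDerivAt_edge hw (hasDerivAt_id x) (hasDerivAt_const x y) hx hy
  exact this.congr_deriv (by simp)

/-- Submodularity: by antitonicity of the slope, `edgeFn w · y' - edgeFn w · y` decreases for `y ≤ y'`. -/
theorem edgeFn_submodular {w x x' y y' : ℝ} (hw : 0 < w) (hx : x ∈ Set.Ioo (0 : ℝ) 1)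
    (hx' : x' ∈ Set.Ioo (0 : ℝ) 1) (hy : y ∈ Set.Ioo (0 : ℝ) 1) (hy' : y' ∈ Set.Ioo (0 : ℝ) 1)
    (hxx : x ≤ x') (hyy : y ≤ y') :
    edgeFn w x y + edgeFn w x' y' ≤ edgeFn w x y' + edgeFn w x' y := by
  have hd : ∀ x ∈ Set.Ioo (0 : ℝ) 1, HasDerivAt (fun x => edgeFn w x y' - edgeFn w x y)
      (edgeSlope (Real.exp w - 1) x y' - edgeSlope (Real.exp w - 1) x y) x := fun x hx =>
    (hasDerivAt_edgeFn_left hw hx hy').sub (hasDerivAt_edgeFn_left hw hx hy)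
  have : AntitoneOn (fun x => edgeFn w x y' - edgeFn w x y) (Set.Ioo 0 1) := by
    refine antitoneOn_of_deriv_nonpos (convex_Ioo 0 1)
      (fun y hy => (hd y hy).continuousAt.continuousWithinAt)
      (fun y hy => (hd y (interior_subset hy)).differentiableAt.differentiableWithinAt) fun x hx => ?_
    have hx := interior_subset hx
    rw [(hd x hx).deriv, sub_nonpos]
    exact edgeSlope_antitoneOn (exp_sub_one_pos hw) hx hy hy' hyy
  have := this hx hx' hxx
  simp only at this
  linarith

/-- Along one argument an edge term decreases at least as fast as the negative entropy, and
increases at least as fast as the negative entropy minus `w x`; this holds for boundary values of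
the other argument too. -/
theorem edgeFn_add_entropy_antitoneOn {w y : ℝ} (hw : 0 < w) (hy : y ∈ Set.Icc (0 : ℝ) 1) :
    AntitoneOn (fun x => edgeFn w x y + Real.binEntropy x) (Set.Icc 0 1) := by
  rcases hy.1.eq_or_lt with rfl | hy0
  · intro x hx x' hx' _
    simp only [edgeFn_zero_right hw hx.1, edgeFn_zero_right hw hx'.1]; linarith
  rcases hy.2.eq_or_lt with rfl | hy1
  · intro x hx x' hx' h
    simp only [edgeFn_one_right hw hx.2, edgeFn_one_right hw hx'.2]; nlinarith
  have hy : y ∈ Set.Ioo (0 : ℝ) 1 := ⟨hy0, hy1⟩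
  have hd : ∀ x ∈ Set.Ioo (0 : ℝ) 1, HasDerivAt (fun x => edgeFn w x y + Real.binEntropy x)
      (edgeSlope (Real.exp w - 1) x y + (Real.log (1 - x) - Real.log x)) x := fun x hx =>
    (hasDerivAt_edgeFn_left hw hx hy).add (Real.hasDerivAt_binEntropy hx.1.ne' hx.2.ne)
  refine antitoneOn_of_deriv_nonpos (convex_Icc 0 1) ?_
    (fun y hy => ?_) fun x hx => ?_
  · have := continuous_edgeFn w
    have h2 : Continuous fun x => edgeFn w x y := this.comp (by fun_prop : Continuous fun x : ℝ => (x, y))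
    exact (h2.add Real.binEntropy_continuous).continuousOn
  · rw [interior_Icc] at hy
    exact (hd y hy).differentiableAt.differentiableWithinAt
  · rw [interior_Icc] at hx
    rw [(hd x hx).deriv]
    linarith [edgeSlope_le_logit (exp_sub_one_pos hw) hx hy]

theorem edgeFn_add_entropy_monotoneOn {w y : ℝ} (hw : 0 < w) (hy : y ∈ Set.Icc (0 : ℝ) 1) :
    MonotoneOn (fun x => edgeFn w x y + Real.binEntropy x + w * x) (Set.Icc 0 1) := by
  rcases hy.1.eq_or_lt with rfl | hy0
  · intro x hx x' hx' h
    simp only [edgeFn_zero_right hw hx.1, edgeFn_zero_right hw hx'.1]; nlinarith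
  rcases hy.2.eq_or_lt with rfl | hy1
  · intro x hx x' hx' h
    simp only [edgeFn_one_right hw hx.2, edgeFn_one_right hw hx'.2]; linarith
  have hy : y ∈ Set.Ioo (0 : ℝ) 1 := ⟨hy0, hy1⟩
  have hd : ∀ x ∈ Set.Ioo (0 : ℝ) 1,
      HasDerivAt (fun x => edgeFn w x y + Real.binEntropy x + w * x)
      (edgeSlope (Real.exp w - 1) x y + (Real.log (1 - x) - Real.log x) + w) x := fun x hx =>
    ((hasDerivAt_edgeFn_left hw hx hy).add (Real.hasDerivAt_binEntropy hx.1.ne' hx.2.ne)).add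
      (by simpa using (hasDerivAt_id x).const_mul w)
  refine monotoneOn_of_deriv_nonneg (convex_Icc 0 1) ?_
    (fun y hy => ?_) fun x hx => ?_
  · have := continuous_edgeFn w
    have h2 : Continuous fun x => edgeFn w x y := this.comp (by fun_prop : Continuous fun x : ℝ => (x, y))
    exact ((h2.add Real.binEntropy_continuous).add (by fun_prop)).continuousOn
  · rw [interior_Icc] at hy
    exact (hd y hy).differentiableAt.differentiableWithinAt
  · rw [interior_Icc] at hx
    rw [(hd x hx).deriv]
    linarith [logit_sub_le_edgeSlope hw hx hy]

theorem sigmoid_le_iff_logit {t x : ℝ} (hx : x ∈ Set.Ioo (0 : ℝ) 1) :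
    Real.sigmoid t ≤ x ↔ t ≤ Real.log x - Real.log (1 - x) := by
  have h1 : 0 < 1 - x := by linarith [hx.2]
  have h0 := hx.1
  rw [← Real.log_div h0.ne' h1.ne', Real.le_log_iff_exp_le (by positivity), Real.sigmoid_def,
    inv_le_iff_one_le_mul₀' (by positivity), le_div_iff₀ h1, Real.exp_neg]
  have := Real.exp_pos t
  rw [← mul_le_mul_iff_of_pos_left this]
  field_simp
  constructor <;> intro h <;> linarith

theorem le_sigmoid_iff_logit {t x : ℝ} (hx : x ∈ Set.Ioo (0 : ℝ) 1) :
    x ≤ Real.sigmoid t ↔ Real.log x - Real.log (1 - x) ≤ t := by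
  have h1 : 0 < 1 - x := by linarith [hx.2]
  have h0 := hx.1
  rw [← Real.log_div h0.ne' h1.ne', Real.log_le_iff_le_exp (by positivity), Real.sigmoid_def,
    le_inv_comm₀ h0 (by positivity), div_le_iff₀ h1, Real.exp_neg]
  have := Real.exp_pos t
  rw [inv_eq_one_div x, le_div_iff₀ h0, ← mul_le_mul_iff_of_pos_left this]
  field_simp
  constructor <;> intro h <;> linarith

/-- `-t x - H(x)` decreases up to `σ(t)` and increases from there on. -/
theorem neg_entropy_strictAntiOn (t : ℝ) :
    StrictAntiOn (fun x => -(t * x) - Real.binEntropy x) (Set.Icc 0 (Real.sigmoid t)) := by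
  refine strictAntiOn_of_deriv_neg (convex_Icc _ _) ?_ fun x hx => ?_
  · exact ((by fun_prop : Continuous fun x : ℝ => -(t * x)).sub Real.binEntropy_continuous).continuousOn
  · rw [interior_Icc] at hx
    have hx' : x ∈ Set.Ioo (0 : ℝ) 1 := ⟨hx.1, hx.2.trans (Real.sigmoid_lt_one t)⟩
    have := (((hasDerivAt_id x).const_mul t).neg).sub (Real.hasDerivAt_binEntropy hx'.1.ne' hx'.2.ne)
    have h := this.deriv
    simp only [mul_one] at h
    have h2 := mt (sigmoid_le_iff_logit hx').2 (not_le.2 hx.2)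
    change deriv ((-fun y => t * id y) - Real.binEntropy) x < 0
    rw [h]; linarith

theorem neg_entropy_strictMonoOn (t : ℝ) :
    StrictMonoOn (fun x => -(t * x) - Real.binEntropy x) (Set.Icc (Real.sigmoid t) 1) := by
  refine strictMonoOn_of_deriv_pos (convex_Icc _ _) ?_ fun x hx => ?_
  · exact ((by fun_prop : Continuous fun x : ℝ => -(t * x)).sub Real.binEntropy_continuous).continuousOn
  · rw [interior_Icc] at hx
    have hx' : x ∈ Set.Ioo (0 : ℝ) 1 := ⟨(Real.sigmoid_pos t).trans hx.1, hx.2⟩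
    have := (((hasDerivAt_id x).const_mul t).neg).sub (Real.hasDerivAt_binEntropy hx'.1.ne' hx'.2.ne)
    have h := this.deriv
    simp only [mul_one] at h
    have h2 := mt (le_sigmoid_iff_logit hx').2 (not_le.2 hx.1)
    change 0 < deriv ((-fun y => t * id y) - Real.binEntropy) x
    rw [h]; linarith

end Bethe
end

noncomputable section
namespace Bethe
namespace MRF

variable {n : ℕ} {M : MRF n}

/-! ### The gradient of the Bethe free energy -/

theorem mem_nbrs {i j : Fin n} : j ∈ M.nbrs i ↔ M.W i j ≠ 0 := by simp [nbrs]

theorem mem_edges {p : Fin n × Fin n} : p ∈ M.edges ↔ p.1 < p.2 ∧ M.W p.1 p.2 ≠ 0 := by simp [edges]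

theorem ne_of_W_ne_zero {i j : Fin n} (h : M.W i j ≠ 0) : i ≠ j := by
  rintro rfl; exact h (M.diag i)

theorem adj_iff {i j : Fin n} : M.graph.Adj i j ↔ M.W i j ≠ 0 := by
  simp only [graph, SimpleGraph.fromRel_adj, M.symm j i, or_self]
  exact ⟨fun h => h.2, fun h => ⟨ne_of_W_ne_zero h, h⟩⟩

theorem Associative.W_pos (hM : M.Associative) {i j : Fin n} (h : M.W i j ≠ 0) : 0 < M.W i j :=
  hM i j (adj_iff.2 h)

theorem Associative.W_nonneg (hM : M.Associative) (i j : Fin n) : 0 ≤ M.W i j := by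
  by_cases h : M.W i j = 0
  · exact h.ge
  · exact (hM.W_pos h).le

theorem Associative.α_pos (hM : M.Associative) {i j : Fin n} (h : M.W i j ≠ 0) : 0 < M.α i j :=
  exp_sub_one_pos (hM.W_pos h)

theorem Associative.α_nonneg (hM : M.Associative) (i j : Fin n) : 0 ≤ M.α i j := by
  have := Real.one_le_exp (hM.W_nonneg i j); unfold α; linarith

theorem α_comm (i j : Fin n) : M.α i j = M.α j i := by unfold α; rw [M.symm]

theorem edgeTerm_eq (i j : Fin n) (x y : ℝ) : M.edgeTerm i j x y = edgeFn (M.W i j) x y := rfl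

/-- Every edge is seen from its two ends. -/
theorem sum_edges_add_swap {R : Type*} [AddCommMonoid R] (φ : Fin n → Fin n → R) :
    ∑ p ∈ M.edges, (φ p.1 p.2 + φ p.2 p.1) = ∑ i, ∑ j ∈ M.nbrs i, φ i j := by
  have e : ∑ i, ∑ j ∈ M.nbrs i, φ i j
      = ∑ p ∈ Finset.univ.filter (fun p : Fin n × Fin n => M.W p.1 p.2 ≠ 0), φ p.1 p.2 := by
    simp only [nbrs, Finset.sum_filter, ← Finset.univ_product_univ, Finset.sum_product]
  rw [e, Finset.sum_add_distrib,
    ← Finset.sum_filter_add_sum_filter_not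
      (Finset.univ.filter fun p : Fin n × Fin n => M.W p.1 p.2 ≠ 0) (fun p : Fin n × Fin n => p.1 < p.2)]
  congr 1
  · refine Finset.sum_congr ?_ fun _ _ => rfl
    ext p; simp [edges, and_comm]
  · refine Finset.sum_bij' (fun p _ => p.swap) (fun p _ => p.swap) ?_ ?_ ?_ ?_ ?_
    · intro p hp
      have := mem_edges.1 hp
      simp only [Finset.mem_filter, Finset.mem_univ, true_and, Prod.fst_swap, Prod.snd_swap, M.symm p.2]
      exact ⟨this.2, not_lt.2 this.1.le⟩
    · intro p hp
      simp only [Finset.mem_filter, Finset.mem_univ, true_and] at hp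
      rw [mem_edges]
      exact ⟨lt_of_le_of_ne (not_lt.1 hp.2) (ne_of_W_ne_zero hp.1).symm,
        by rw [Prod.fst_swap, Prod.snd_swap, M.symm]; exact hp.1⟩
    all_goals simp

/-- The partial derivative of the Bethe free energy with respect to `qᵢ`. -/
def grad (M : MRF n) (q : Fin n → ℝ) (i : Fin n) : ℝ :=
  -M.θ i + ((M.deg i : ℝ) - 1) * (Real.log (1 - q i) - Real.log (q i))
    + ∑ j ∈ M.nbrs i, edgeSlope (M.α i j) (q i) (q j)

/-- Along a line the derivative of the free energy is `∑ vᵢ gradᵢ`: every edge contributes its two partial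
slopes, one to each of its ends. -/
theorem hasDerivAt_F_line (hM : M.Associative) (q v : Fin n → ℝ) {t : ℝ}
    (hq : ∀ i, q i + t * v i ∈ Set.Ioo (0 : ℝ) 1) :
    HasDerivAt (fun t => M.F fun i => q i + t * v i)
      (∑ i, v i * M.grad (fun i => q i + t * v i) i) t := by
  have hl : ∀ i, HasDerivAt (fun t => q i + t * v i) (v i) t := fun i => by
    simpa using ((hasDerivAt_id t).mul_const (v i)).const_add (q i)
  have h1 : HasDerivAt (fun t => ∑ p ∈ M.edges,
      M.edgeTerm p.1 p.2 (q p.1 + t * v p.1) (q p.2 + t * v p.2))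
      (∑ p ∈ M.edges, (v p.1 * edgeSlope (M.α p.1 p.2) (q p.1 + t * v p.1) (q p.2 + t * v p.2)
        + v p.2 * edgeSlope (M.α p.2 p.1) (q p.2 + t * v p.2) (q p.1 + t * v p.1))) t := by
    refine HasDerivAt.fun_sum fun p hp => ?_
    rw [α_comm p.2 p.1]
    exact hasDerivAt_edge (hM.W_pos (mem_edges.1 hp).2) (hl p.1) (hl p.2) (hq p.1) (hq p.2)
  have h2 : HasDerivAt (fun t => ∑ i, (-(M.θ i * (q i + t * v i))
      + ((M.deg i : ℝ) - 1) * Real.binEntropy (q i + t * v i)))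
      (∑ i, (-(M.θ i * v i) + ((M.deg i : ℝ) - 1) *
        ((Real.log (1 - (q i + t * v i)) - Real.log (q i + t * v i)) * v i))) t := by
    refine HasDerivAt.fun_sum fun i _ => ?_
    have := (Real.hasDerivAt_binEntropy (hq i).1.ne' (hq i).2.ne).comp t (hl i)
    exact ((hl i).const_mul _).neg.add (this.const_mul _)
  refine (h1.add h2).congr_deriv ?_
  rw [sum_edges_add_swap fun i j => v i * edgeSlope (M.α i j) (q i + t * v i) (q j + t * v j),
    ← Finset.sum_add_distrib]
  refine Finset.sum_congr rfl fun i _ => ?_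
  rw [grad, ← Finset.mul_sum]; ring

theorem hasDerivAt_grad_line (hM : M.Associative) (q v : Fin n → ℝ) {t : ℝ}
    (hq : ∀ i, q i + t * v i ∈ Set.Ioo (0 : ℝ) 1) (i : Fin n) :
    HasDerivAt (fun t => M.grad (fun i => q i + t * v i) i)
      (((M.deg i : ℝ) - 1) * (-(v i / ((q i + t * v i) * (1 - (q i + t * v i)))))
        + ∑ j ∈ M.nbrs i, ((q j + t * v j) * (1 - (q j + t * v j)) * v i
          - (xi (M.α i j) (q i + t * v i) (q j + t * v j) - (q i + t * v i) * (q j + t * v j)) * v j)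
          / hessDen (M.α i j) (q i + t * v i) (q j + t * v j)) t := by
  have hl : ∀ i, HasDerivAt (fun t => q i + t * v i) (v i) t := fun i => by
    simpa using ((hasDerivAt_id t).mul_const (v i)).const_add (q i)
  have h1 : 0 < q i + t * v i := (hq i).1
  have h2 : 0 < 1 - (q i + t * v i) := sub_pos.2 (hq i).2
  have hlog := (((hl i).const_sub 1).log h2.ne').sub ((hl i).log h1.ne')
  have hs : HasDerivAt (fun t => ∑ j ∈ M.nbrs i,
      edgeSlope (M.α i j) (q i + t * v i) (q j + t * v j)) _ t :=
    HasDerivAt.fun_sum fun j hj => hasDerivAt_edgeSlope (hM.α_pos (mem_nbrs.1 hj)) (hl i) (hl j) (hq i) (hq j)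
  refine (((hlog.const_mul ((M.deg i : ℝ) - 1)).const_add (-M.θ i)).add hs).congr_deriv ?_
  congr 2
  have h3 := h1.ne'; have h4 := h2.ne'
  generalize q i + t * v i = z at *
  field_simp; ring

theorem continuous_F (M : MRF n) : Continuous M.F := by
  unfold F
  refine Continuous.add ?_ ?_
  · refine continuous_finsetSum _ fun p _ => ?_
    simp only [edgeTerm_eq]
    exact (continuous_edgeFn (M.W p.1 p.2)).comp (by fun_prop : Continuous fun q : Fin n → ℝ => (q p.1, q p.2))
  · refine continuous_finsetSum _ fun i _ => ?_
    have : Continuous fun q : Fin n → ℝ => Real.binEntropy (q i) :=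
      Real.binEntropy_continuous.comp (continuous_apply i)
    fun_prop

theorem exists_isMinOn_F (M : MRF n) : ∃ q ∈ Set.Icc (0 : Fin n → ℝ) 1, IsMinOn M.F (Set.Icc 0 1) q :=
  isCompact_Icc.exists_isMinOn ⟨0, by simp⟩ M.continuous_F.continuousOn

/-- The effect of changing one coordinate. -/
theorem F_update_sub (q : Fin n → ℝ) (i : Fin n) (x : ℝ) :
    M.F (Function.update q i x) - M.F q
      = ∑ j ∈ M.nbrs i, (edgeFn (M.W i j) x (q j) - edgeFn (M.W i j) (q i) (q j))
        - M.θ i * (x - q i)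
        + ((M.deg i : ℝ) - 1) * (Real.binEntropy x - Real.binEntropy (q i)) := by
  have h1 : ∑ p ∈ M.edges, (M.edgeTerm p.1 p.2 (Function.update q i x p.1) (Function.update q i x p.2)
        - M.edgeTerm p.1 p.2 (q p.1) (q p.2))
      = ∑ j ∈ M.nbrs i, (edgeFn (M.W i j) x (q j) - edgeFn (M.W i j) (q i) (q j)) := by
    have := sum_edges_add_swap (M := M) fun a b => if a = i then
      edgeFn (M.W i b) x (q b) - edgeFn (M.W i b) (q i) (q b) else 0
    have e : ∀ a, ∑ b ∈ M.nbrs a, (if a = i then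
        edgeFn (M.W i b) x (q b) - edgeFn (M.W i b) (q i) (q b) else 0)
        = if a = i then ∑ b ∈ M.nbrs i, (edgeFn (M.W i b) x (q b) - edgeFn (M.W i b) (q i) (q b)) else 0 := by
      intro a; split_ifs with h
      · rw [h]
      · simp
    simp only [e, Finset.sum_ite_eq', Finset.mem_univ, if_true] at this
    rw [← this]
    refine Finset.sum_congr rfl fun p hp => ?_
    have hne := (mem_edges.1 hp).1.ne
    simp only [edgeTerm_eq]
    by_cases h1 : p.1 = i
    · have h2 : p.2 ≠ i := fun h => hne (h1.trans h.symm)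
      simp [h1, h2]
    · by_cases h2 : p.2 = i
      · simp only [h1, h2, Function.update_self, Function.update_of_ne h1, if_true, if_false, zero_add,
          M.symm p.1 i]
        rw [edgeFn_comm _ (q p.1) x, edgeFn_comm _ (q p.1) (q i)]
      · simp [h1, h2, Function.update_of_ne]
  have h2 : ∑ a, ((-(M.θ a * Function.update q i x a)
        + ((M.deg a : ℝ) - 1) * Real.binEntropy (Function.update q i x a))
        - (-(M.θ a * q a) + ((M.deg a : ℝ) - 1) * Real.binEntropy (q a)))
      = -(M.θ i * (x - q i)) + ((M.deg i : ℝ) - 1) * (Real.binEntropy x - Real.binEntropy (q i)) := by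
    rw [Finset.sum_eq_single i]
    · simp; ring
    · intro b _ hb; simp [Function.update_of_ne hb]
    · simp
  rw [Finset.sum_sub_distrib] at h1 h2
  unfold F
  linear_combination h1 + h2

theorem mem_Icc_iff {q : Fin n → ℝ} : q ∈ Set.Icc (0 : Fin n → ℝ) 1 ↔ ∀ i, q i ∈ Set.Icc (0 : ℝ) 1 := by
  simp [Set.mem_Icc, Pi.le_def, forall_and]

theorem update_mem_Icc {q : Fin n → ℝ} (hq : q ∈ Set.Icc (0 : Fin n → ℝ) 1) (i : Fin n) {x : ℝ}
    (hx : x ∈ Set.Icc (0 : ℝ) 1) : Function.update q i x ∈ Set.Icc (0 : Fin n → ℝ) 1 := by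
  rw [mem_Icc_iff] at *
  intro j
  by_cases h : j = i
  · subst h; simpa using hx
  · simpa [Function.update_of_ne h] using hq j

theorem sum_edgeFn_sub_le {q : Fin n → ℝ} (i : Fin n) {x x' c : ℝ}
    (h : ∀ j ∈ M.nbrs i, edgeFn (M.W i j) x' (q j) - edgeFn (M.W i j) x (q j)
      ≤ -(Real.binEntropy x' - Real.binEntropy x) + c * M.W i j) :
    ∑ j ∈ M.nbrs i, (edgeFn (M.W i j) x' (q j) - edgeFn (M.W i j) x (q j))
      ≤ -((M.deg i : ℝ) * (Real.binEntropy x' - Real.binEntropy x)) + c * M.Wsum i := by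
  refine (Finset.sum_le_sum h).trans_eq ?_
  rw [Finset.sum_add_distrib, Finset.sum_const, ← Finset.mul_sum, nsmul_eq_mul, Wsum, deg]; ring

/-- Minimizers lie in the initial Bethe box. -/
theorem minimizer_mem_side_zero (hM : M.Associative) {q : Fin n → ℝ}
    (hq : q ∈ Set.Icc (0 : Fin n → ℝ) 1) (hmin : IsMinOn M.F (Set.Icc 0 1) q) (i : Fin n) :
    q i ∈ M.side 0 i := by
  have hqi := mem_Icc_iff.1 hq
  have hA : M.A 0 i = Real.sigmoid (M.θ i) := rfl
  have hB : M.B 0 i = 1 - Real.sigmoid (M.θ i + M.Wsum i) := rfl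
  rw [side, hA, hB]
  constructor
  · by_contra! hc
    have hx : Real.sigmoid (M.θ i) ∈ Set.Icc (0 : ℝ) 1 := ⟨Real.sigmoid_nonneg _, Real.sigmoid_le_one _⟩
    have h0 := isMinOn_iff.1 hmin _ (update_mem_Icc hq i hx)
    have h1 := F_update_sub (M := M) q i (Real.sigmoid (M.θ i))
    have h2 := sum_edgeFn_sub_le (M := M) (q := q) i (x := q i) (x' := Real.sigmoid (M.θ i)) (c := 0)
      fun j hj => by
        have := edgeFn_add_entropy_antitoneOn (hM.W_pos (mem_nbrs.1 hj)) (hqi j) (hqi i) hx hc.le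
        simp only at this
        linarith
    have h3 := neg_entropy_strictAntiOn (M.θ i) ⟨(hqi i).1, hc.le⟩ ⟨hx.1, le_rfl⟩ hc
    simp only at h3
    linarith
  · by_contra! hc
    rw [sub_sub_cancel] at hc
    have hx : Real.sigmoid (M.θ i + M.Wsum i) ∈ Set.Icc (0 : ℝ) 1 :=
      ⟨Real.sigmoid_nonneg _, Real.sigmoid_le_one _⟩
    have h0 := isMinOn_iff.1 hmin _ (update_mem_Icc hq i hx)
    have h1 := F_update_sub (M := M) q i (Real.sigmoid (M.θ i + M.Wsum i))
    have h2 := sum_edgeFn_sub_le (M := M) (q := q) i (x := q i)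
      (x' := Real.sigmoid (M.θ i + M.Wsum i)) (c := q i - Real.sigmoid (M.θ i + M.Wsum i))
      fun j hj => by
        have := edgeFn_add_entropy_monotoneOn (hM.W_pos (mem_nbrs.1 hj)) (hqi j) hx (hqi i) hc.le
        simp only at this
        linarith
    have h3 := neg_entropy_strictMonoOn (M.θ i + M.Wsum i) ⟨le_rfl, hx.2⟩ ⟨hc.le, (hqi i).2⟩ hc
    simp only at h3
    linarith

/-- The gradient vanishes at minimizers. -/
theorem grad_minimizer (hM : M.Associative) {q : Fin n → ℝ}
    (hq : ∀ i, q i ∈ Set.Ioo (0 : ℝ) 1) (hmin : IsMinOn M.F (Set.Icc 0 1) q) (i : Fin n) :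
    M.grad q i = 0 := by
  have h := hasDerivAt_F_line hM q (Pi.single i 1) (t := 0) (by simpa using hq)
  have hloc : IsLocalMin (fun t : ℝ => M.F fun j => q j + t * (Pi.single i 1 : Fin n → ℝ) j) 0 := by
    have ho : IsOpen {q : Fin n → ℝ | ∀ i, q i ∈ Set.Ioo (0 : ℝ) 1} := by
      simp only [Set.ofPred_forall]
      exact isOpen_iInter_of_finite fun i => isOpen_Ioo.preimage (continuous_apply i)
    have hc : Continuous fun t : ℝ => (fun j => q j + t * (Pi.single i 1 : Fin n → ℝ) j) := by fun_prop
    have := hc.continuousAt.preimage_mem_nhds (x := 0) (ho.mem_nhds (by simpa using hq))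
    filter_upwards [this] with t ht
    simp only [zero_mul, add_zero]
    exact isMinOn_iff.1 hmin _ (mem_Icc_iff.2 fun i => ⟨(ht i).1.le, (ht i).2.le⟩)
  have := hloc.hasDerivAt_eq_zero h
  simpa [Pi.single_apply] using this

end MRF
end Bethe
end

noncomputable section
namespace Bethe
namespace MRF

variable {n : ℕ} {M : MRF n}

/-! ### The Bethe box contains every minimizer -/

/-- The factors `L` and `U` of Bethe bound propagation. -/
def bbpFactor (M : MRF n) (A B : Fin n → ℝ) (i : Fin n) : ℝ :=
  ∏ j ∈ M.nbrs i, (1 + M.α i j * A j / (1 + M.α i j * (1 - B i) * (1 - A j)))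

theorem A_succ (k : ℕ) (i : Fin n) :
    M.A (k + 1) i = 1 / (1 + Real.exp (-M.θ i) / M.bbpFactor (M.A k) (M.B k) i) := rfl

theorem B_succ (k : ℕ) (i : Fin n) :
    M.B (k + 1) i = 1 / (1 + Real.exp (M.θ i + M.Wsum i) / M.bbpFactor (M.B k) (M.A k) i) := rfl

theorem bbp_term_nonneg {a A B : ℝ} (ha : 0 ≤ a) (hA : A ∈ Set.Ioo (0 : ℝ) 1) (hB : B ∈ Set.Ioo (0 : ℝ) 1) :
    0 ≤ a * A / (1 + a * (1 - B) * (1 - A)) := by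
  have := hA.1; have := sub_pos.2 hA.2; have := sub_pos.2 hB.2
  positivity

theorem Associative.one_le_bbpFactor (hM : M.Associative) {A B : Fin n → ℝ}
    (hA : ∀ i, A i ∈ Set.Ioo (0 : ℝ) 1) (hB : ∀ i, B i ∈ Set.Ioo (0 : ℝ) 1) (i : Fin n) :
    1 ≤ M.bbpFactor A B i := by
  apply Finset.one_le_prod
  intro j
  have := bbp_term_nonneg (hM.α_nonneg i j) (hA j) (hB i)
  intro _
  linarith

theorem A_zero (i : Fin n) : M.A 0 i = Real.sigmoid (M.θ i) := rfl

theorem B_zero (i : Fin n) : M.B 0 i = Real.sigmoid (-(M.θ i + M.Wsum i)) := by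
  rw [Real.sigmoid_neg]; rfl

theorem sigmoid_eq_one_div (t : ℝ) : Real.sigmoid t = 1 / (1 + Real.exp (-t)) := by
  rw [Real.sigmoid_def, one_div]

/-- A round of bound propagation never falls below the initial bound, since its factors are at least `1`. -/
theorem sigmoid_le_bbp {t L : ℝ} (hL : 1 ≤ L) :
    Real.sigmoid t ≤ 1 / (1 + Real.exp (-t) / L) ∧ 1 / (1 + Real.exp (-t) / L) < 1 := by
  have h0 : 0 < L := by linarith
  have h1 := Real.exp_pos (-t)
  rw [sigmoid_eq_one_div]
  constructor
  · gcongr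
    exact div_le_self h1.le hL
  · rw [div_lt_one (by positivity)]
    have : 0 < Real.exp (-t) / L := by positivity
    linarith

theorem Associative.bounds_mem (hM : M.Associative) (k : ℕ) :
    (∀ i, M.A k i ∈ Set.Ioo (0 : ℝ) 1) ∧ ∀ i, M.B k i ∈ Set.Ioo (0 : ℝ) 1 := by
  induction k with
  | zero =>
    exact ⟨fun i => ⟨Real.sigmoid_pos _, Real.sigmoid_lt_one _⟩,
      fun i => by rw [B_zero]; exact ⟨Real.sigmoid_pos _, Real.sigmoid_lt_one _⟩⟩
  | succ k ih =>
    constructor <;> intro i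
    · have := sigmoid_le_bbp (t := M.θ i) (hM.one_le_bbpFactor ih.1 ih.2 i)
      rw [A_succ]; exact ⟨(Real.sigmoid_pos _).trans_le this.1, this.2⟩
    · have := sigmoid_le_bbp (t := -(M.θ i + M.Wsum i)) (hM.one_le_bbpFactor ih.2 ih.1 i)
      rw [neg_neg] at this
      rw [B_succ]; exact ⟨(Real.sigmoid_pos _).trans_le this.1, this.2⟩

/-- The bounds after any number of rounds are at least the initial ones. -/
theorem Associative.sigmoid_le_A (hM : M.Associative) (k : ℕ) (i : Fin n) :
    Real.sigmoid (M.θ i) ≤ M.A k i := by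
  cases k with
  | zero => exact le_rfl
  | succ k =>
    exact (sigmoid_le_bbp (t := M.θ i)
      (hM.one_le_bbpFactor (hM.bounds_mem k).1 (hM.bounds_mem k).2 i)).1

theorem Associative.sigmoid_le_B (hM : M.Associative) (k : ℕ) (i : Fin n) :
    Real.sigmoid (-(M.θ i + M.Wsum i)) ≤ M.B k i := by
  cases k with
  | zero => exact (B_zero i).ge
  | succ k =>
    have := (sigmoid_le_bbp (t := -(M.θ i + M.Wsum i))
      (hM.one_le_bbpFactor (hM.bounds_mem k).2 (hM.bounds_mem k).1 i)).1
    rwa [neg_neg] at this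

theorem Associative.side_subset (hM : M.Associative) (k : ℕ) (i : Fin n) :
    M.side k i ⊆ Set.Ioo 0 1 := fun x hx =>
  ⟨((hM.bounds_mem k).1 i).1.trans_le hx.1, by have := ((hM.bounds_mem k).2 i).1; linarith [hx.2]⟩

/-- At a stationary point the logit of `qᵢ` is determined by the neighbours. -/
theorem logit_eq_of_grad_eq_zero (hM : M.Associative) {q : Fin n → ℝ}
    (hq : ∀ i, q i ∈ Set.Ioo (0 : ℝ) 1) {i : Fin n} (h : M.grad q i = 0) :
    Real.log (q i) - Real.log (1 - q i) = M.θ i + ∑ j ∈ M.nbrs i,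
      Real.log (1 + M.α i j * ((q j - xi (M.α i j) (q i) (q j)) / (1 - q i))) := by
  have e : ∑ j ∈ M.nbrs i, edgeSlope (M.α i j) (q i) (q j)
      = ∑ j ∈ M.nbrs i, ((Real.log (q i) - Real.log (1 - q i))
        - Real.log (1 + M.α i j * ((q j - xi (M.α i j) (q i) (q j)) / (1 - q i)))) :=
    Finset.sum_congr rfl fun j hj => edgeSlope_eq (hM.α_pos (mem_nbrs.1 hj)) (hq i) (hq j)
  rw [grad, e, Finset.sum_sub_distrib, Finset.sum_const, nsmul_eq_mul] at h
  unfold deg at h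
  linarith

/-- A round of Bethe bound propagation keeps the stationary points of the box. -/
theorem mem_side_succ (hM : M.Associative) {q : Fin n → ℝ} {k : ℕ} (hq : ∀ i, q i ∈ M.side k i)
    (hg : ∀ i, M.grad q i = 0) (i : Fin n) : q i ∈ M.side (k + 1) i := by
  have hq' : ∀ i, q i ∈ Set.Ioo (0 : ℝ) 1 := fun i => hM.side_subset k i (hq i)
  have hl := logit_eq_of_grad_eq_zero hM hq' (hg i)
  obtain ⟨hA, hB⟩ := hM.bounds_mem k
  have hL := hM.one_le_bbpFactor hA hB i
  have hU := hM.one_le_bbpFactor hB hA i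
  have hqi := hq' i
  constructor
  · have h1 : Real.log (M.bbpFactor (M.A k) (M.B k) i) ≤ ∑ j ∈ M.nbrs i,
        Real.log (1 + M.α i j * ((q j - xi (M.α i j) (q i) (q j)) / (1 - q i))) := by
      unfold bbpFactor
      rw [Real.log_prod fun j _ => by
        have := bbp_term_nonneg (hM.α_nonneg i j) (hA j) (hB i); linarith]
      refine Finset.sum_le_sum fun j hj => ?_
      have ha := hM.α_pos (mem_nbrs.1 hj)
      have hp := bbp_term_nonneg (hM.α_nonneg i j) (hA j) (hB i)
      apply Real.log_le_log (by linarith)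
      rw [mul_div_assoc]
      have h2 := condProb_ge ha hqi (hq' j)
      have h3 : M.A k j / (1 + M.α i j * (1 - M.B k i) * (1 - M.A k j))
          ≤ q j / (1 + M.α i j * q i * (1 - q j)) := by
        have a1 := (hq j).1
        have a2 := (hq i).2
        have a3 := hqi.1
        have a4 := sub_pos.2 (hq' j).2
        have a5 := (hq' j).1
        have a6 := sub_pos.2 (hB i).2
        gcongr
      have := mul_le_mul_of_nonneg_left (h3.trans h2) ha.le
      linarith
    have h2 : Real.sigmoid (M.θ i + Real.log (M.bbpFactor (M.A k) (M.B k) i)) ≤ q i :=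
      (sigmoid_le_iff_logit hqi).2 (by linarith)
    rw [A_succ]
    refine le_trans (le_of_eq ?_) h2
    rw [sigmoid_eq_one_div, neg_add, Real.exp_add, Real.exp_neg (Real.log _),
      Real.exp_log (by linarith)]
    rfl
  · have h1 : ∑ j ∈ M.nbrs i,
        Real.log (1 + M.α i j * ((q j - xi (M.α i j) (q i) (q j)) / (1 - q i)))
        ≤ M.Wsum i - Real.log (M.bbpFactor (M.B k) (M.A k) i) := by
      unfold bbpFactor Wsum
      rw [Real.log_prod fun j _ => by
        have := bbp_term_nonneg (hM.α_nonneg i j) (hB j) (hA i); linarith, ← Finset.sum_sub_distrib]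
      refine Finset.sum_le_sum fun j hj => ?_
      have ha := hM.α_pos (mem_nbrs.1 hj)
      have hp := bbp_term_nonneg (hM.α_nonneg i j) (hB j) (hA i)
      have hu := mul_pos ha (condProb_le_one ha hqi (hq' j)).1
      have a1 := (hq j).2
      have a2 := (hq i).1
      have a3 := sub_pos.2 hqi.2
      have a4 := sub_pos.2 (hq' j).2
      have a5 := (hq' j).1
      have a6 := sub_pos.2 (hA i).2
      rw [le_sub_iff_add_le, ← Real.log_mul (by linarith) (by linarith), ← Real.log_exp (M.W i j)]
      refine Real.log_le_log (mul_pos (by linarith) (by linarith)) ?_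
      have h2 := condProb_le ha hqi (hq' j)
      have h3 : M.α i j * M.B k j / (1 + M.α i j * (1 - M.A k i) * (1 - M.B k j))
          ≤ M.α i j * (1 - q j) / (1 + M.α i j * (1 - q i) * q j) := by
        have b1 : M.B k j ≤ 1 - q j := by linarith
        have b2 : q j ≤ 1 - M.B k j := a1
        gcongr
      have e : Real.exp (M.W i j) = 1 + M.α i j := by unfold α; ring
      rw [e]
      refine le_trans ?_ h2
      gcongr
    have h2 : q i ≤ Real.sigmoid (M.θ i + M.Wsum i - Real.log (M.bbpFactor (M.B k) (M.A k) i)) :=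
      (le_sigmoid_iff_logit hqi).2 (by linarith)
    have h3 : M.B (k + 1) i
        = 1 - Real.sigmoid (M.θ i + M.Wsum i - Real.log (M.bbpFactor (M.B k) (M.A k) i)) := by
      rw [← Real.sigmoid_neg, sigmoid_eq_one_div, neg_neg, B_succ, Real.exp_sub,
        Real.exp_log (by linarith)]
    linarith

/-- Every global minimizer lies in the Bethe box: for the initial box by comparing entropies, and then
round by round, because the box lies in the open cube, where a minimizer is stationary. -/
theorem minimizer_mem_side (hM : M.Associative) {q : Fin n → ℝ}
    (hq : q ∈ Set.Icc (0 : Fin n → ℝ) 1) (hmin : IsMinOn M.F (Set.Icc 0 1) q) (k : ℕ) (i : Fin n) :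
    q i ∈ M.side k i := by
  induction k generalizing i with
  | zero => exact minimizer_mem_side_zero hM hq hmin i
  | succ k ih =>
    exact mem_side_succ hM ih
      (grad_minimizer hM (fun i => hM.side_subset k i (ih i)) hmin) i

/-- The Bethe box is non-empty, as it contains a minimizer. -/
theorem Associative.A_le (hM : M.Associative) (k : ℕ) (i : Fin n) : M.A k i ≤ 1 - M.B k i := by
  obtain ⟨q, hq, hmin⟩ := M.exists_isMinOn_F
  have := minimizer_mem_side hM hq hmin k i
  exact this.1.trans this.2

/-! ### Second derivatives in the Bethe box -/

theorem Associative.η_mem (hM : M.Associative) (k : ℕ) (i : Fin n) :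
    0 < M.η k i ∧ M.η k i ≤ 1 / 2 := by
  have h1 := ((hM.bounds_mem k).1 i).1
  have h2 := ((hM.bounds_mem k).2 i).1
  have h3 := hM.A_le k i
  refine ⟨lt_min h1 h2, ?_⟩
  rcases le_total (M.A k i) (M.B k i) with h | h
  · rw [η, min_eq_left h]; linarith
  · rw [η, min_eq_right h]; linarith

theorem Associative.η_var_pos (hM : M.Associative) (k : ℕ) (i : Fin n) :
    0 < M.η k i * (1 - M.η k i) := by
  have := hM.η_mem k i
  exact mul_pos this.1 (by linarith)

/-- On `[Aᵢ, 1 - Bᵢ]` the variance `x (1 - x)` is least at an end point, which is no closer to `0` or `1`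
than `ηᵢ`. -/
theorem η_var_le {k : ℕ} {i : Fin n} {x : ℝ} (hx : x ∈ M.side k i) :
    M.η k i * (1 - M.η k i) ≤ x * (1 - x) := by
  have h1 : M.η k i ≤ x := (min_le_left _ _).trans hx.1
  have h2 : M.η k i ≤ 1 - x := (min_le_right _ _).trans (by linarith [hx.2])
  nlinarith

/-- The quantity whose maximum is `a`. -/
def offBound (M : MRF n) (k : ℕ) (i j : Fin n) : ℝ :=
  M.α i j * (M.α i j + 1) / (4 * (2 * M.α i j + 1) * M.η k i * M.η k j * (1 - M.η k i) * (1 - M.η k j))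

/-- The quantity whose maximum is `b`. -/
def diagBound (M : MRF n) (k : ℕ) (i : Fin n) : ℝ :=
  1 / (M.η k i * (1 - M.η k i)) *
    (1 - (M.deg i : ℝ) + ∑ j ∈ M.nbrs i, (M.α i j + 1) ^ 2 / (2 * M.α i j + 1))

theorem offBound_comm (k : ℕ) (i j : Fin n) : M.offBound k i j = M.offBound k j i := by
  unfold offBound; rw [α_comm i j]; congr 1; ring

theorem offBound_le_Ω {k : ℕ} {i j : Fin n} (h : M.W i j ≠ 0) : M.offBound k i j ≤ M.Ω k := by
  have hne := ne_of_W_ne_zero h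
  have key : ∀ i j : Fin n, i < j → M.W i j ≠ 0 → M.offBound k i j ≤ M.Ω k := fun i j hij h =>
    le_trans (le_ciSup (f := fun p : {p : Fin n × Fin n // p ∈ M.edges} => M.offBound k p.1.1 p.1.2)
      (Set.finite_range _).bddAbove ⟨(i, j), mem_edges.2 ⟨hij, h⟩⟩) (le_max_left _ _)
  rcases lt_or_gt_of_ne hne with h1 | h1
  · exact key i j h1 h
  · rw [offBound_comm]; exact key j i h1 (by rwa [M.symm])

theorem diagBound_le_Ω (k : ℕ) (i : Fin n) : M.diagBound k i ≤ M.Ω k :=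
  le_trans (le_ciSup (f := fun i => M.diagBound k i) (Set.finite_range _).bddAbove i) (le_max_right _ _)

/-- Each summand is at least `1`, so the terms of the degree cancel. -/
theorem Associative.one_le_diag_sum (hM : M.Associative) (i : Fin n) :
    1 ≤ 1 - (M.deg i : ℝ) + ∑ j ∈ M.nbrs i, (M.α i j + 1) ^ 2 / (2 * M.α i j + 1) := by
  have : ∑ j ∈ M.nbrs i, (1 : ℝ) ≤ ∑ j ∈ M.nbrs i, (M.α i j + 1) ^ 2 / (2 * M.α i j + 1) := by
    refine Finset.sum_le_sum fun j _ => ?_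
    have := hM.α_nonneg i j
    rw [le_div_iff₀ (by positivity)]; nlinarith
  simp only [Finset.sum_const, nsmul_eq_mul, mul_one] at this
  unfold deg
  linarith

theorem Associative.Ω_ge (hM : M.Associative) (k : ℕ) (i : Fin n) : 4 ≤ M.Ω k := by
  refine le_trans ?_ (diagBound_le_Ω k i)
  have h1 := hM.one_le_diag_sum i
  have h2 := hM.η_var_pos k i
  have h3 : 4 ≤ 1 / (M.η k i * (1 - M.η k i)) := by
    rw [le_div_iff₀ h2]; nlinarith [sq_nonneg (1 - 2 * M.η k i)]
  unfold diagBound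
  nlinarith

theorem Associative.hess_off_le_Ω (hM : M.Associative) {k : ℕ} {i j : Fin n} (h : M.W i j ≠ 0) {x y : ℝ}
    (hx : x ∈ M.side k i) (hy : y ∈ M.side k j) :
    (xi (M.α i j) x y - x * y) / hessDen (M.α i j) x y ≤ M.Ω k := by
  have ha := hM.α_pos h
  refine (hess_off_le ha (hM.side_subset k i hx) (hM.side_subset k j hy)).trans
    (le_trans ?_ (offBound_le_Ω h))
  have h1 := hM.η_var_pos k i
  have h2 := hM.η_var_pos k j
  have h3 := η_var_le hx
  have h4 : 4 * (M.η k j * (1 - M.η k j)) ≤ 1 := by nlinarith [sq_nonneg (1 - 2 * M.η k j)]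
  have e : M.offBound k i j = M.α i j * (M.α i j + 1) / (2 * M.α i j + 1) /
      (4 * (M.η k j * (1 - M.η k j)) * (M.η k i * (1 - M.η k i))) := by
    rw [offBound, div_div]; congr 1; ring
  have ha2 : 0 ≤ M.α i j * (M.α i j + 1) / (2 * M.α i j + 1) := by positivity
  rw [e]
  exact div_le_div_of_nonneg_left ha2 (by positivity) (by nlinarith)

theorem mul_sub_div_le {v v' c d T Ω : ℝ} (hT : 0 < T) (hd : 0 ≤ d) (h : d / T ≤ Ω) :
    v * ((c * v - d * v') / T) ≤ c / T * v ^ 2 + Ω * (|v| * |v'|) := by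
  have e : v * ((c * v - d * v') / T) = c / T * v ^ 2 + d / T * (-(v * v')) := by field_simp; ring
  have h0 : 0 ≤ d / T := by positivity
  have h1 : -(v * v') ≤ |v| * |v'| := by rw [← abs_mul]; exact neg_le_abs _
  rw [e]
  have := mul_le_mul_of_nonneg_left h1 h0
  have := mul_le_mul_of_nonneg_right h (mul_nonneg (abs_nonneg v) (abs_nonneg v'))
  linarith

/-- The Hessian form is bounded by `Ω` times the form of the absolute values over the non-zero
entries. -/
theorem Associative.hess_form_le (hM : M.Associative) {k : ℕ} {q : Fin n → ℝ}
    (hq : ∀ i, q i ∈ M.side k i) (v : Fin n → ℝ) (i : Fin n) :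
    v i * (((M.deg i : ℝ) - 1) * (-(v i / (q i * (1 - q i))))
        + ∑ j ∈ M.nbrs i, (q j * (1 - q j) * v i
          - (xi (M.α i j) (q i) (q j) - q i * q j) * v j) / hessDen (M.α i j) (q i) (q j))
      ≤ M.Ω k * (v i ^ 2 + ∑ j ∈ M.nbrs i, |v i| * |v j|) := by
  have hq' : ∀ i, q i ∈ Set.Ioo (0 : ℝ) 1 := fun i => hM.side_subset k i (hq i)
  have hv : 0 < q i * (1 - q i) := mul_pos (hq' i).1 (sub_pos.2 (hq' i).2)
  have h1 : v i * ∑ j ∈ M.nbrs i, (q j * (1 - q j) * v i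
          - (xi (M.α i j) (q i) (q j) - q i * q j) * v j) / hessDen (M.α i j) (q i) (q j)
      ≤ ∑ j ∈ M.nbrs i, (1 / (q i * (1 - q i)) * ((M.α i j + 1) ^ 2 / (2 * M.α i j + 1)) * v i ^ 2
        + M.Ω k * (|v i| * |v j|)) := by
    rw [Finset.mul_sum]
    refine Finset.sum_le_sum fun j hj => ?_
    have hW := mem_nbrs.1 hj
    have ha := hM.α_pos hW
    refine (mul_sub_div_le (hessDen_pos ha (hq' i) (hq' j)) (xi_sub_mul_pos ha (hq' i) (hq' j)).le
      (hM.hess_off_le_Ω hW (hq i) (hq j))).trans ?_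
    have := hess_diag_le ha (hq' i) (hq' j)
    gcongr
  rw [Finset.sum_add_distrib, ← Finset.sum_mul, ← Finset.mul_sum, ← Finset.mul_sum] at h1
  have h2 : 1 / (q i * (1 - q i)) * (1 - (M.deg i : ℝ) + ∑ j ∈ M.nbrs i,
      (M.α i j + 1) ^ 2 / (2 * M.α i j + 1)) ≤ M.Ω k := by
    refine le_trans ?_ (diagBound_le_Ω k i)
    unfold diagBound
    have := hM.one_le_diag_sum i
    have := hM.η_var_pos k i
    have := η_var_le (hq i)
    gcongr
  have h3 := mul_le_mul_of_nonneg_right h2 (sq_nonneg (v i))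
  have e : v i * (((M.deg i : ℝ) - 1) * (-(v i / (q i * (1 - q i)))))
      = 1 / (q i * (1 - q i)) * (1 - (M.deg i : ℝ)) * v i ^ 2 := by field_simp; ring
  rw [mul_add, e]
  linarith

theorem card_edges_eq : (2 * (M.edges.card : ℝ)) = ∑ i, (M.deg i : ℝ) := by
  have := sum_edges_add_swap (M := M) (R := ℝ) fun _ _ => 1
  simp only [Finset.sum_const, nsmul_eq_mul, mul_one] at this
  unfold deg
  rw [← this]; ring

/-- Cauchy–Schwarz over the non-zero entries of the Hessian. -/
theorem sum_abs_le (v : Fin n → ℝ) :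
    ∑ i, (v i ^ 2 + ∑ j ∈ M.nbrs i, |v i| * |v j|)
      ≤ √((n : ℝ) + 2 * (M.edges.card : ℝ)) * ∑ i, v i ^ 2 := by
  set c : Fin n → Fin n → ℝ := fun i j => if i = j ∨ M.W i j ≠ 0 then 1 else 0 with hc
  have hsplit : ∀ (i : Fin n) (f : Fin n → ℝ), ∑ j, c i j * f j = f i + ∑ j ∈ M.nbrs i, f j := by
    intro i f
    have : ∀ j, c i j * f j = (if i = j then f j else 0) + if M.W i j ≠ 0 then f j else 0 := by
      intro j
      by_cases h : i = j
      · subst h; simp [hc, M.diag]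
      · by_cases h' : M.W i j = 0 <;> simp [hc, h, h']
    simp only [this, Finset.sum_add_distrib, Finset.sum_ite_eq, Finset.mem_univ, if_true, nbrs,
      Finset.sum_filter]
  have e1 : ∑ i, (v i ^ 2 + ∑ j ∈ M.nbrs i, |v i| * |v j|)
      = ∑ p : Fin n × Fin n, c p.1 p.2 * (|v p.1| * |v p.2|) := by
    rw [Fintype.sum_prod_type]
    refine Finset.sum_congr rfl fun i _ => ?_
    rw [hsplit i fun j => |v i| * |v j|, abs_mul_abs_self, sq]
  have e2 : ∑ p : Fin n × Fin n, c p.1 p.2 ^ 2 = (n : ℝ) + 2 * (M.edges.card : ℝ) := by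
    rw [Fintype.sum_prod_type, card_edges_eq]
    have : ∀ i, ∑ j, c i j ^ 2 = 1 + (M.deg i : ℝ) := by
      intro i
      have h := hsplit i fun _ => 1
      simp only [mul_one, Finset.sum_const, nsmul_eq_mul] at h
      unfold deg
      rw [← h]
      refine Finset.sum_congr rfl fun j _ => ?_
      simp only [hc]; split_ifs <;> simp
    simp only [this, Finset.sum_add_distrib]; simp
  have e3 : ∑ p : Fin n × Fin n, (|v p.1| * |v p.2|) ^ 2 = (∑ i, v i ^ 2) ^ 2 := by
    rw [Fintype.sum_prod_type, sq, Finset.sum_mul_sum]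
    simp [mul_pow]
  -- `c` is the indicator of the `n + 2 |E|` non-zero entries
  have hcs := Finset.sum_mul_sq_le_sq_mul_sq Finset.univ (fun p : Fin n × Fin n => c p.1 p.2)
    fun p => |v p.1| * |v p.2|
  rw [e2, e3] at hcs
  rw [e1]
  refine Real.le_sqrt_of_sq_le hcs |>.trans_eq ?_
  rw [Real.sqrt_mul (by positivity), Real.sqrt_sq (Finset.sum_nonneg fun i _ => sq_nonneg _)]

theorem sqrt_density (hn : 0 < n) :
    (n : ℝ) * √M.density = √((n : ℝ) + 2 * (M.edges.card : ℝ)) := by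
  have : (0 : ℝ) < n := by exact_mod_cast hn
  rw [density, Real.sqrt_div (by positivity), Real.sqrt_sq this.le]; field_simp

/-- Second order Taylor bound at a minimizer, inside the Bethe box. -/
theorem F_sub_minimizer_le (hM : M.Associative) {k : ℕ} {q q' : Fin n → ℝ}
    (hq : q ∈ Set.Icc (0 : Fin n → ℝ) 1) (hmin : IsMinOn M.F (Set.Icc 0 1) q)
    (hq' : ∀ i, q' i ∈ M.side k i) :
    M.F q' - M.F q
      ≤ M.Ω k * √((n : ℝ) + 2 * (M.edges.card : ℝ)) * (∑ i, (q' i - q i) ^ 2) / 2 := by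
  set v : Fin n → ℝ := fun i => q' i - q i with hv
  set K := M.Ω k * √((n : ℝ) + 2 * (M.edges.card : ℝ)) * ∑ i, v i ^ 2 with hK
  have hbox := minimizer_mem_side hM hq hmin k
  have hseg : ∀ t ∈ Set.Icc (0 : ℝ) 1, ∀ i, q i + t * v i ∈ M.side k i := by
    intro t ht i
    have h1 := hbox i
    have h2 := hq' i
    have h3 : q i + t * v i = (1 - t) * q i + t * q' i := by simp only [hv]; ring
    rw [h3]
    exact convex_Icc _ _ h1 h2 (by linarith [ht.2]) ht.1 (by ring)
  have hseg' := fun t ht i => hM.side_subset k i (hseg t ht i)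
  set g' : ℝ → ℝ := fun t => ∑ i, v i * M.grad (fun i => q i + t * v i) i with hg'
  have hd1 : ∀ t ∈ Set.Icc (0 : ℝ) 1, HasDerivAt (fun t => M.F fun i => q i + t * v i) (g' t) t :=
    fun t ht => hasDerivAt_F_line hM q v (hseg' t ht)
  have hd2 : ∀ t ∈ Set.Icc (0 : ℝ) 1, ∃ c ≤ K, HasDerivAt g' c t := by
    intro t ht
    refine ⟨_, ?_, HasDerivAt.fun_sum fun i _ =>
      (hasDerivAt_grad_line hM q v (hseg' t ht) i).const_mul (v i)⟩
    refine (Finset.sum_le_sum fun i _ => hM.hess_form_le (hseg t ht) v i).trans ?_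
    rw [← Finset.mul_sum, hK, mul_assoc]
    rcases isEmpty_or_nonempty (Fin n) with h | ⟨⟨i⟩⟩
    · simp
    · exact mul_le_mul_of_nonneg_left (sum_abs_le v) (by linarith [hM.Ω_ge k i])
  have h0 : g' 0 = 0 := by
    simp only [hg', zero_mul, add_zero]
    refine Finset.sum_eq_zero fun i _ => ?_
    rw [show (fun i => q i) = q from rfl,
      grad_minimizer hM (fun i => hM.side_subset k i (hbox i)) hmin, mul_zero]
  -- the first derivative vanishes at the minimizer, so two integrations of `g'' ≤ K` give `K / 2`
  have hg'le : ∀ t ∈ Set.Icc (0 : ℝ) 1, g' t ≤ K * t := by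
    have : AntitoneOn (fun t => g' t - K * t) (Set.Icc 0 1) := by
      refine antitoneOn_of_deriv_nonpos (convex_Icc 0 1) (fun t ht => ?_) (fun t ht => ?_) fun t ht => ?_
      · obtain ⟨c, -, h⟩ := hd2 t ht
        exact (h.sub ((hasDerivAt_id t).const_mul K)).continuousAt.continuousWithinAt
      · obtain ⟨c, -, h⟩ := hd2 t (interior_subset ht)
        exact (h.sub ((hasDerivAt_id t).const_mul K)).differentiableAt.differentiableWithinAt
      · obtain ⟨c, hc, h⟩ := hd2 t (interior_subset ht)
        have := (h.sub ((hasDerivAt_id t).const_mul K)).deriv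
        have e : deriv (fun t => g' t - K * t) t = c - K * 1 := this
        rw [e]; linarith
    intro t ht
    have h := this (Set.left_mem_Icc.2 zero_le_one) ht ht.1
    simp only [h0] at h
    linarith
  have : AntitoneOn (fun t => (M.F fun i => q i + t * v i) - K / 2 * t ^ 2) (Set.Icc 0 1) := by
    have hd : ∀ t ∈ Set.Icc (0 : ℝ) 1,
        HasDerivAt (fun t => (M.F fun i => q i + t * v i) - K / 2 * t ^ 2) (g' t - K * t) t := by
      intro t ht
      refine ((hd1 t ht).sub ((hasDerivAt_pow 2 t).const_mul (K / 2))).congr_deriv ?_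
      simp; ring
    refine antitoneOn_of_deriv_nonpos (convex_Icc 0 1)
      (fun t ht => (hd t ht).continuousAt.continuousWithinAt)
      (fun t ht => (hd t (interior_subset ht)).differentiableAt.differentiableWithinAt) fun t ht => ?_
    rw [(hd t (interior_subset ht)).deriv]
    linarith [hg'le t (interior_subset ht)]
  have h := this (Set.left_mem_Icc.2 zero_le_one) (Set.right_mem_Icc.2 zero_le_one) zero_le_one
  have e : (fun i => q i + (q' i - q i)) = q' := by funext i; ring
  simp only [hv, one_mul, zero_mul, add_zero, e] at h
  rw [show (fun i => q i) = q from rfl] at h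
  linarith

/-- The best point of a sufficiently fine mesh in the Bethe box is within `ε` of the minimum. -/
theorem withinOfMin_of_mesh (hM : M.Associative) (hn : 0 < n) {k : ℕ} {ε γ : ℝ} {N : Fin n → ℕ}
    {d : ∀ i, Fin (N i) → ℝ} (hd : ∀ i r, d i r ∈ M.side k i)
    (hcov : ∀ i, ∀ y ∈ M.side k i, ∃ r, |y - d i r| ≤ γ)
    (hγ : (n : ℝ) * γ ^ 2 ≤ 2 * ε / ((n : ℝ) * M.Ω k * √M.density))
    (x : ∀ i, Fin (N i)) (hx : ∀ y : (∀ i, Fin (N i)), M.F (fun i => d i (x i)) ≤ M.F fun i => d i (y i)) :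
    M.WithinOfMin (fun i => d i (x i)) ε := by
  obtain ⟨q, hq, hmin⟩ := M.exists_isMinOn_F
  refine ⟨q, hq, hmin, ?_⟩
  have hbox := minimizer_mem_side hM hq hmin k
  choose y hy using fun i => hcov i (q i) (hbox i)
  have h1 := F_sub_minimizer_le (k := k) (q' := fun i => d i (y i)) hM hq hmin fun i => hd i (y i)
  have h2 : ∑ i, (d i (y i) - q i) ^ 2 ≤ (n : ℝ) * γ ^ 2 := by
    have : ∑ i, (d i (y i) - q i) ^ 2 ≤ ∑ _i : Fin n, γ ^ 2 := by
      refine Finset.sum_le_sum fun i _ => ?_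
      rw [← neg_sub, neg_sq, ← sq_abs]
      exact pow_le_pow_left₀ (abs_nonneg _) (hy i) 2
    simpa using this
  have hn' : (0 : ℝ) < n := by exact_mod_cast hn
  have hΩ : 0 < M.Ω k := by linarith [hM.Ω_ge k ⟨0, hn⟩]
  rw [← sqrt_density hn] at h1
  have hD : 0 < M.density := by unfold density; positivity
  have hs := Real.sqrt_pos.2 hD
  have h3 := mul_le_mul_of_nonneg_left (h2.trans hγ) (by positivity : 0 ≤ M.Ω k * ((n : ℝ) * √M.density))
  have e : M.Ω k * ((n : ℝ) * √M.density) * (2 * ε / ((n : ℝ) * M.Ω k * √M.density)) = 2 * ε := by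
    field_simp
  rw [e] at h3
  have := hx y
  linarith

end MRF
end Bethe
end

noncomputable section
namespace Bethe
namespace MRF

variable {n : ℕ} {M : MRF n}

/-! ### The equally spaced mesh -/

theorem density_pos (hn : 0 < n) : 0 < M.density := by
  have : (0 : ℝ) < n := by exact_mod_cast hn
  unfold density; positivity

theorem Associative.meshWidth_arg_pos (hM : M.Associative) (hn : 0 < n) (k : ℕ) {ε : ℝ} (hε : 0 < ε) :
    0 < 2 * ε / ((n : ℝ) ^ 2 * M.Ω k * √M.density) := by
  have h1 : (0 : ℝ) < n := by exact_mod_cast hn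
  have h2 : 0 < M.Ω k := by linarith [hM.Ω_ge k ⟨0, hn⟩]
  have h3 := Real.sqrt_pos.2 (M.density_pos hn)
  positivity

theorem Associative.meshWidth_pos (hM : M.Associative) (hn : 0 < n) (k : ℕ) {ε : ℝ} (hε : 0 < ε) :
    0 < M.meshWidth k ε := Real.sqrt_pos.2 (hM.meshWidth_arg_pos hn k hε)

theorem Associative.meshWidth_sq (hM : M.Associative) (hn : 0 < n) (k : ℕ) {ε : ℝ} (hε : 0 < ε) :
    (n : ℝ) * M.meshWidth k ε ^ 2 = 2 * ε / ((n : ℝ) * M.Ω k * √M.density) := by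
  have h1 : (0 : ℝ) < n := by exact_mod_cast hn
  have h2 : 0 < M.Ω k := by linarith [hM.Ω_ge k ⟨0, hn⟩]
  have h3 := Real.sqrt_pos.2 (M.density_pos hn)
  rw [meshWidth, Real.sq_sqrt (hM.meshWidth_arg_pos hn k hε).le]
  field_simp

theorem meshCount_pos (k : ℕ) (ε : ℝ) (i : Fin n) : 0 < M.meshCount k ε i :=
  lt_of_lt_of_le one_pos (le_max_left _ _)

/-- The defining inequality of `Nᵢ`, the least positive integer with cells of length at most `γ`. -/
theorem le_meshCount {k : ℕ} {ε : ℝ} (hγ : 0 < M.meshWidth k ε) (i : Fin n) :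
    1 - M.B k i - M.A k i ≤ M.meshWidth k ε * ((M.meshCount k ε i : ℝ) + 1) := by
  have h1 := Nat.le_ceil ((1 - M.B k i - M.A k i) / M.meshWidth k ε)
  have h2 : ⌈(1 - M.B k i - M.A k i) / M.meshWidth k ε⌉₊ ≤ M.meshCount k ε i + 1 := by
    unfold meshCount; omega
  have h3 : (⌈(1 - M.B k i - M.A k i) / M.meshWidth k ε⌉₊ : ℝ) ≤ (M.meshCount k ε i : ℝ) + 1 := by
    exact_mod_cast h2
  rw [← div_le_iff₀' hγ]
  exact h1.trans h3

/-- Minimality of `Nᵢ`. -/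
theorem meshCount_le {k : ℕ} {ε : ℝ} (hγ : 0 < M.meshWidth k ε) (i : Fin n) {N : ℕ} (hN : 0 < N)
    (h : 1 - M.B k i - M.A k i ≤ M.meshWidth k ε * ((N : ℝ) + 1)) : M.meshCount k ε i ≤ N := by
  have h2 : ⌈(1 - M.B k i - M.A k i) / M.meshWidth k ε⌉₊ ≤ N + 1 := by
    apply Nat.ceil_le.2
    rw [div_le_iff₀' hγ]; push_cast; exact h
  unfold meshCount; omega

/-- By minimality of `Nᵢ` the cells are longer than `γ` for `Nᵢ - 1`, unless `Nᵢ = 1`; that exception is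
why `γ ≤ 1` is needed. -/
theorem Associative.meshCount_mul_le (hM : M.Associative) {k : ℕ} {ε : ℝ} (hγ : 0 < M.meshWidth k ε)
    (hγ1 : M.meshWidth k ε ≤ 1) (i : Fin n) : (M.meshCount k ε i : ℝ) * M.meshWidth k ε ≤ 1 := by
  rcases Nat.lt_or_ge 1 (M.meshCount k ε i) with h | h
  · by_contra! hc
    have h1 := (hM.bounds_mem k).1 i
    have h2 := (hM.bounds_mem k).2 i
    have := meshCount_le hγ i (N := M.meshCount k ε i - 1) (by omega) (by
      rw [Nat.cast_sub h.le]; push_cast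
      linarith [h1.1, h2.1])
    omega
  · have : (M.meshCount k ε i : ℝ) ≤ 1 := by exact_mod_cast h
    nlinarith

theorem Associative.mesh_mem_side (hM : M.Associative) (k : ℕ) (ε : ℝ) (i : Fin n)
    (r : Fin (M.meshCount k ε i)) : M.mesh k ε i r ∈ M.side k i := by
  have h1 := hM.A_le k i
  have h2 : ((r : ℕ) + 1 : ℝ) ≤ (M.meshCount k ε i : ℝ) := by exact_mod_cast r.2
  unfold mesh
  set N := (M.meshCount k ε i : ℝ)
  have h0 : 0 ≤ 1 - M.B k i - M.A k i := by linarith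
  have hN : (0 : ℝ) < N + 1 := by positivity
  constructor
  · have : 0 ≤ ((r : ℕ) + 1 : ℝ) * ((1 - M.B k i - M.A k i) / (N + 1)) := by positivity
    linarith
  · have : ((r : ℕ) + 1 : ℝ) * ((1 - M.B k i - M.A k i) / (N + 1)) ≤ 1 - M.B k i - M.A k i := by
      rw [mul_div_assoc', div_le_iff₀ hN]
      nlinarith
    linarith

theorem Associative.mesh_mono (hM : M.Associative) (k : ℕ) (ε : ℝ) (i : Fin n) :
    Monotone (M.mesh k ε i) := by
  intro r s hrs
  have h1 := hM.A_le k i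
  have h2 : ((r : ℕ) : ℝ) ≤ (s : ℕ) := by exact_mod_cast hrs
  have h0 : 0 ≤ 1 - M.B k i - M.A k i := by linarith
  unfold mesh
  gcongr

/-- Every point of the side lies between two neighbouring mesh points or in one of the two end cells, whose
length is at most `γ`. -/
theorem Associative.mesh_cover (hM : M.Associative) {k : ℕ} {ε : ℝ} (hγ : 0 < M.meshWidth k ε)
    (i : Fin n) (y : ℝ) (hy : y ∈ M.side k i) : ∃ r, |y - M.mesh k ε i r| ≤ M.meshWidth k ε := by
  have hN := M.meshCount_pos k ε i
  have hw := le_meshCount hγ i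
  have hAB := hM.A_le k i
  set N := M.meshCount k ε i with hNdef
  set h := (1 - M.B k i - M.A k i) / ((N : ℝ) + 1) with hh
  have hN1 : (0 : ℝ) < (N : ℝ) + 1 := by positivity
  have hhγ : h ≤ M.meshWidth k ε := by rw [hh, div_le_iff₀ hN1]; exact hw
  have hwh : 1 - M.B k i - M.A k i = ((N : ℝ) + 1) * h := by rw [hh]; field_simp
  have hh0 : 0 ≤ h := div_nonneg (by linarith) hN1.le
  suffices ∃ j : ℕ, 1 ≤ j ∧ j ≤ N ∧ |(y - M.A k i) - j * h| ≤ h by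
    obtain ⟨j, h1, h2, h3⟩ := this
    refine ⟨⟨j - 1, by omega⟩, le_trans (le_of_eq ?_) (h3.trans hhγ)⟩
    simp only [mesh, ← hNdef, ← hh]
    rw [Nat.cast_sub h1]; push_cast; congr 1; ring
  rcases hh0.eq_or_lt with h0 | h0
  · refine ⟨1, le_rfl, hN, ?_⟩
    have : y - M.A k i = 0 := by
      have h1 := hy.1; have h2 := hy.2; rw [← h0] at hwh; linarith
    rw [this, ← h0]; simp
  · have hs : 0 ≤ (y - M.A k i) / h := div_nonneg (by linarith [hy.1]) hh0
    have f1 := Nat.floor_le hs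
    have f2 := Nat.lt_floor_add_one ((y - M.A k i) / h)
    rw [le_div_iff₀ h0] at f1
    rw [div_lt_iff₀ h0] at f2
    have hyw : y - M.A k i ≤ ((N : ℝ) + 1) * h := by linarith [hy.2]
    set m := ⌊(y - M.A k i) / h⌋₊
    rcases Nat.eq_zero_or_pos m with hm | hm
    · refine ⟨1, le_rfl, hN, ?_⟩
      rw [hm] at f1 f2; push_cast at *
      rw [abs_le]; constructor <;> linarith
    · rcases Nat.lt_or_ge N m with hmN | hmN
      · refine ⟨N, hN, le_rfl, ?_⟩
        have : (N : ℝ) + 1 ≤ m := by exact_mod_cast hmN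
        rw [abs_le]; constructor <;> nlinarith
      · refine ⟨m, hm, hmN, ?_⟩
        rw [abs_le]; constructor <;> linarith

/-- Every point of least energy of the equally spaced mesh is within `ε` of the minimum. -/
theorem withinOfMin_of_equally_spaced (hM : M.Associative) (hn : 0 < n) {k : ℕ} {ε : ℝ} (hε : 0 < ε)
    (x : ∀ i, Fin (M.meshCount k ε i))
    (hx : ∀ y : (∀ i, Fin (M.meshCount k ε i)),
      M.F (fun i => M.mesh k ε i (x i)) ≤ M.F fun i => M.mesh k ε i (y i)) :
    M.WithinOfMin (fun i => M.mesh k ε i (x i)) ε :=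
  withinOfMin_of_mesh hM hn (hM.mesh_mem_side k ε) (hM.mesh_cover (hM.meshWidth_pos hn k hε))
    (hM.meshWidth_sq hn k hε).le x hx

/-- The number of mesh points, cubed, is bounded by the time bound. -/
theorem Associative.sum_meshCount_le (hM : M.Associative) (hn : 2 ≤ n) {k : ℕ} {ε : ℝ} (hε : 0 < ε)
    (hγ1 : M.meshWidth k ε ≤ 1) :
    ((2 + ∑ i, M.meshCount k ε i : ℕ) : ℝ) ^ 3 ≤ 8 * M.timeBound k ε := by
  have hn0 : 0 < n := by omega
  have hγ := hM.meshWidth_pos hn0 k hε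
  have hn' : (2 : ℝ) ≤ n := by exact_mod_cast hn
  have hΩ : 0 < M.Ω k := by linarith [hM.Ω_ge k ⟨0, hn0⟩]
  have hD := M.density_pos hn0
  have hsum : (∑ i, (M.meshCount k ε i : ℝ)) * M.meshWidth k ε ≤ n := by
    rw [Finset.sum_mul]
    refine (Finset.sum_le_sum fun i _ => hM.meshCount_mul_le hγ hγ1 i).trans_eq ?_
    simp
  have hV : ((2 + ∑ i, M.meshCount k ε i : ℕ) : ℝ) * M.meshWidth k ε ≤ 2 * n := by
    push_cast; nlinarith
  have h3 := pow_le_pow_left₀ (by positivity) hV 3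
  rw [mul_pow] at h3
  set a := 2 * ε / ((n : ℝ) ^ 2 * M.Ω k * √M.density) with ha
  have ha0 : 0 < a := hM.meshWidth_arg_pos hn0 k hε
  have e1 : M.meshWidth k ε ^ 3 = a ^ (3 / 2 : ℝ) := by
    rw [meshWidth, ← ha, Real.sqrt_eq_rpow, ← Real.rpow_natCast, ← Real.rpow_mul ha0.le]
    norm_num
  have e2 : a⁻¹ ^ (3 / 2 : ℝ) ≤ (n : ℝ) ^ 3 * M.density ^ (3 / 4 : ℝ) * M.Ω k ^ (3 / 2 : ℝ)
      * ε ^ (-(3 / 2) : ℝ) := by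
    have : a⁻¹ ≤ (n : ℝ) ^ 2 * M.density ^ (1 / 2 : ℝ) * M.Ω k * ε⁻¹ := by
      rw [ha, inv_div, Real.sqrt_eq_rpow, div_le_iff₀ (by positivity)]
      have : 0 ≤ (n : ℝ) ^ 2 * M.Ω k * M.density ^ (1 / 2 : ℝ) := by positivity
      field_simp; linarith
    refine (Real.rpow_le_rpow (by positivity) this (by norm_num)).trans_eq ?_
    rw [Real.mul_rpow (by positivity) (by positivity), Real.mul_rpow (by positivity) (by positivity),
      Real.mul_rpow (by positivity) (by positivity), ← Real.rpow_mul hD.le, Real.inv_rpow hε.le,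
      ← Real.rpow_neg hε.le, ← Real.rpow_natCast (n : ℝ) 2, ← Real.rpow_mul (by positivity)]
    norm_num
  rw [e1] at h3
  have e3 : a⁻¹ ^ (3 / 2 : ℝ) = (a ^ (3 / 2 : ℝ))⁻¹ := Real.inv_rpow ha0.le _
  have h4 : ((2 + ∑ i, M.meshCount k ε i : ℕ) : ℝ) ^ 3 ≤ (2 * (n : ℝ)) ^ 3 * a⁻¹ ^ (3 / 2 : ℝ) := by
    rw [e3, ← div_eq_mul_inv, le_div_iff₀ (by positivity)]; exact h3
  refine h4.trans ((mul_le_mul_of_nonneg_left e2 (by positivity)).trans_eq ?_)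
  unfold timeBound; ring

/-! ### Ranges of the parameters with polynomial running time -/

theorem deg_lt (i : Fin n) : M.deg i < n := by
  have : (M.nbrs i).card < (Finset.univ : Finset (Fin n)).card :=
    Finset.card_lt_card (Finset.ssubset_univ_iff.2 fun h => by
      have : i ∈ M.nbrs i := h ▸ Finset.mem_univ i
      exact mem_nbrs.1 this (M.diag i))
  simpa [deg] using this

theorem density_le_one (hn : 0 < n) : M.density ≤ 1 := by
  have hn' : (0 : ℝ) < n := by exact_mod_cast hn
  rw [density, div_le_one (by positivity), card_edges_eq]
  have : ∑ i, (M.deg i : ℝ) ≤ ∑ _i : Fin n, ((n : ℝ) - 1) := by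
    refine Finset.sum_le_sum fun i _ => ?_
    have := M.deg_lt i
    have h : (M.deg i : ℝ) + 1 ≤ n := by exact_mod_cast this
    linarith
  simp only [Finset.sum_const, Finset.card_univ, Fintype.card_fin, nsmul_eq_mul] at this
  nlinarith

theorem one_div_two_exp_le_sigmoid {t X : ℝ} (hX : 0 ≤ X) (h : -X ≤ t) :
    1 / (2 * Real.exp X) ≤ Real.sigmoid t := by
  refine le_trans ?_ (Real.sigmoid_le h)
  rw [sigmoid_eq_one_div, neg_neg]
  have := Real.one_le_exp hX
  exact one_div_le_one_div_of_le (by positivity) (by linarith)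

/-- If all `ηᵢ ≥ 1 / Q`, then both maxima in `Ω` are polynomial in `Q`, `exp w` and `n`. -/
theorem Associative.Ω_le (hM : M.Associative) (hn : 2 ≤ n) (hc : M.graph.Connected) {k : ℕ} {w Q : ℝ}
    (hw : ∀ i j, M.W i j ≤ w) (hη : ∀ i, 1 / Q ≤ M.η k i) (hQ : 1 ≤ Q) :
    M.Ω k ≤ 5 * Real.exp w * Q ^ 2 * n := by
  have hn' : (2 : ℝ) ≤ n := by exact_mod_cast hn
  have hw0 : 0 ≤ w := by have := hw ⟨0, by omega⟩ ⟨0, by omega⟩; rwa [M.diag] at this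
  have hew := Real.one_le_exp hw0
  have hα : ∀ i j, M.α i j + 1 ≤ Real.exp w := fun i j => by
    have := Real.exp_le_exp.2 (hw i j); unfold α; linarith
  have hvar : ∀ i, 1 / (2 * Q) ≤ M.η k i * (1 - M.η k i) := fun i => by
    have h1 := hM.η_mem k i
    have h2 := hη i
    have e : 1 / (2 * Q) = 1 / Q * (1 / 2) := by field_simp
    rw [e]
    exact mul_le_mul h2 (by linarith) (by norm_num) h1.1.le
  have : Nonempty (Fin n) := ⟨⟨0, by omega⟩⟩
  apply max_le
  · have : Nonempty {p : Fin n × Fin n // p ∈ M.edges} := by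
      have : Nontrivial (Fin n) := Fin.nontrivial_iff_two_le.2 hn
      obtain ⟨j, hj⟩ := hc.preconnected.exists_adj_of_nontrivial (⟨0, by omega⟩ : Fin n)
      have hW := adj_iff.1 hj
      rcases lt_or_gt_of_ne (ne_of_W_ne_zero hW) with h | h
      · exact ⟨⟨(_, _), mem_edges.2 ⟨h, hW⟩⟩⟩
      · exact ⟨⟨(_, _), mem_edges.2 ⟨h, by rwa [M.symm]⟩⟩⟩
    refine ciSup_le fun p => ?_
    change M.offBound k p.1.1 p.1.2 ≤ _
    set i := p.1.1
    set j := p.1.2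
    have h0 := hM.α_nonneg i j
    have h1 := hvar i
    have h2 := hvar j
    have h3 := hα i j
    have e : M.offBound k i j = M.α i j / (2 * M.α i j + 1) * ((M.α i j + 1) / 4) /
        ((M.η k i * (1 - M.η k i)) * (M.η k j * (1 - M.η k j))) := by
      rw [offBound]; field_simp
    have h4 : M.α i j / (2 * M.α i j + 1) ≤ 1 := by rw [div_le_one (by positivity)]; linarith
    have h5 := (hM.η_var_pos k i).le
    calc M.offBound k i j ≤ 1 * (Real.exp w / 4) / (1 / (2 * Q) * (1 / (2 * Q))) := by
          rw [e]; gcongr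
      _ = Real.exp w * Q ^ 2 := by field_simp; ring
      _ ≤ _ := by
        have : 0 ≤ Real.exp w * Q ^ 2 := by positivity
        nlinarith
  · refine ciSup_le fun i => ?_
    have h1 := hvar i
    have h2 : ∑ j ∈ M.nbrs i, (M.α i j + 1) ^ 2 / (2 * M.α i j + 1) ≤ M.deg i * Real.exp w := by
      have : ∑ j ∈ M.nbrs i, (M.α i j + 1) ^ 2 / (2 * M.α i j + 1) ≤ ∑ j ∈ M.nbrs i, Real.exp w := by
        refine Finset.sum_le_sum fun j _ => le_trans ?_ (hα i j)
        have h0 := hM.α_nonneg i j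
        rw [div_le_iff₀ (by positivity)]; nlinarith
      simpa [deg] using this
    have h3 : (M.deg i : ℝ) + 1 ≤ n := by exact_mod_cast M.deg_lt i
    have h4 : 1 - (M.deg i : ℝ) + ∑ j ∈ M.nbrs i, (M.α i j + 1) ^ 2 / (2 * M.α i j + 1)
        ≤ n * Real.exp w := by
      have h5 : (0 : ℝ) ≤ M.deg i := by positivity
      nlinarith
    have h6 := hM.one_le_diag_sum i
    calc _ ≤ 1 / (1 / (2 * Q)) * (n * Real.exp w) := by gcongr
      _ = 2 * (Real.exp w * n * Q) := by field_simp
      _ ≤ _ := by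
        have : 0 ≤ Real.exp w * n * Q := by positivity
        nlinarith [mul_nonneg this (by linarith : 0 ≤ Q - 1)]

/-- Since `Wᵢ ≤ W* c log n`, the initial bounds are at least `σ(-θ* - Wᵢ) ≥ 1 / (2 exp θ* n ^ S)` for a
constant `S`, so that `ηᵢ` is polynomially small at worst and `Ω` is at most polynomial in `n`. -/
theorem timeBound_polynomial (k : ℕ) (c Wmax θmax : ℝ) : ∃ (K : ℝ) (e : ℕ), ∀ (n : ℕ) (M : MRF n),
    2 ≤ n → M.graph.Connected → M.Associative → (∀ i, (M.deg i : ℝ) ≤ c * Real.log n) →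
    (∀ i j, M.W i j ≤ Wmax) → ((∀ i, |M.θ i| ≤ θmax) ∨ ∀ i, |M.θ i + M.Wsum i / 2| ≤ θmax) →
    ∀ ε : ℝ, 0 < ε → M.timeBound k ε ≤ K * (n : ℝ) ^ e * ε ^ (-(3 / 2) : ℝ) := by
  -- `n ^ S` bounds `exp Wᵢ`, and `Ω ≤ const * n ^ (2 S + 1)` is used as `Ω ^ (3 / 2) ≤ Ω ^ 2`
  set S := ⌈|Wmax * c|⌉₊ with hS
  refine ⟨(20 * Real.exp Wmax * Real.exp θmax ^ 2) ^ 2, 4 * S + 8, ?_⟩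
  intro n M hn hconn hM hdeg hW hθ ε hε
  have hn0 : 0 < n := by omega
  have hn' : (2 : ℝ) ≤ n := by exact_mod_cast hn
  have hlog : 0 ≤ Real.log n := Real.log_nonneg (by linarith)
  have hW0 : 0 ≤ Wmax := by have := hW ⟨0, hn0⟩ ⟨0, hn0⟩; rwa [M.diag] at this
  have hT0 : 0 ≤ θmax := by
    rcases hθ with h | h <;> exact (abs_nonneg _).trans (h ⟨0, hn0⟩)
  have hWs0 : ∀ i, 0 ≤ M.Wsum i := fun i => Finset.sum_nonneg fun j _ => hM.W_nonneg i j
  have hWs : ∀ i, M.Wsum i ≤ S * Real.log n := by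
    intro i
    have h1 : M.Wsum i ≤ M.deg i * Wmax := by
      have : M.Wsum i ≤ ∑ j ∈ M.nbrs i, Wmax := Finset.sum_le_sum fun j _ => hW i j
      simpa [deg] using this
    have h2 : M.deg i * Wmax ≤ Wmax * c * Real.log n := by nlinarith [hdeg i]
    have h3 : Wmax * c * Real.log n ≤ S * Real.log n :=
      mul_le_mul_of_nonneg_right ((le_abs_self _).trans (Nat.le_ceil _)) hlog
    linarith
  have hpow : ∀ i, Real.exp (θmax + M.Wsum i) ≤ Real.exp θmax * (n : ℝ) ^ S := by
    intro i
    have : (n : ℝ) ^ S = Real.exp (S * Real.log n) := by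
      rw [Real.exp_nat_mul, Real.exp_log (by linarith)]
    rw [Real.exp_add, this]
    have := Real.exp_le_exp.2 (hWs i)
    gcongr
  have hθ1 : ∀ i, -(θmax + M.Wsum i) ≤ M.θ i := by
    intro i
    have h0 := hWs0 i
    rcases hθ with h | h
    · have := neg_le_of_abs_le (h i); linarith
    · have := neg_le_of_abs_le (h i); linarith
  have hθ2 : ∀ i, -(θmax + M.Wsum i) ≤ -(M.θ i + M.Wsum i) := by
    intro i
    have h0 := hWs0 i
    rcases hθ with h | h
    · have := le_of_abs_le (h i); linarith
    · have := le_of_abs_le (h i); linarith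
  set Q := 2 * (Real.exp θmax * (n : ℝ) ^ S) with hQ
  have hpn : (1 : ℝ) ≤ (n : ℝ) ^ S := one_le_pow₀ (by linarith)
  have het := Real.one_le_exp hT0
  have hQ1 : 1 ≤ Q := by nlinarith
  have hη : ∀ i, 1 / Q ≤ M.η k i := by
    intro i
    have hX : 0 ≤ θmax + M.Wsum i := by linarith [hWs0 i]
    have h1 : 1 / Q ≤ 1 / (2 * Real.exp (θmax + M.Wsum i)) :=
      one_div_le_one_div_of_le (by positivity) (by linarith [hpow i])
    exact h1.trans (le_min ((one_div_two_exp_le_sigmoid hX (hθ1 i)).trans (hM.sigmoid_le_A k i))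
      ((one_div_two_exp_le_sigmoid hX (hθ2 i)).trans (hM.sigmoid_le_B k i)))
  have hΩ := hM.Ω_le hn hconn hW hη hQ1
  have hΩ4 := hM.Ω_ge k ⟨0, hn0⟩
  have e1 : 5 * Real.exp Wmax * Q ^ 2 * n
      = 20 * Real.exp Wmax * Real.exp θmax ^ 2 * (n : ℝ) ^ (2 * S + 1) := by rw [hQ]; ring
  rw [e1] at hΩ
  have h1 : M.Ω k ^ (3 / 2 : ℝ)
      ≤ (20 * Real.exp Wmax * Real.exp θmax ^ 2 * (n : ℝ) ^ (2 * S + 1)) ^ 2 := by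
    calc M.Ω k ^ (3 / 2 : ℝ) ≤ M.Ω k ^ (2 : ℝ) :=
          Real.rpow_le_rpow_of_exponent_le (by linarith) (by norm_num)
      _ = M.Ω k ^ 2 := by norm_num
      _ ≤ _ := pow_le_pow_left₀ (by linarith) hΩ 2
  have h2 : M.density ^ (3 / 4 : ℝ) ≤ 1 :=
    Real.rpow_le_one (M.density_pos hn0).le (M.density_le_one hn0) (by norm_num)
  have h3 : 0 ≤ M.density ^ (3 / 4 : ℝ) := Real.rpow_nonneg (M.density_pos hn0).le _
  calc M.timeBound k ε ≤ (n : ℝ) ^ 6 * 1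
        * (20 * Real.exp Wmax * Real.exp θmax ^ 2 * (n : ℝ) ^ (2 * S + 1)) ^ 2 * ε ^ (-(3 / 2) : ℝ) := by
        unfold timeBound
        gcongr
    _ = _ := by ring

end MRF
end Bethe
end

noncomputable section
namespace Bethe

/-! ### The flow network of a multi-label problem -/

section Network

variable {n : ℕ} {N : Fin n → ℕ}

theorem cutValue_eq {V : Type*} [Fintype V] [DecidableEq V] (cap : V → V → ℝ) (S : Finset V) :
    cutValue cap S = ∑ u, ∑ v, if u ∈ S ∧ v ∉ S then cap u v else 0 := by
  have h : ∀ u, (∑ v, if u ∈ S ∧ v ∉ S then cap u v else 0) = if u ∈ S then ∑ v ∈ Sᶜ, cap u v else 0 := by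
    intro u
    by_cases hu : u ∈ S
    · simp only [hu, true_and, if_true, ← Finset.mem_compl, Finset.sum_ite_mem, Finset.univ_inter]
    · simp [hu]
  simp only [h, Finset.sum_ite_mem, Finset.univ_inter, cutValue]

@[simp] theorem inl_mem_labelCut (x : ∀ i, Fin (N i)) (b : Bool) :
    (Sum.inl b : CutNode N) ∈ labelCut x ↔ b = true := by
  simp [labelCut]

@[simp] theorem inr_mem_labelCut (x : ∀ i, Fin (N i)) (p : Σ i : Fin n, Fin (N i)) :
    (Sum.inr p : CutNode N) ∈ labelCut x ↔ p.2 ≤ x p.1 := by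
  simp [labelCut]

/-- The successor of a node in the chain of its variable; the last node is followed by the sink. -/
def chainNext (p : Σ i : Fin n, Fin (N i)) : CutNode N :=
  if h : (p.2 : ℕ) + 1 < N p.1 then Sum.inr ⟨p.1, ⟨p.2 + 1, h⟩⟩ else Sum.inl false

/-- Arcs along the chains, which carry the unary costs. -/
def chainCap (g : (Σ i : Fin n, Fin (N i)) → ℝ) : CutNode N → CutNode N → ℝ
  | Sum.inr p, v => if v = chainNext p then g p else 0
  | Sum.inl _, _ => 0

/-- Arcs between labels of different variables, which carry the interactions. -/
def pairCap (w : (Σ i : Fin n, Fin (N i)) → (Σ i : Fin n, Fin (N i)) → ℝ) : CutNode N → CutNode N → ℝ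
  | Sum.inr p, Sum.inr q => w p q
  | _, _ => 0

/-- The arcs which no cut of a labelling separates: from the source to the first node of each
chain, and backwards along the chains. -/
def IsRigid : CutNode N → CutNode N → Prop
  | Sum.inl true, Sum.inr q => (q.2 : ℕ) = 0
  | Sum.inr p, Sum.inr q => p.1 = q.1 ∧ (p.2 : ℕ) = q.2 + 1
  | _, _ => False

open Classical in
/-- The capacities of the network: unary costs, interactions, and rigid arcs of capacity `big`. -/
def netCap (g : (Σ i : Fin n, Fin (N i)) → ℝ)
    (w : (Σ i : Fin n, Fin (N i)) → (Σ i : Fin n, Fin (N i)) → ℝ) (big : ℝ) (u v : CutNode N) : ℝ :=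
  chainCap g u v + pairCap w u v + if IsRigid u v then big else 0

variable {g : (Σ i : Fin n, Fin (N i)) → ℝ}
  {w : (Σ i : Fin n, Fin (N i)) → (Σ i : Fin n, Fin (N i)) → ℝ} {big : ℝ}

theorem chainCap_nonneg (hg : ∀ p, 0 ≤ g p) (u v : CutNode N) : 0 ≤ chainCap g u v := by
  rcases u with _ | p
  · exact le_rfl
  · simp only [chainCap]; split_ifs
    exacts [hg p, le_rfl]

theorem pairCap_nonneg (hw : ∀ p q, 0 ≤ w p q) (u v : CutNode N) : 0 ≤ pairCap w u v := by
  rcases u with _ | p <;> rcases v with _ | q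
  exacts [le_rfl, le_rfl, le_rfl, hw p q]

theorem netCap_nonneg (hg : ∀ p, 0 ≤ g p) (hw : ∀ p q, 0 ≤ w p q) (hb : 0 ≤ big) (u v : CutNode N) :
    0 ≤ netCap g w big u v := by
  have h1 := chainCap_nonneg hg u v
  have h2 := pairCap_nonneg hw u v
  unfold netCap; split_ifs <;> positivity

/-- A labelling separates exactly one node of each chain from its successor. -/
theorem mem_labelCut_chainNext (x : ∀ i, Fin (N i)) (p : Σ i : Fin n, Fin (N i)) :
    (Sum.inr p ∈ labelCut x ∧ chainNext p ∉ labelCut x) ↔ p.2 = x p.1 := by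
  rw [inr_mem_labelCut]
  unfold chainNext
  split_ifs with h
  · rw [inr_mem_labelCut]
    simp only [Fin.le_def, Fin.ext_iff]; omega
  · have := (x p.1).2
    simp only [inl_mem_labelCut, Fin.le_def, Fin.ext_iff, Bool.false_eq_true, not_false_eq_true, and_true]
    omega

theorem not_rigid_labelCut (x : ∀ i, Fin (N i)) {u v : CutNode N} (hu : u ∈ labelCut x)
    (hv : v ∉ labelCut x) : ¬ IsRigid u v := by
  intro h
  rcases u with (_ | _) | ⟨i, r⟩ <;> rcases v with _ | ⟨j, s⟩ <;> simp only [IsRigid] at h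
  · rw [inr_mem_labelCut, Fin.le_def] at hv; simp only at hv; omega
  · obtain ⟨rfl, h⟩ := h
    rw [inr_mem_labelCut, Fin.le_def] at hu hv; simp only at hu hv; omega

/-- The value of the cut of a labelling is the total of the unary costs and of the separated interactions. -/
theorem cutValue_labelCut (x : ∀ i, Fin (N i)) :
    cutValue (netCap g w big) (labelCut x) = ∑ i, g ⟨i, x i⟩
      + ∑ p, ∑ q, if p.2 ≤ x p.1 ∧ x q.1 < q.2 then w p q else 0 := by
  rw [cutValue_eq]
  have h1 : ∀ u v : CutNode N, (if u ∈ labelCut x ∧ v ∉ labelCut x then netCap g w big u v else 0)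
      = (if u ∈ labelCut x ∧ v ∉ labelCut x then chainCap g u v else 0)
        + if u ∈ labelCut x ∧ v ∉ labelCut x then pairCap w u v else 0 := by
    intro u v
    split_ifs with h
    · rw [netCap, if_neg (not_rigid_labelCut x h.1 h.2), add_zero]
    · simp
  simp only [h1, Finset.sum_add_distrib]
  congr 1
  · rw [Fintype.sum_sum_type]
    have h2 : ∀ p : Σ i : Fin n, Fin (N i), (∑ v : CutNode N,
        if Sum.inr p ∈ labelCut x ∧ v ∉ labelCut x then chainCap g (Sum.inr p) v else 0)
        = if p.2 = x p.1 then g p else 0 := by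
      intro p
      rw [Finset.sum_eq_single (chainNext p)]
      · simp only [chainCap, if_true]
        exact if_congr (mem_labelCut_chainNext x p) rfl rfl
      · intro v _ hv; simp [chainCap, hv]
      · simp
    simp only [h2]
    simp only [chainCap, ite_self, Finset.sum_const_zero, zero_add]
    rw [Fintype.sum_sigma]
    refine Finset.sum_congr rfl fun i _ => ?_
    simp
  · rw [Fintype.sum_sum_type]
    simp only [Fintype.sum_sum_type, pairCap, ite_self, Finset.sum_const_zero, zero_add,
      inr_mem_labelCut, not_le]

/-- The total capacity of all arcs that are not rigid. -/
def softTotal (g : (Σ i : Fin n, Fin (N i)) → ℝ)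
    (w : (Σ i : Fin n, Fin (N i)) → (Σ i : Fin n, Fin (N i)) → ℝ) : ℝ :=
  ∑ u : CutNode N, ∑ v, (chainCap g u v + pairCap w u v)

/-- A set that separates no rigid arc is the source side of a labelling. -/
theorem exists_labelCut_of_not_rigid (hN : ∀ i, 0 < N i) {S : Finset (CutNode N)}
    (hs : Sum.inl true ∈ S) (ht : Sum.inl false ∉ S) (h : ∀ u ∈ S, ∀ v ∉ S, ¬ IsRigid u v) :
    ∃ x, S = labelCut x := by
  have h0 : ∀ i, (Sum.inr ⟨i, ⟨0, hN i⟩⟩ : CutNode N) ∈ S := by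
    intro i; by_contra hc; exact h _ hs _ hc rfl
  have hdown : ∀ (i : Fin n) (k r : ℕ) (hr : r < N i) (hk : k ≤ r),
      (Sum.inr ⟨i, ⟨r, hr⟩⟩ : CutNode N) ∈ S → (Sum.inr ⟨i, ⟨k, hk.trans_lt hr⟩⟩ : CutNode N) ∈ S := by
    intro i k r hr hk hS
    induction r, hk using Nat.le_induction with
    | base => exact hS
    | succ r hkr ih =>
      refine ih (by omega) ?_
      by_contra hc
      exact h _ hS _ hc ⟨rfl, rfl⟩
  have hmax : ∀ i, ∃ r : Fin (N i), (Sum.inr ⟨i, r⟩ : CutNode N) ∈ S ∧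
      ∀ s : Fin (N i), (Sum.inr ⟨i, s⟩ : CutNode N) ∈ S → s ≤ r := by
    intro i
    obtain ⟨r, hr, hmax⟩ := (Finset.univ.filter fun r : Fin (N i) =>
      (Sum.inr ⟨i, r⟩ : CutNode N) ∈ S).exists_max_image id ⟨⟨0, hN i⟩, by simpa using h0 i⟩
    exact ⟨r, by simpa using hr, fun s hs => hmax s (by simpa using hs)⟩
  choose x hx hx' using hmax
  refine ⟨x, ?_⟩
  ext u
  rcases u with (_ | _) | ⟨i, r⟩
  · simpa using ht
  · simpa using hs
  · rw [inr_mem_labelCut]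
    exact ⟨fun hr => hx' i r hr, fun hr => hdown i r (x i) (x i).2 hr (hx i)⟩

/-- A minimum cut separates no rigid arc, since a single one costs more than any cut of a labelling. -/
theorem eq_labelCut_of_isMinCut (hN : ∀ i, 0 < N i) (hg : ∀ p, 0 ≤ g p) (hw : ∀ p q, 0 ≤ w p q)
    (hb : softTotal g w < big) {S : Finset (CutNode N)} (hS : IsMinCut (netCap g w big) S) :
    ∃ x, S = labelCut x := by
  have hsoft : ∀ u v, 0 ≤ chainCap g u v + pairCap w u v := fun u v =>
    add_nonneg (chainCap_nonneg hg u v) (pairCap_nonneg hw u v)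
  have hb0 : 0 ≤ big := le_trans (Finset.sum_nonneg fun u _ => Finset.sum_nonneg fun v _ => hsoft u v) hb.le
  refine exists_labelCut_of_not_rigid hN hS.1.1 hS.1.2 fun u hu v hv hr => ?_
  have h1 : big ≤ cutValue (netCap g w big) S := by
    calc big ≤ netCap g w big u v := by rw [netCap, if_pos hr]; linarith [hsoft u v]
      _ ≤ ∑ v ∈ Sᶜ, netCap g w big u v :=
        Finset.single_le_sum (f := fun v => netCap g w big u v)
          (fun v _ => netCap_nonneg hg hw hb0 u v) (Finset.mem_compl.2 hv)
      _ ≤ _ := Finset.single_le_sum (f := fun u => ∑ v ∈ Sᶜ, netCap g w big u v)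
          (fun u _ => Finset.sum_nonneg fun v _ => netCap_nonneg hg hw hb0 u v) hu
  set x : ∀ i, Fin (N i) := fun i => ⟨0, hN i⟩
  have h2 := hS.2 (labelCut x) (by simp) (by simp)
  have h3 : cutValue (netCap g w big) (labelCut x) ≤ softTotal g w := by
    rw [cutValue_eq]
    refine Finset.sum_le_sum fun u _ => Finset.sum_le_sum fun v _ => ?_
    split_ifs with h
    · rw [netCap, if_neg (not_rigid_labelCut x h.1 h.2), add_zero]
    · exact hsoft u v
  linarith

end Network

/-! ### The Bethe free energy on a mesh as a cut value -/

theorem sum_range_telescope_le (h : ℕ → ℝ) (x N : ℕ) :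
    ∑ r ∈ Finset.range N, (if 1 ≤ r ∧ r ≤ x then h r - h (r - 1) else 0) = h (min x (N - 1)) - h 0 := by
  induction N with
  | zero => simp
  | succ N ih =>
    rw [Finset.sum_range_succ, ih]
    split_ifs with hc
    · rw [show min x (N - 1) = N - 1 by omega, show min x (N + 1 - 1) = N by omega]; ring
    · rw [show min x (N - 1) = min x (N + 1 - 1) by omega]; ring

theorem sum_range_telescope_lt (h : ℕ → ℝ) {y N : ℕ} (hy : y < N) :
    ∑ s ∈ Finset.range N, (if y < s then h s - h (s - 1) else 0) = h (N - 1) - h y := by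
  have h1 := sum_range_telescope_le h (N - 1) N
  have h2 := sum_range_telescope_le h y N
  rw [min_self] at h1
  rw [show min y (N - 1) = y by omega] at h2
  have : ∑ s ∈ Finset.range N, (if y < s then h s - h (s - 1) else 0)
      = ∑ r ∈ Finset.range N, (if 1 ≤ r ∧ r ≤ N - 1 then h r - h (r - 1) else 0)
      - ∑ r ∈ Finset.range N, (if 1 ≤ r ∧ r ≤ y then h r - h (r - 1) else 0) := by
    rw [← Finset.sum_sub_distrib]
    refine Finset.sum_congr rfl fun s hs => ?_
    have := Finset.mem_range.1 hs
    by_cases c1 : y < s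
    · rw [if_pos c1, if_pos (by omega), if_neg (by omega), sub_zero]
    · rw [if_neg c1]
      by_cases c2 : 1 ≤ s
      · rw [if_pos (by omega), if_pos (by omega), sub_self]
      · rw [if_neg (by omega), if_neg (by omega), sub_self]
  rw [this, h1, h2]; ring

/-- The second difference of an interaction, with the sign that makes it non-negative for
submodular interactions. -/
def mixedDiff (f : ℕ → ℕ → ℝ) (r s : ℕ) : ℝ :=
  f (r - 1) s + f r (s - 1) - f r s - f (r - 1) (s - 1)

/-- A function of two labels is, up to functions of one label, the sum of its mixed differences over the
pairs of labels `r ≤ x`, `s > y` that the cut separates. -/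
theorem sum_mixedDiff (f : ℕ → ℕ → ℝ) {x y K L : ℕ} (hx : x < K) (hy : y < L) :
    ∑ r ∈ Finset.range K, ∑ s ∈ Finset.range L,
      (if (1 ≤ r ∧ r ≤ x) ∧ y < s then mixedDiff f r s else 0)
      = f x y - f x (L - 1) - f 0 y + f 0 (L - 1) := by
  have h1 : ∀ r, ∑ s ∈ Finset.range L, (if (1 ≤ r ∧ r ≤ x) ∧ y < s then mixedDiff f r s else 0)
      = if 1 ≤ r ∧ r ≤ x then (f r y - f r (L - 1)) - (f (r - 1) y - f (r - 1) (L - 1)) else 0 := by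
    intro r
    split_ifs with h
    · have := sum_range_telescope_lt (fun s => f (r - 1) s - f r s) hy
      rw [show (f r y - f r (L - 1)) - (f (r - 1) y - f (r - 1) (L - 1))
        = (f (r - 1) (L - 1) - f r (L - 1)) - (f (r - 1) y - f r y) by ring, ← this]
      refine Finset.sum_congr rfl fun s _ => ?_
      simp only [h, and_self, true_and]
      congr 1
      unfold mixedDiff; ring
    · simp [h]
  simp only [h1]
  rw [sum_range_telescope_le (fun r => f r y - f r (L - 1)), show min x (K - 1) = x by omega]; ring

namespace MRF

variable {n : ℕ} (M : MRF n) (N : Fin n → ℕ) (d : Fin n → ℕ → ℝ)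

/-- The unary costs of the network: the singleton terms, and the edge terms with the last label of
the later and the first label of the earlier variable. -/
def netUnary (p : Σ i : Fin n, Fin (N i)) : ℝ :=
  -(M.θ p.1 * d p.1 p.2) + ((M.deg p.1 : ℝ) - 1) * Real.binEntropy (d p.1 p.2)
    + ∑ j ∈ M.nbrs p.1, edgeFn (M.W p.1 j) (d p.1 p.2) (d j (if p.1 < j then N j - 1 else 0))

/-- The interactions of the network. -/
def netPair (p q : Σ i : Fin n, Fin (N i)) : ℝ :=
  if (p.1 < q.1 ∧ M.W p.1 q.1 ≠ 0) ∧ 1 ≤ (p.2 : ℕ) ∧ 1 ≤ (q.2 : ℕ) then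
    mixedDiff (fun r s => edgeFn (M.W p.1 q.1) (d p.1 r) (d q.1 s)) p.2 q.2 else 0

variable {M N d}

theorem netPair_nonneg (hM : M.Associative) (hd : ∀ i r, r < N i → d i r ∈ Set.Ioo (0 : ℝ) 1)
    (hmono : ∀ i r s, r ≤ s → s < N i → d i r ≤ d i s) (p q : Σ i : Fin n, Fin (N i)) :
    0 ≤ M.netPair N d p q := by
  unfold netPair
  split_ifs with h
  · have hp := p.2.2
    have hq := q.2.2
    have := edgeFn_submodular (hM.W_pos h.1.2) (hd p.1 (p.2 - 1) (by omega)) (hd p.1 p.2 hp)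
      (hd q.1 (q.2 - 1) (by omega)) (hd q.1 q.2 hq) (hmono _ _ _ (Nat.sub_le _ _) hp)
      (hmono _ _ _ (Nat.sub_le _ _) hq)
    unfold mixedDiff; linarith
  · exact le_rfl

/-- Up to a constant the free energy at a labelling is the sum of the unary costs and of the
interactions across the cut. -/
theorem F_eq_net (x : ∀ i, Fin (N i)) :
    ∑ i, M.netUnary N d ⟨i, x i⟩
      + ∑ p : Σ i : Fin n, Fin (N i), ∑ q : Σ i : Fin n, Fin (N i),
        (if p.2 ≤ x p.1 ∧ x q.1 < q.2 then M.netPair N d p q else 0)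
      = M.F (fun i => d i (x i))
        + ∑ p ∈ M.edges, edgeFn (M.W p.1 p.2) (d p.1 0) (d p.2 (N p.2 - 1)) := by
  have h1 : ∑ p : Σ i : Fin n, Fin (N i), ∑ q : Σ i : Fin n, Fin (N i),
        (if p.2 ≤ x p.1 ∧ x q.1 < q.2 then M.netPair N d p q else 0)
      = ∑ p ∈ M.edges, (edgeFn (M.W p.1 p.2) (d p.1 (x p.1)) (d p.2 (x p.2))
        - edgeFn (M.W p.1 p.2) (d p.1 (x p.1)) (d p.2 (N p.2 - 1))
        - edgeFn (M.W p.1 p.2) (d p.1 0) (d p.2 (x p.2))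
        + edgeFn (M.W p.1 p.2) (d p.1 0) (d p.2 (N p.2 - 1))) := by
    simp only [Fintype.sum_sigma]
    rw [edges, Finset.sum_filter, Fintype.sum_prod_type]
    refine Finset.sum_congr rfl fun i _ => ?_
    rw [Finset.sum_comm]
    refine Finset.sum_congr rfl fun j _ => ?_
    simp only
    split_ifs with h
    · rw [← sum_mixedDiff (fun r s => edgeFn (M.W i j) (d i r) (d j s)) (x i).2 (x j).2,
        Finset.sum_range]
      refine Finset.sum_congr rfl fun r _ => ?_
      rw [Finset.sum_range]
      refine Finset.sum_congr rfl fun s _ => ?_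
      simp only [netPair, h, ne_eq, not_false_eq_true, and_self, true_and, Fin.le_def, Fin.lt_def]
      by_cases c : (x j : ℕ) < s
      · simp only [c, and_true, show 1 ≤ (s : ℕ) by omega, ← ite_and]
        congr 1
        simp only [and_comm]
      · simp [c]
    · refine Finset.sum_eq_zero fun r _ => Finset.sum_eq_zero fun s _ => ?_
      simp [netPair, h]
  have h2 : ∑ i, ∑ j ∈ M.nbrs i, edgeFn (M.W i j) (d i (x i)) (d j (if i < j then N j - 1 else 0))
      = ∑ p ∈ M.edges, (edgeFn (M.W p.1 p.2) (d p.1 (x p.1)) (d p.2 (N p.2 - 1))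
        + edgeFn (M.W p.1 p.2) (d p.1 0) (d p.2 (x p.2))) := by
    rw [← sum_edges_add_swap fun i j => edgeFn (M.W i j) (d i (x i)) (d j (if i < j then N j - 1 else 0))]
    refine Finset.sum_congr rfl fun p hp => ?_
    have hlt := (mem_edges.1 hp).1
    rw [if_pos hlt, if_neg hlt.asymm, M.symm p.2 p.1, edgeFn_comm _ (d p.2 _)]
  have h3 : M.F (fun i => d i (x i)) = ∑ p ∈ M.edges, edgeFn (M.W p.1 p.2) (d p.1 (x p.1)) (d p.2 (x p.2))
      + ∑ i, (-(M.θ i * d i (x i)) + ((M.deg i : ℝ) - 1) * Real.binEntropy (d i (x i))) := rfl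
  simp only [netUnary]
  rw [h1, h3, Finset.sum_add_distrib, h2]
  simp only [Finset.sum_add_distrib, Finset.sum_sub_distrib]
  ring

end MRF
end Bethe
end

noncomputable section
namespace Bethe
namespace MRF
variable {n : ℕ} {M : MRF n}

/-! ### Submodularity and graph cuts on a mesh -/

theorem edgeTerm_submodular (hM : M.Associative) {k : ℕ} {i j : Fin n} (h : M.graph.Adj i j) {K L : ℕ}
    {d : Fin K → ℝ} {d' : Fin L → ℝ} (hd : Monotone d) (hd' : Monotone d')
    (hs : ∀ r, d r ∈ M.side k i) (hs' : ∀ r, d' r ∈ M.side k j) :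
    Submodular fun r s => M.edgeTerm i j (d r) (d' s) := by
  have hw := hM.W_pos (adj_iff.1 h)
  intro a a' b b'
  have ho := fun r => hM.side_subset k i (hs r)
  have ho' := fun r => hM.side_subset k j (hs' r)
  simp only [edgeTerm_eq]
  rcases le_total a a' with h1 | h1 <;> rcases le_total b b' with h2 | h2 <;>
    simp only [min_eq_left, min_eq_right, max_eq_left, max_eq_right, h1, h2]
  · exact le_rfl
  · exact edgeFn_submodular hw (ho _) (ho _) (ho' _) (ho' _) (hd h1) (hd' h2)
  · have := edgeFn_submodular hw (ho _) (ho _) (ho' _) (ho' _) (hd h1) (hd' h2)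
    linarith
  · linarith

/-- The network of capacities `netCap` with the costs shifted by `K` to be non-negative represents
the free energy on a mesh. -/
theorem netCap_represents (hM : M.Associative) {N : Fin n → ℕ} {d : Fin n → ℕ → ℝ} (hN : ∀ i, 0 < N i)
    (hd : ∀ i r, r < N i → d i r ∈ Set.Ioo (0 : ℝ) 1)
    (hmono : ∀ i r s, r ≤ s → s < N i → d i r ≤ d i s) {K big : ℝ}
    (hK : ∀ p, 0 ≤ M.netUnary N d p + K)
    (hbig : softTotal (fun p => M.netUnary N d p + K) (M.netPair N d) < big) :
    (∀ u v, 0 ≤ netCap (fun p => M.netUnary N d p + K) (M.netPair N d) big u v) ∧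
      (∃ c : ℝ, ∀ x : (∀ i, Fin (N i)),
        cutValue (netCap (fun p => M.netUnary N d p + K) (M.netPair N d) big) (labelCut x)
          = M.F (fun i => d i (x i)) + c) ∧
      ∀ S, IsMinCut (netCap (fun p => M.netUnary N d p + K) (M.netPair N d) big) S →
        ∃ x, S = labelCut x := by
  have hw := netPair_nonneg hM hd hmono
  have hb0 : 0 ≤ big := le_trans (Finset.sum_nonneg fun u _ => Finset.sum_nonneg fun v _ =>
    add_nonneg (chainCap_nonneg hK u v) (pairCap_nonneg hw u v)) hbig.le
  refine ⟨netCap_nonneg hK hw hb0, ⟨∑ p ∈ M.edges, edgeFn (M.W p.1 p.2) (d p.1 0) (d p.2 (N p.2 - 1))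
    + n * K, fun x => ?_⟩, fun S hS => eq_labelCut_of_isMinCut hN hK hw hbig hS⟩
  have := F_eq_net (M := M) (d := d) x
  rw [cutValue_labelCut, Finset.sum_add_distrib]
  simp only [Finset.sum_const, Finset.card_univ, Fintype.card_fin, nsmul_eq_mul]
  linarith

/-- The unary costs are shifted by the sum of their absolute values, and the rigid arcs get more than the
total capacity of all other arcs. -/
theorem isGraphCutProblem (hM : M.Associative) {k : ℕ} {N : Fin n → ℕ} {d : ∀ i, Fin (N i) → ℝ}
    (hN : ∀ i, 0 < N i) (hmono : ∀ i, Monotone (d i)) (hs : ∀ i r, d i r ∈ M.side k i) :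
    IsGraphCutProblem N fun x => M.F fun i => d i (x i) := by
  set d' : Fin n → ℕ → ℝ := fun i r => if h : r < N i then d i ⟨r, h⟩ else 0
  have e : ∀ i (r : ℕ) (h : r < N i), d' i r = d i ⟨r, h⟩ := fun i r h => dif_pos h
  have e' : ∀ x : (∀ i, Fin (N i)), (fun i => d' i (x i)) = fun i => d i (x i) :=
    fun x => funext fun i => e i _ (x i).2
  obtain ⟨h1, ⟨c, h2⟩, h3⟩ := netCap_represents hM (d := d')
    (K := ∑ p, |M.netUnary N d' p|) (big := _ + 1) hN
    (fun i r h => by rw [e i r h]; exact hM.side_subset k i (hs i _))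
    (fun i r s hrs h => by rw [e i s h, e i r (hrs.trans_lt h)]; exact hmono i hrs)
    (fun p => by
      have := Finset.single_le_sum (f := fun p => |M.netUnary N d' p|) (fun p _ => abs_nonneg _)
        (Finset.mem_univ p)
      have := neg_abs_le (M.netUnary N d' p)
      linarith) (lt_add_one _)
  exact ⟨_, h1, ⟨c, fun x => by rw [h2 x, e' x]⟩, h3⟩

end MRF
end Bethe
end

noncomputable section
namespace Bethe

/-! ### Minimum cuts by push-relabel -/

/-- The state of the push-relabel algorithm on the nodes `0, …, V - 1`, with source `0` and sink
`1`: residual capacities, excesses, heights and current arcs, and the state of the current pass: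
its position, whether it has met an active node, and whether the algorithm still runs. -/
structure Flow where
  res : ℕ → ℕ → ℝ
  exc : ℕ → ℝ
  ht : ℕ → ℕ
  cur : ℕ → ℕ
  pos : ℕ
  act : ℕ
  run : ℕ

namespace Flow

/-- Inner nodes with positive excess are active as long as their height is below `V`. -/
def Active (V : ℕ) (s : Flow) (v : ℕ) : Prop := (2 ≤ v ∧ v < V) ∧ 0 < s.exc v ∧ s.ht v < V

/-- Sending `δ` along the arc from `u` to `w`. -/
def push (s : Flow) (u w : ℕ) (δ : ℝ) : Flow :=
  { s with
    res := fun a b => if a = u ∧ b = w then s.res u w - δ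
      else if a = w ∧ b = u then s.res w u + δ else s.res a b
    exc := fun a => if a = u then s.exc u - δ else if a = w then s.exc w + δ else s.exc a }

open Classical in
/-- One step: the node at the current position either pushes along its current arc, or advances
it, or is relabelled by one if all its arcs have been tried; a pass ends at position `V`. -/
def step (V : ℕ) (s : Flow) : Flow :=
  if s.pos < V then
    if s.Active V s.pos then
      if s.cur s.pos < V then
        if 0 < s.res s.pos (s.cur s.pos) ∧ s.ht s.pos = s.ht (s.cur s.pos) + 1 then
          if s.exc s.pos ≤ s.res s.pos (s.cur s.pos) then
            { s.push s.pos (s.cur s.pos) (s.exc s.pos) with pos := s.pos + 1, act := 1 }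
          else
            { s.push s.pos (s.cur s.pos) (s.res s.pos (s.cur s.pos)) with
              cur := Function.update s.cur s.pos (s.cur s.pos + 1), act := 1 }
        else { s with cur := Function.update s.cur s.pos (s.cur s.pos + 1), act := 1 }
      else
        { s with
          ht := Function.update s.ht s.pos (s.ht s.pos + 1)
          cur := Function.update s.cur s.pos 0
          act := 1 }
    else { s with pos := s.pos + 1 }
  else if s.act = 1 then { s with pos := 0, act := 0 }
  else { s with run := 0 }

/-- The invariant: `res` is the residual graph of a preflow, `ht` is a valid labelling, and arcs
before the current arc are not admissible. -/
structure Inv (V : ℕ) (cap : ℕ → ℕ → ℝ) (s : Flow) : Prop where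
  res_nonneg : ∀ u v, u < V → v < V → 0 ≤ s.res u v
  res_add : ∀ u v, u < V → v < V → s.res u v + s.res v u = cap u v + cap v u
  exc_eq : ∀ v, v < V → v ≠ 0 → s.exc v = ∑ u ∈ Finset.range V, (cap u v - s.res u v)
  exc_nonneg : ∀ v, v < V → v ≠ 0 → 0 ≤ s.exc v
  valid : ∀ u v, u < V → v < V → 0 < s.res u v → s.ht u ≤ s.ht v + 1
  ht_source : s.ht 0 = V
  ht_sink : s.ht 1 = 0
  ht_le : ∀ v, v < V → s.ht v ≤ V
  cur_le : ∀ v, v < V → s.cur v ≤ V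
  cur_spec : ∀ v w, v < V → w < s.cur v → ¬ (0 < s.res v w ∧ s.ht v = s.ht w + 1)
  pos_le : s.pos ≤ V
  act_le : s.act ≤ 1
  run_le : s.run ≤ 1
  idle : s.act = 0 → ∀ v, v < s.pos → ¬ s.Active V v
  halted : s.run = 0 → ∀ v, ¬ s.Active V v

/-- A push along an admissible arc keeps the invariant: the reverse arc, which may become residual, leads
from a lower to a higher node. The current arc advances only if the arc has been saturated. -/
theorem Inv.push {V : ℕ} {cap : ℕ → ℕ → ℝ} {s : Flow} (hs : s.Inv V cap) {u w : ℕ} {δ : ℝ}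
    (hu : 2 ≤ u) (huV : u < V) (hw : w < V) (hδ : 0 ≤ δ) (hδr : δ ≤ s.res u w) (hδe : δ ≤ s.exc u)
    (hh : s.ht u = s.ht w + 1) (hr : s.run = 1) (pos : ℕ) (hp : pos ≤ V) (cur : ℕ → ℕ)
    (hc : ∀ v, v < V → cur v ≤ V)
    (hc' : ∀ v, v < V → cur v = s.cur v ∨ v = u ∧ cur v = s.cur v + 1 ∧ s.cur v = w ∧ δ = s.res u w) :
    Inv V cap { s.push u w δ with cur := cur, pos := pos, act := 1 } := by
  have huw : u ≠ w := by rintro rfl; omega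
  refine ⟨?_, ?_, ?_, ?_, ?_, hs.ht_source, hs.ht_sink, hs.ht_le, hc, ?_, hp, le_rfl, hs.run_le, ?_, ?_⟩
  · intro a b ha hb
    have := hs.res_nonneg a b ha hb
    have := hs.res_nonneg w u hw huV
    simp only [Flow.push]; split_ifs <;> linarith
  · intro a b ha hb
    have := hs.res_add a b ha hb
    have := hs.res_add u w huV hw
    simp only [Flow.push]
    split_ifs <;> first | (exfalso; omega) | skip
    · rename_i h _ _; obtain ⟨rfl, rfl⟩ := h; linarith
    · rename_i _ h _; obtain ⟨rfl, rfl⟩ := h; linarith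
    · exact hs.res_add a b ha hb
  · intro v hv hv0
    have h0 := hs.exc_eq v hv hv0
    simp only [Flow.push]
    by_cases h1 : v = u
    · subst h1
      rw [if_pos rfl, h0, ← Finset.sum_erase_add _ _ (Finset.mem_range.2 hw),
        ← Finset.sum_erase_add _ _ (Finset.mem_range.2 hw)]
      have : ∀ a ∈ (Finset.range V).erase w, cap a v - s.res a v
          = cap a v - (if a = v ∧ v = w then s.res v w - δ
            else if a = w ∧ v = v then s.res w v + δ else s.res a v) := by
        intro a ha
        rw [if_neg (by tauto), if_neg (by simp [Finset.ne_of_mem_erase ha])]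
      rw [Finset.sum_congr rfl this, if_neg (by tauto), if_pos ⟨rfl, rfl⟩]; ring
    · by_cases h2 : v = w
      · subst h2
        rw [if_neg h1, if_pos rfl, h0, ← Finset.sum_erase_add _ _ (Finset.mem_range.2 huV),
          ← Finset.sum_erase_add _ _ (Finset.mem_range.2 huV)]
        have : ∀ a ∈ (Finset.range V).erase u, cap a v - s.res a v
            = cap a v - (if a = u ∧ v = v then s.res u v - δ
              else if a = v ∧ v = u then s.res v u + δ else s.res a v) := by
          intro a ha
          rw [if_neg (by simp [Finset.ne_of_mem_erase ha]), if_neg (by tauto)]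
        rw [Finset.sum_congr rfl this, if_pos ⟨rfl, rfl⟩]; ring
      · rw [if_neg h1, if_neg h2, h0]
        simp [h1, h2]
  · intro v hv hv0
    have := hs.exc_nonneg v hv hv0
    simp only [Flow.push]; split_ifs with h1 h2
    · linarith
    · subst h2; linarith
    · exact this
  · intro a b ha hb hab
    simp only [Flow.push] at hab ⊢
    split_ifs at hab with h1 h2
    · obtain ⟨rfl, rfl⟩ := h1; omega
    · obtain ⟨rfl, rfl⟩ := h2; omega
    · exact hs.valid a b ha hb hab
  · intro v b hv hb
    simp only [Flow.push] at hb ⊢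
    rcases hc' v hv with h | ⟨rfl, h, h', rfl⟩
    · rw [h] at hb
      have := hs.cur_spec v b hv hb
      split_ifs with h1 h2
      · obtain ⟨rfl, rfl⟩ := h1
        rintro ⟨h3, h4⟩
        exact this ⟨by linarith, h4⟩
      · obtain ⟨rfl, rfl⟩ := h2; omega
      · exact this
    · by_cases hbw : b = w
      · subst hbw; simp
      · rw [if_neg (by tauto), if_neg (by tauto)]
        exact hs.cur_spec v b hv (by omega)
  · simp
  · intro h; exact absurd (hr.symm.trans h) one_ne_zero

/-- All steps keep the invariant. A relabelling by one is valid because a node whose arcs have all been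
tried has no admissible arc, so that its residual arcs lead to nodes that are at least as high. -/
theorem Inv.step {V : ℕ} {cap : ℕ → ℕ → ℝ} {s : Flow} (hs : s.Inv V cap) (hr : s.run = 1) :
    (s.step V).Inv V cap := by
  have hrun : ∀ {P : Prop}, s.run = 0 → P := fun h => absurd (hr.symm.trans h) one_ne_zero
  unfold Flow.step
  split_ifs with h1 h2 h3 h4 h5 h6
  · exact hs.push h2.1.1 h1 h3 h2.2.1.le h5 le_rfl h4.2 hr _ h1 _ hs.cur_le fun v _ => Or.inl rfl
  · refine hs.push h2.1.1 h1 h3 h4.1.le le_rfl (not_le.1 h5).le h4.2 hr _ h1.le _ (fun v hv => ?_)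
      fun v _ => ?_
    · rcases eq_or_ne v s.pos with rfl | hne
      · simpa using h3
      · simpa [hne] using hs.cur_le v hv
    · rcases eq_or_ne v s.pos with rfl | hne
      · right; simp
      · left; simp [hne]
  · refine ⟨hs.res_nonneg, hs.res_add, hs.exc_eq, hs.exc_nonneg, hs.valid, hs.ht_source, hs.ht_sink,
      hs.ht_le, fun v hv => ?_, fun v w hv hw => ?_, hs.pos_le, le_rfl, hs.run_le, by simp, hrun⟩
    · rcases eq_or_ne v s.pos with rfl | hne
      · simpa using h3
      · simpa [hne] using hs.cur_le v hv
    · rcases eq_or_ne v s.pos with rfl | hne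
      · simp only [Function.update_self] at hw
        rcases Nat.lt_succ_iff_lt_or_eq.1 hw with h | rfl
        · exact hs.cur_spec _ _ hv h
        · exact h4
      · simp only [Function.update_of_ne hne] at hw
        exact hs.cur_spec _ _ hv hw
  · have hadm : ∀ w, w < V → 0 < s.res s.pos w → s.ht s.pos ≤ s.ht w := by
      intro w hw hres
      have := hs.valid _ _ h1 hw hres
      have := hs.cur_spec s.pos w h1 (by omega)
      by_contra hc
      exact this ⟨hres, by omega⟩
    have hn0 : s.pos ≠ 0 := by have := h2.1.1; omega
    have hn1 : s.pos ≠ 1 := by have := h2.1.1; omega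
    refine ⟨hs.res_nonneg, hs.res_add, hs.exc_eq, hs.exc_nonneg, fun u v hu hv huv => ?_, ?_, ?_,
      fun v hv => ?_, fun v hv => ?_, fun v w hv hw => ?_, hs.pos_le, le_rfl, hs.run_le, by simp, hrun⟩
    · have := hs.valid u v hu hv huv
      simp only [Function.update_apply]
      split_ifs with a b b
      · omega
      · subst a; have := hadm v hv huv; omega
      · subst b; omega
      · exact this
    · simpa [Function.update_of_ne hn0.symm] using hs.ht_source
    · simpa [Function.update_of_ne hn1.symm] using hs.ht_sink
    · rcases eq_or_ne v s.pos with rfl | hne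
      · simpa using h2.2.2
      · simpa [hne] using hs.ht_le v hv
    · rcases eq_or_ne v s.pos with rfl | hne
      · simp
      · simpa [hne] using hs.cur_le v hv
    · rcases eq_or_ne v s.pos with rfl | hne
      · simp at hw
      · simp only [Function.update_of_ne hne] at hw ⊢
        have := hs.cur_spec v w hv hw
        rintro ⟨hres, hht⟩
        rcases eq_or_ne w s.pos with rfl | hw'
        · rw [Function.update_self] at hht
          have := hs.valid v _ hv h1 hres
          omega
        · rw [Function.update_of_ne hw'] at hht
          exact this ⟨hres, hht⟩
  · refine ⟨hs.res_nonneg, hs.res_add, hs.exc_eq, hs.exc_nonneg, hs.valid, hs.ht_source, hs.ht_sink,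
      hs.ht_le, hs.cur_le, hs.cur_spec, h1, hs.act_le, hs.run_le, fun ha v hv => ?_, hrun⟩
    rcases Nat.lt_succ_iff_lt_or_eq.1 hv with h | rfl
    · exact hs.idle ha v h
    · exact h2
  · exact ⟨hs.res_nonneg, hs.res_add, hs.exc_eq, hs.exc_nonneg, hs.valid, hs.ht_source, hs.ht_sink,
      hs.ht_le, hs.cur_le, hs.cur_spec, Nat.zero_le _, zero_le_one, hs.run_le,
      fun _ v hv => absurd hv (Nat.not_lt_zero v), hrun⟩
  · refine ⟨hs.res_nonneg, hs.res_add, hs.exc_eq, hs.exc_nonneg, hs.valid, hs.ht_source, hs.ht_sink,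
      hs.ht_le, hs.cur_le, hs.cur_spec, hs.pos_le, hs.act_le, zero_le_one, hs.idle, fun _ v hv => ?_⟩
    have ha : s.act = 0 := by have := hs.act_le; omega
    exact hs.idle ha v (by have := hv.1.2; omega) hv

open Classical in
/-- A bound for the heights of active nodes; nodes that were already visited in the current pass
count one more, so that the bound drops at the end of a pass without relabelling. -/
def level (V : ℕ) (s : Flow) : ℕ :=
  max ((Finset.range V).sup fun v => if s.Active V v then s.ht v + 1 + (if v < s.pos then 1 else 0) else 0)
    s.act

/-- The potential that bounds the number of remaining steps. -/
def potential (V : ℕ) (s : Flow) : ℕ :=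
  (∑ v ∈ Finset.range V, (V - s.ht v)) * (V + 1) + ∑ v ∈ Finset.range V, (V - s.cur v)
    + (V + 3) * (s.level V + 2 * ∑ v ∈ Finset.range V, (V - s.ht v)) + (V - s.pos) + s.run

theorem le_level {V : ℕ} {s : Flow} {v : ℕ} (h : s.Active V v) :
    s.ht v + 1 + (if v < s.pos then 1 else 0) ≤ s.level V := by
  classical
  refine le_trans ?_ (le_max_left _ _)
  have := Finset.le_sup (f := fun v => if s.Active V v then s.ht v + 1 + (if v < s.pos then 1 else 0)
    else 0) (Finset.mem_range.2 h.1.2)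
  simpa [h] using this

theorem level_le {V : ℕ} {s : Flow} {B : ℕ} (ha : s.act ≤ B)
    (h : ∀ v, s.Active V v → s.ht v + 1 + (if v < s.pos then 1 else 0) ≤ B) : s.level V ≤ B := by
  refine max_le (Finset.sup_le fun v _ => ?_) ha
  split_ifs with h1 h2
  · simpa [h2] using h v h1
  · simpa [h2] using h v h1
  · exact Nat.zero_le _

theorem sum_range_update {V p : ℕ} (f : ℕ → ℕ) (a : ℕ) (hp : p < V) :
    ∑ v ∈ Finset.range V, (V - Function.update f p a v) + (V - f p)
      = ∑ v ∈ Finset.range V, (V - f v) + (V - a) := by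
  rw [← Finset.sum_erase_add _ _ (Finset.mem_range.2 hp),
    ← Finset.sum_erase_add (Finset.range V) (fun v => V - f v) (Finset.mem_range.2 hp)]
  have : ∀ v ∈ (Finset.range V).erase p, V - Function.update f p a v = V - f v := fun v hv => by
    rw [Function.update_of_ne (Finset.ne_of_mem_erase hv)]
  rw [Finset.sum_congr rfl this, Function.update_self]; omega

/-- Advancing an arc lowers `∑ (V - cur v)`, and advancing the position lowers `V - pos`. A relabelling
lowers the sum `∑ (V - ht v)`, which pays for the reset of the current arc and for a rise of the level.
The end of a pass lowers the level, which pays for the reset of the position. -/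
theorem potential_step {V : ℕ} {cap : ℕ → ℕ → ℝ} {s : Flow} (hs : s.Inv V cap) (hr : s.run = 1) :
    (s.step V).potential V + 1 ≤ s.potential V := by
  -- a push activates a node lower by one, which does not raise the level even if it counts as visited
  have push_level : ∀ (w : ℕ) (δ : ℝ) (pos : ℕ) (cur : ℕ → ℕ), s.Active V s.pos →
      s.ht s.pos = s.ht w + 1 → (pos = s.pos ∨ pos = s.pos + 1 ∧ δ = s.exc s.pos) →
      level V { s.push s.pos w δ with cur := cur, pos := pos, act := 1 } ≤ s.level V := by
    intro w δ pos cur hact hh hpos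
    have h0 := le_level hact
    have hne : w ≠ s.pos := by rintro rfl; omega
    refine level_le (by simp only; omega) fun v hv => ?_
    simp only [Active, Flow.push] at hv ⊢
    by_cases h1 : v = s.pos
    · subst h1
      rcases hpos with rfl | ⟨rfl, rfl⟩
      · exact h0
      · simp at hv
    · by_cases h2 : v = w
      · subst h2; split_ifs <;> omega
      · simp only [h1, h2, if_false] at hv
        have := le_level (s := s) (V := V) (v := v) hv
        have h3 : (v < pos) ↔ v < s.pos := by omega
        simpa only [h3] using this
  unfold Flow.step
  split_ifs with h1 h2 h3 h4 h5 h6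
  · have := push_level (s.cur s.pos) (s.exc s.pos) (s.pos + 1) s.cur h2 h4.2 (Or.inr ⟨rfl, rfl⟩)
    have h7 := Nat.mul_le_mul_left (V + 3) (Nat.add_le_add_right this
      (2 * ∑ v ∈ Finset.range V, (V - s.ht v)))
    simp only [potential, Flow.push] at *
    omega
  · have := push_level (s.cur s.pos) (s.res s.pos (s.cur s.pos)) s.pos
      (Function.update s.cur s.pos (s.cur s.pos + 1)) h2 h4.2 (Or.inl rfl)
    have h7 := Nat.mul_le_mul_left (V + 3) (Nat.add_le_add_right this
      (2 * ∑ v ∈ Finset.range V, (V - s.ht v)))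
    have h8 := sum_range_update s.cur (s.cur s.pos + 1) h1
    simp only [potential, Flow.push] at *
    omega
  · have : level V { s with cur := Function.update s.cur s.pos (s.cur s.pos + 1), act := 1 } ≤ s.level V :=
      level_le (by have := le_level h2; simp only; omega) fun v hv => le_level (s := s) hv
    have h7 := Nat.mul_le_mul_left (V + 3) (Nat.add_le_add_right this
      (2 * ∑ v ∈ Finset.range V, (V - s.ht v)))
    have h8 := sum_range_update s.cur (s.cur s.pos + 1) h1
    simp only [potential] at *
    omega
  · have hl : level V { s with
        ht := Function.update s.ht s.pos (s.ht s.pos + 1)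
        cur := Function.update s.cur s.pos 0
        act := 1 } ≤ s.level V + 1 := by
      have h0 := le_level h2
      refine level_le (by simp only; omega) fun v hv => ?_
      simp only [Active] at hv ⊢
      rcases eq_or_ne v s.pos with rfl | hne
      · simp only [Function.update_self, lt_irrefl, if_false] at h0 ⊢; omega
      · simp only [Function.update_of_ne hne] at hv ⊢
        exact (le_level (s := s) hv).trans (Nat.le_succ _)
    have hlt := h2.2.2
    have hc := hs.cur_le _ h1
    have h8 := sum_range_update s.cur 0 h1
    have h9 := sum_range_update s.ht (s.ht s.pos + 1) h1
    simp only [potential] at *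
    generalize (∑ v ∈ Finset.range V, (V - Function.update s.ht s.pos (s.ht s.pos + 1) v)) = H' at *
    have h10 : ∑ v ∈ Finset.range V, (V - s.ht v) = H' + 1 := by omega
    rw [h10]
    have h7 := Nat.mul_le_mul_left (V + 3) (Nat.add_le_add_right hl (2 * H'))
    have e1 : (H' + 1) * (V + 1) = H' * (V + 1) + (V + 1) := by ring
    have e2 : (V + 3) * (s.level V + 2 * (H' + 1)) = (V + 3) * (s.level V + 1 + 2 * H') + (V + 3) := by ring
    omega
  · have : level V { s with pos := s.pos + 1 } ≤ s.level V := by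
      refine level_le (le_max_right _ _) fun v hv => ?_
      have h3 := le_level (s := s) hv
      have hne : v ≠ s.pos := by rintro rfl; exact h2 hv
      have h4 : (v < s.pos + 1) ↔ v < s.pos := by omega
      simpa only [h4] using h3
    have h7 := Nat.mul_le_mul_left (V + 3) (Nat.add_le_add_right this
      (2 * ∑ v ∈ Finset.range V, (V - s.ht v)))
    simp only [potential] at *
    omega
  · -- the end of a pass
    have hp : s.pos = V := by have := hs.pos_le; omega
    have hl1 : 1 ≤ s.level V := h6 ▸ le_max_right _ _
    have : level V { s with pos := 0, act := 0 } ≤ s.level V - 1 := by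
      refine level_le (Nat.zero_le _) fun v hv => ?_
      have h3 := le_level (s := s) hv
      rw [if_pos (by have := hv.1.2; omega)] at h3
      simp only [Nat.not_lt_zero, if_false]
      omega
    have h7 := Nat.mul_le_mul_left (V + 3) (Nat.add_le_add_right this
      (2 * ∑ v ∈ Finset.range V, (V - s.ht v)))
    have e2 : (V + 3) * (s.level V + 2 * ∑ v ∈ Finset.range V, (V - s.ht v))
        = (V + 3) * (s.level V - 1 + 2 * ∑ v ∈ Finset.range V, (V - s.ht v)) + (V + 3) := by
      obtain ⟨l, hl⟩ := Nat.exists_eq_add_of_le hl1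
      rw [hl, Nat.add_sub_cancel_left]; ring
    simp only [potential] at *
    omega
  · have : level V { s with run := 0 } ≤ s.level V :=
      level_le (le_max_right _ _) fun v hv => le_level (s := s) hv
    have h7 := Nat.mul_le_mul_left (V + 3) (Nat.add_le_add_right this
      (2 * ∑ v ∈ Finset.range V, (V - s.ht v)))
    simp only [potential] at *
    omega

/-- All parts of the potential are at most cubic in the number of nodes. -/
theorem potential_le {V : ℕ} {cap : ℕ → ℕ → ℝ} {s : Flow} (hs : s.Inv V cap) (hV : 2 ≤ V) :
    s.potential V ≤ 16 * V ^ 3 := by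
  have h1 : ∀ f : ℕ → ℕ, ∑ v ∈ Finset.range V, (V - f v) ≤ V * V := fun f => by
    refine (Finset.sum_le_card_nsmul _ _ V fun v _ => Nat.sub_le _ _).trans ?_
    simp
  have h2 : s.level V ≤ V + 1 := by
    refine level_le (by have := hs.act_le; omega) fun v hv => ?_
    have := hv.2.2
    split_ifs <;> omega
  have ha := h1 s.ht
  have hb := h1 s.cur
  have hr := hs.run_le
  unfold potential
  set H := ∑ v ∈ Finset.range V, (V - s.ht v)
  have e1 : H * (V + 1) ≤ V * V * (V + 1) := Nat.mul_le_mul_right _ ha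
  have e2 : (V + 3) * (s.level V + 2 * H) ≤ (V + 3) * (V + 1 + 2 * (V * V)) :=
    Nat.mul_le_mul_left _ (by omega)
  have e3 : 2 * (V * V) ≤ V ^ 3 := by
    have := Nat.mul_le_mul_right (V * V) hV; rw [pow_succ, sq]; linarith
  have e4 : 2 * V ≤ V * V := Nat.mul_le_mul_right V hV
  have e5 : V - s.pos ≤ V := Nat.sub_le _ _
  nlinarith

/-- The invariant holds initially, when the arcs out of the source are saturated. -/
theorem inv_of_saturated {V : ℕ} {cap : ℕ → ℕ → ℝ} {s : Flow}
    (hcap : ∀ u v, u < V → v < V → 0 ≤ cap u v) (h0 : cap 0 0 = 0) (hV : 2 ≤ V)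
    (hres : ∀ u v, u < V → v < V →
      s.res u v = if u = 0 then 0 else if v = 0 then cap u 0 + cap 0 u else cap u v)
    (hexc : ∀ v, v < V → s.exc v = cap 0 v) (hht : ∀ v, v < V → s.ht v = if v = 0 then V else 0)
    (hcur : ∀ v, v < V → s.cur v = 0) (hpos : s.pos = 0) (hact : s.act = 0) (hrun : s.run = 1) :
    s.Inv V cap := by
  have hV0 : 0 < V := by omega
  refine ⟨?_, ?_, ?_, ?_, ?_, ?_, ?_, ?_, fun v hv => by simp [hcur v hv],
    fun v w hv hw => by simp [hcur v hv] at hw, by simp [hpos], by simp [hact], by simp [hrun],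
    by simp [hpos], by simp [hrun]⟩
  · intro u v hu hv
    have := hcap u v hu hv
    have := hcap u 0 hu hV0
    have := hcap 0 u hV0 hu
    rw [hres u v hu hv]; split_ifs <;> linarith
  · intro u v hu hv
    rw [hres u v hu hv, hres v u hv hu]
    split_ifs with h1 h2 h2 <;> (try subst h1) <;> (try subst h2) <;> simp_all
    exact add_comm _ _
  · intro v hv hv0
    rw [hexc v hv, Finset.sum_eq_single 0]
    · simp [hres 0 v hV0 hv]
    · intro u hu hu0; simp [hres u v (Finset.mem_range.1 hu) hv, hu0, hv0]
    · intro h; exact absurd (Finset.mem_range.2 hV0) h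
  · intro v hv _; rw [hexc v hv]; exact hcap 0 v hV0 hv
  · intro u v hu hv h
    rw [hres u v hu hv] at h
    rw [hht u hu]
    split_ifs at h with h1
    · exact absurd h (lt_irrefl 0)
    all_goals simp [h1]
  · rw [hht 0 hV0, if_pos rfl]
  · rw [hht 1 (by omega), if_neg one_ne_zero]
  · intro v hv; rw [hht v hv]; split_ifs <;> omega

open Classical in
/-- The capacity of the cut with source side `S`, on the nodes below `V`. -/
def cutCap (V : ℕ) (cap : ℕ → ℕ → ℝ) (S : ℕ → Prop) : ℝ :=
  ∑ u ∈ Finset.range V, ∑ v ∈ Finset.range V, if S u ∧ ¬ S v then cap u v else 0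

open Classical in
/-- The net flow across a cut is the total excess of its sink side. -/
theorem Inv.net_flow {V : ℕ} {cap : ℕ → ℕ → ℝ} {s : Flow} (hs : s.Inv V cap) {S : ℕ → Prop} (h0 : S 0) :
    ∑ u ∈ Finset.range V, ∑ v ∈ Finset.range V, (if S u ∧ ¬ S v then cap u v - s.res u v else 0)
      = ∑ v ∈ Finset.range V, if S v then 0 else s.exc v := by
  -- the flow inside the sink side cancels
  have hanti : ∑ u ∈ Finset.range V, ∑ v ∈ Finset.range V,
      (if ¬ S u ∧ ¬ S v then cap u v - s.res u v else 0) = 0 := by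
    have : ∑ u ∈ Finset.range V, ∑ v ∈ Finset.range V,
        (if ¬ S u ∧ ¬ S v then cap u v - s.res u v else 0)
        = -∑ u ∈ Finset.range V, ∑ v ∈ Finset.range V,
        (if ¬ S u ∧ ¬ S v then cap u v - s.res u v else 0) := by
      conv_lhs => rw [Finset.sum_comm]
      rw [← Finset.sum_neg_distrib]
      refine Finset.sum_congr rfl fun u hu => ?_
      rw [← Finset.sum_neg_distrib]
      refine Finset.sum_congr rfl fun v hv => ?_
      have := hs.res_add u v (Finset.mem_range.1 hu) (Finset.mem_range.1 hv)
      by_cases h1 : S u <;> by_cases h2 : S v <;> simp [h1, h2]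
      linarith
    linarith
  refine (add_zero _).symm.trans ((congrArg _ hanti.symm).trans ?_)
  simp only [← Finset.sum_add_distrib]
  rw [Finset.sum_comm]
  refine Finset.sum_congr rfl fun v hv => ?_
  by_cases h : S v
  · simp [h]
  · simp only [h, if_false]
    rw [hs.exc_eq v (Finset.mem_range.1 hv) (by rintro rfl; exact h h0)]
    refine Finset.sum_congr rfl fun u _ => ?_
    by_cases hu : S u <;> simp [hu]

/-- When no node is active, the nodes above a gap in the heights form a minimum cut. -/
theorem Inv.isMin_of_gap {V : ℕ} {cap : ℕ → ℕ → ℝ} {s : Flow} (hs : s.Inv V cap) (hV : 2 ≤ V)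
    (hrun : s.run = 0) {k : ℕ} (hkV : k < V) (hk : ∀ v, v < V → s.ht v ≠ k)
    {T : ℕ → Prop} (hT0 : T 0) (hT1 : ¬ T 1) :
    cutCap V cap (fun v => k < s.ht v) ≤ cutCap V cap T := by
  classical
  have hT := hs.net_flow hT0
  have hS := hs.net_flow (S := fun v => k < s.ht v) (by rw [hs.ht_source]; exact hkV)
  have h1 : cutCap V cap (fun v => k < s.ht v) = ∑ v ∈ Finset.range V, if k < s.ht v then 0 else s.exc v := by
    refine Eq.trans ?_ (hS.trans (by congr!))
    refine Finset.sum_congr rfl fun u hu => Finset.sum_congr rfl fun v hv => ?_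
    rw [Finset.mem_range] at hu hv
    simp only
    split_ifs with h
    · have h2 := hs.res_nonneg u v hu hv
      -- across the gap a residual arc would descend by more than one, so all arcs of the cut are saturated
      have h3 := hs.valid u v hu hv
      have h4 := hk v hv
      rcases h2.eq_or_lt with h5 | h5
      · rw [← h5, sub_zero]
      · have := h3 h5; omega
    · rfl
  -- nodes below the gap are not active, so their excess vanishes, except at the sink
  have h2 : (∑ v ∈ Finset.range V, if k < s.ht v then 0 else s.exc v) = s.exc 1 := by
    rw [Finset.sum_eq_single 1]
    · simp [hs.ht_sink]
    · intro v hv hv1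
      rw [Finset.mem_range] at hv
      split_ifs with h
      · rfl
      · have hv0 : v ≠ 0 := by rintro rfl; rw [hs.ht_source] at h; exact h hkV
        have := hs.halted hrun v
        have h3 := hs.exc_nonneg v hv hv0
        by_contra hne
        exact this ⟨⟨by omega, hv⟩, lt_of_le_of_ne h3 (Ne.symm hne), by omega⟩
    · intro h; exact absurd (Finset.mem_range.2 (by omega)) h
  have h3 : s.exc 1 ≤ ∑ v ∈ Finset.range V, if T v then 0 else s.exc v := by
    have : ∀ v ∈ Finset.range V, 0 ≤ if T v then 0 else s.exc v := by
      intro v hv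
      split_ifs with h
      · exact le_rfl
      · exact hs.exc_nonneg v (Finset.mem_range.1 hv) (by rintro rfl; exact h hT0)
    have := Finset.single_le_sum this (Finset.mem_range.2 (by omega : 1 < V))
    simpa [hT1] using this
  rw [h1, h2]
  refine h3.trans ?_
  rw [← hT]
  refine Finset.sum_le_sum fun u hu => Finset.sum_le_sum fun v hv => ?_
  have := hs.res_nonneg u v (Finset.mem_range.1 hu) (Finset.mem_range.1 hv)
  split_ifs <;> linarith

/-- Pigeonhole: the `V - 2` inner nodes cannot occupy all the heights `1, …, V - 1`. -/
theorem Inv.exists_gap {V : ℕ} {cap : ℕ → ℕ → ℝ} {s : Flow} (hs : s.Inv V cap) (hV : 2 ≤ V) :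
    ∃ k, 1 ≤ k ∧ k < V ∧ ∀ v, v < V → s.ht v ≠ k := by
  by_contra! hc
  have hsub : Finset.Ico 1 V ⊆ (Finset.Ico 2 V).image s.ht := by
    intro k hk
    rw [Finset.mem_Ico] at hk
    obtain ⟨v, hv, hvk⟩ := hc k hk.1 hk.2
    refine Finset.mem_image.2 ⟨v, Finset.mem_Ico.2 ⟨?_, hv⟩, hvk⟩
    rcases v with _ | _ | v
    · rw [hs.ht_source] at hvk; omega
    · rw [zero_add, hs.ht_sink] at hvk; omega
    · omega
  have := (Finset.card_le_card hsub).trans Finset.card_image_le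
  simp only [Nat.card_Ico] at this
  omega

end Flow
end Bethe
end

noncomputable section
namespace Bethe

/-! ### Reasoning about programs -/

/-- The cost of running every part of the program once. -/
def Prog.size : Prog → ℕ
  | .skip => 1
  | .setNat a e => a.cost + e.cost + 1
  | .setReal a e => a.cost + e.cost + 1
  | .seq P Q => P.size + Q.size
  | .branch c P Q => c.cost + P.size + Q.size + 1
  | .loop c P => c.cost + P.size + 1

/-- `Runs P k m Q`: from memory `m` the program halts with a memory that satisfies `Q`, after at most
`k` passes through its loops altogether. Only passes are counted, since the number of steps is at
most `size P` times one plus the number of passes. -/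
def Runs (P : Prog) (k : ℕ) (m : Mem) (Q : Mem → Prop) : Prop :=
  ∃ t m', Exec P m t m' ∧ t ≤ P.size * (k + 1) ∧ Q m'

namespace Runs

variable {P P' : Prog} {k k' : ℕ} {m : Mem} {Q R : Mem → Prop}

theorem mono (h : Runs P k m Q) (hk : k ≤ k') (hQ : ∀ m, Q m → R m) : Runs P k' m R := by
  obtain ⟨t, m', h1, h2, h3⟩ := h
  exact ⟨t, m', h1, h2.trans (Nat.mul_le_mul_left _ (by omega)), hQ _ h3⟩

theorem skip (h : Q m) : Runs .skip k m Q := ⟨1, m, .skip m, by simp [Prog.size], h⟩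

theorem setNat {a e : NExp} (h : Q { m with nat := Function.update m.nat (a.eval m) (e.eval m) }) :
    Runs (.setNat a e) k m Q :=
  ⟨_, _, .setNat a e m, Nat.le_mul_of_pos_right _ (Nat.succ_pos k), h⟩

theorem setReal {a : NExp} {e : RExp}
    (h : Q { m with real := Function.update m.real (a.eval m) (e.eval m) }) :
    Runs (.setReal a e) k m Q :=
  ⟨_, _, .setReal a e m, Nat.le_mul_of_pos_right _ (Nat.succ_pos k), h⟩

/-- Numbers of passes add up; the sizes of the parts bound the cost of each of them. -/
theorem seq (k₁ k₂ : ℕ) (h : Runs P k₁ m fun m' => Runs P' k₂ m' Q) (hk : k₁ + k₂ ≤ k) :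
    Runs (.seq P P') k m Q := by
  obtain ⟨t, m', h1, h2, t', m'', h3, h4, h5⟩ := h
  refine ⟨_, _, .seq h1 h3, ?_, h5⟩
  have e1 := Nat.mul_le_mul_left P.size (show k₁ + 1 ≤ k + 1 by omega)
  have e2 := Nat.mul_le_mul_left P'.size (show k₂ + 1 ≤ k + 1 by omega)
  simp only [Prog.size, add_mul]; omega

/-- Sequencing after a program without loops. -/
theorem seq0 (h : Runs P 0 m fun m' => Runs P' k m' Q) : Runs (.seq P P') k m Q :=
  seq 0 k h (by omega)

theorem branch {c : BExp} (h1 : c.Holds m → Runs P k m Q) (h2 : ¬ c.Holds m → Runs P' k m Q) :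
    Runs (.branch c P P') k m Q := by
  have e : c.cost + 1 ≤ (c.cost + 1) * (k + 1) := Nat.le_mul_of_pos_right _ (Nat.succ_pos k)
  by_cases hc : c.Holds m
  · obtain ⟨t, m', h3, h4, h5⟩ := h1 hc
    refine ⟨_, _, .branchTrue hc h3, ?_, h5⟩
    simp only [Prog.size, add_mul] at *; omega
  · obtain ⟨t, m', h3, h4, h5⟩ := h2 hc
    refine ⟨_, _, .branchFalse hc h3, ?_, h5⟩
    simp only [Prog.size, add_mul] at *; omega

/-- Loops: `I φ m` is an invariant that depends on the number `φ` of passes left. -/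
theorem loop {c : BExp} {I : ℕ → Mem → Prop} {φ : ℕ} (h0 : I φ m)
    (hstep : ∀ φ m, I φ m → c.Holds m →
      ∃ k, Runs P k m fun m' => ∃ φ', φ' + k + 1 ≤ φ ∧ I φ' m')
    (hpost : ∀ φ m, I φ m → ¬ c.Holds m → Q m) : Runs (.loop c P) φ m Q := by
  induction φ using Nat.strong_induction_on generalizing m with
  | _ φ ih =>
    by_cases hc : c.Holds m
    · obtain ⟨k, t, m', h1, h2, φ', h3, h4⟩ := hstep φ m h0 hc
      obtain ⟨t', m'', h5, h6, h7⟩ := ih φ' (by omega) h4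
      refine ⟨_, _, .loopStep hc h1 h5, ?_, h7⟩
      simp only [Prog.size] at *
      have e1 : (c.cost + P.size + 1) * (k + 1 + (φ' + 1))
          ≤ (c.cost + P.size + 1) * (φ + 1) := Nat.mul_le_mul_left _ (by omega)
      have e2 : (c.cost + P.size + 1) * (k + 1 + (φ' + 1)) = c.cost * (k + 1) + P.size * (k + 1)
        + (k + 1) + (c.cost + P.size + 1) * (φ' + 1) := by ring
      have e3 : c.cost ≤ c.cost * (k + 1) := Nat.le_mul_of_pos_right _ (Nat.succ_pos k)
      omega
    · refine ⟨_, _, .loopExit hc, ?_, hpost φ m h0 hc⟩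
      simp only [Prog.size]
      have := Nat.le_mul_of_pos_right (c.cost + P.size + 1) (Nat.succ_pos φ)
      simp only [Nat.succ_eq_add_one] at this
      omega

end Runs

/-! ### Arrays

The input and the output use the cells from `0` on. All other data are kept in sixteen interleaved
arrays for each memory, with the following contents.

Natural numbers: array `0` holds scalars, namely `n` in cell `0`, loop counters in the cells `1`, `2`, `5`
and `6`, the number `V` of nodes in cell `3`, a mesh size in cell `4`, the state of push-relabel in the cells
`7`, `8`, `9`, and the gap height in cell `10`. The arrays `1` to `5` hold the mesh sizes, the variables and
the labels of the nodes, their heights and their current arcs.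

Real numbers: array `0` holds scalars, namely two accumulators in the cells `0` and `1`, `Ω` in cell `2`,
`γ` in cell `3`, the sum of the degrees in cell `4`, the shift of the unary costs in cell `5`, and the total
of the soft capacities in cell `6`. Array `1` holds the input, `2` and `3` the bounds `A` and `B`, `4` and `5`
the new bounds during a round, `6` the sums `Wᵢ`, `7` the degrees, `8` the residual capacities, `9` the
excesses, `10` the unary costs, `11` the indicator of the edges, and `15` the output. -/

namespace Mem

/-- The memory for natural numbers is used as sixteen interleaved arrays. -/
def N (m : Mem) (k : Fin 16) (i : ℕ) : ℕ := m.nat (16 * i + k)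

/-- The memory for real numbers is used as sixteen interleaved arrays. -/
def R (m : Mem) (k : Fin 16) (i : ℕ) : ℝ := m.real (16 * i + k)

/-- Writing to an array of natural numbers. -/
def setN (m : Mem) (k : Fin 16) (i v : ℕ) : Mem :=
  { m with nat := Function.update m.nat (16 * i + k) v }

/-- Writing to an array of real numbers. -/
def setR (m : Mem) (k : Fin 16) (i : ℕ) (v : ℝ) : Mem :=
  { m with real := Function.update m.real (16 * i + k) v }

theorem cell_inj {k k' : Fin 16} {i i' : ℕ} : 16 * i + k = 16 * i' + k' ↔ k = k' ∧ i = i' := by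
  have := k.2; have := k'.2
  rw [Fin.ext_iff]; omega

@[simp] theorem N_setN_self (m : Mem) (k : Fin 16) (i v : ℕ) :
    (m.setN k i v).N k = Function.update (m.N k) i v := by
  funext j
  simp only [N, setN, Function.update_apply, cell_inj, true_and]

@[simp] theorem N_setN_of_ne (m : Mem) {k k' : Fin 16} (h : k' ≠ k) (i v : ℕ) :
    (m.setN k i v).N k' = m.N k' := by
  funext j
  simp only [N, setN, Function.update_apply, cell_inj, h, false_and, if_false]

@[simp] theorem R_setR_self (m : Mem) (k : Fin 16) (i : ℕ) (v : ℝ) :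
    (m.setR k i v).R k = Function.update (m.R k) i v := by
  funext j
  simp only [R, setR, Function.update_apply, cell_inj, true_and]

@[simp] theorem R_setR_of_ne (m : Mem) {k k' : Fin 16} (h : k' ≠ k) (i : ℕ) (v : ℝ) :
    (m.setR k i v).R k' = m.R k' := by
  funext j
  simp only [R, setR, Function.update_apply, cell_inj, h, false_and, if_false]

@[simp] theorem R_setN (m : Mem) (k : Fin 16) (i v : ℕ) : (m.setN k i v).R = m.R := rfl

@[simp] theorem N_setR (m : Mem) (k : Fin 16) (i : ℕ) (v : ℝ) : (m.setR k i v).N = m.N := rfl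

end Mem

instance : Add NExp := ⟨.add⟩
instance : Sub NExp := ⟨.sub⟩
instance : Mul NExp := ⟨.mul⟩
instance (c : ℕ) : OfNat NExp c := ⟨.lit c⟩
instance : Add RExp := ⟨.add⟩
instance : Sub RExp := ⟨.sub⟩
instance : Mul RExp := ⟨.mul⟩
instance : Div RExp := ⟨.div⟩
instance (c : ℕ) : OfNat RExp c := ⟨.ofNat (.lit c)⟩

/-- An entry of an array of natural numbers. -/
def nv (k : Fin 16) (i : NExp) : NExp := .cell (16 * i + .lit k)

/-- An entry of an array of real numbers. -/
def rv (k : Fin 16) (i : NExp) : RExp := .cell (16 * i + .lit k)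

/-- Assignment to an entry of an array of natural numbers. -/
def putN (k : Fin 16) (i v : NExp) : Prog := .setNat (16 * i + .lit k) v

/-- Assignment to an entry of an array of real numbers. -/
def putR (k : Fin 16) (i : NExp) (v : RExp) : Prog := .setReal (16 * i + .lit k) v

section Eval

variable (m : Mem)

@[simp] theorem eval_nadd (a b : NExp) : (a + b).eval m = a.eval m + b.eval m := rfl
@[simp] theorem eval_nsub (a b : NExp) : (a - b).eval m = a.eval m - b.eval m := rfl
@[simp] theorem eval_nmul (a b : NExp) : (a * b).eval m = a.eval m * b.eval m := rfl
@[simp] theorem eval_nzero : NExp.eval m 0 = 0 := rfl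
@[simp] theorem eval_none : NExp.eval m 1 = 1 := rfl
@[simp] theorem eval_nlit (c : ℕ) [c.AtLeastTwo] : NExp.eval m ofNat(c) = OfNat.ofNat c := rfl
@[simp] theorem eval_nlit' (c : ℕ) : (NExp.lit c).eval m = c := rfl
@[simp] theorem eval_nv (k : Fin 16) (i : NExp) : (nv k i).eval m = m.N k (i.eval m) := rfl
@[simp] theorem eval_rv (k : Fin 16) (i : NExp) : (rv k i).eval m = m.R k (i.eval m) := rfl
@[simp] theorem eval_radd (a b : RExp) : (a + b).eval m = a.eval m + b.eval m := rfl
@[simp] theorem eval_rsub (a b : RExp) : (a - b).eval m = a.eval m - b.eval m := rfl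
@[simp] theorem eval_rmul (a b : RExp) : (a * b).eval m = a.eval m * b.eval m := rfl
@[simp] theorem eval_rdiv (a b : RExp) : (a / b).eval m = a.eval m / b.eval m := rfl
@[simp] theorem eval_rzero : RExp.eval m 0 = 0 := Nat.cast_zero
@[simp] theorem eval_rone : RExp.eval m 1 = 1 := Nat.cast_one
@[simp] theorem eval_rlit (c : ℕ) [c.AtLeastTwo] : RExp.eval m ofNat(c) = (OfNat.ofNat c : ℝ) := rfl
@[simp] theorem eval_ofNat (a : NExp) : (RExp.ofNat a).eval m = (a.eval m : ℝ) := rfl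
@[simp] theorem eval_exp (a : RExp) : (RExp.exp a).eval m = Real.exp (a.eval m) := rfl
@[simp] theorem eval_log (a : RExp) : (RExp.log a).eval m = Real.log (a.eval m) := rfl
@[simp] theorem eval_sqrt (a : RExp) : (RExp.sqrt a).eval m = √(a.eval m) := rfl
@[simp] theorem holds_natLt (a b : NExp) : (BExp.natLt a b).Holds m ↔ a.eval m < b.eval m := Iff.rfl
@[simp] theorem holds_natEq (a b : NExp) : (BExp.natEq a b).Holds m ↔ a.eval m = b.eval m := Iff.rfl
@[simp] theorem holds_realLt (a b : RExp) : (BExp.realLt a b).Holds m ↔ a.eval m < b.eval m := Iff.rfl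
@[simp] theorem holds_neg (c : BExp) : (BExp.neg c).Holds m ↔ ¬ c.Holds m := Iff.rfl
@[simp] theorem holds_conj (c d : BExp) : (BExp.conj c d).Holds m ↔ c.Holds m ∧ d.Holds m := Iff.rfl

end Eval

theorem Runs.putN {j : Fin 16} {i v : NExp} {k : ℕ} {m : Mem} {Q : Mem → Prop}
    (h : Q (m.setN j (i.eval m) (v.eval m))) : Runs (putN j i v) k m Q := Runs.setNat h

theorem Runs.putR {j : Fin 16} {i : NExp} {v : RExp} {k : ℕ} {m : Mem} {Q : Mem → Prop}
    (h : Q (m.setR j (i.eval m) (v.eval m))) : Runs (putR j i v) k m Q := Runs.setReal h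

/-- `for v = 0, …, hi - 1 do P`, where the counter `v` is an entry of the array `0`. -/
def forUp (v : ℕ) (hi : NExp) (P : Prog) : Prog :=
  .seq (putN 0 (.lit v) 0) (.loop (.natLt (nv 0 (.lit v)) hi)
    (.seq P (putN 0 (.lit v) (nv 0 (.lit v) + 1))))

/-- The rule for counting loops: `I i` holds before the pass for `i`, which may use `T i` passes of inner
loops and must preserve the counter. -/
theorem Runs.forUp {v : ℕ} {hi : NExp} {P : Prog} {m : Mem} {Q : Mem → Prop} (I : ℕ → Mem → Prop)
    (B : ℕ) (T : ℕ → ℕ) {k : ℕ} (hk : ∑ i ∈ Finset.range B, (T i + 1) ≤ k)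
    (h0 : I 0 (m.setN 0 v 0)) (hB : ∀ i m, I i m → hi.eval m = B)
    (hstep : ∀ i m, i < B → m.N 0 v = i → I i m →
      Runs P (T i) m fun m' => m'.N 0 v = i ∧ I (i + 1) (m'.setN 0 v (i + 1)))
    (hpost : ∀ m, m.N 0 v = B → I B m → Q m) : Runs (forUp v hi P) k m Q := by
  refine Runs.seq0 (Runs.putN ?_)
  refine Runs.mono (k := ∑ i ∈ Finset.range B, (T i + 1)) (Q := Q) ?_ hk fun _ h => h
  refine Runs.loop (I := fun φ m => ∃ i, i ≤ B ∧ φ = ∑ j ∈ Finset.Ico i B, (T j + 1) ∧ m.N 0 v = i ∧ I i m)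
    ⟨0, Nat.zero_le _, by rw [Finset.range_eq_Ico], by simp, h0⟩ ?_ ?_
  · rintro φ m ⟨i, hi', rfl, hv, hI⟩ hc
    rw [holds_natLt, hB i m hI, eval_nv, eval_nlit', hv] at hc
    refine ⟨T i, Runs.seq (T i) 0 ?_ le_rfl⟩
    refine (hstep i m hc hv hI).mono le_rfl ?_
    rintro m' ⟨h1, h2⟩
    refine Runs.putN ⟨∑ j ∈ Finset.Ico (i + 1) B, (T j + 1), ?_, i + 1, hc, rfl, ?_⟩
    · rw [Finset.sum_eq_sum_Ico_succ_bot hc]; omega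
    · simp [h1]; exact h2
  · rintro φ m ⟨i, hi', -, hv, hI⟩ hc
    rw [holds_natLt, hB i m hI, eval_nv, eval_nlit', hv] at hc
    obtain rfl : i = B := by omega
    exact hpost m hv hI

/-- `acc := ∑_{v < hi} e`. -/
def sumUp (v : ℕ) (hi : NExp) (acc : ℕ) (e : RExp) : Prog :=
  .seq (putR 0 (.lit acc) 0) (forUp v hi (putR 0 (.lit acc) (rv 0 (.lit acc) + e)))

/-- Sums change nothing but the accumulator and the counter, whose final values are known exactly. -/
theorem Runs.sumUp {v : ℕ} {hi : NExp} {acc : ℕ} {e : RExp} {m : Mem} {Q : Mem → Prop} (B : ℕ)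
    (f : ℕ → ℝ) {k : ℕ} (hk : B ≤ k)
    (hB : ∀ i x, hi.eval ((m.setR 0 acc x).setN 0 v i) = B)
    (he : ∀ i x, i < B → e.eval ((m.setR 0 acc x).setN 0 v i) = f i)
    (hpost : Q ((m.setR 0 acc (∑ i ∈ Finset.range B, f i)).setN 0 v B)) :
    Runs (sumUp v hi acc e) k m Q := by
  refine Runs.seq0 (Runs.putR ?_)
  have hRR : ∀ x y, (m.setR 0 acc x).setR 0 acc y = m.setR 0 acc y := fun x y => by
    simp [Mem.setR]
  have hNN : ∀ (m : Mem) x y, (m.setN 0 v x).setN 0 v y = m.setN 0 v y := fun m x y => by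
    simp [Mem.setN]
  refine Runs.forUp (fun i m' => m' = (m.setR 0 acc (∑ j ∈ Finset.range i, f j)).setN 0 v i) B
    (fun _ => 0) (by simpa using hk) (by simp) ?_ ?_ ?_
  · rintro i m' rfl; exact hB _ _
  · rintro i m' hi' - rfl
    refine Runs.putR ⟨by simp [Function.update_self], ?_⟩
    rw [eval_radd, he _ _ hi', Finset.sum_range_succ]
    simp only [eval_rv, eval_nlit', Mem.R_setN, Mem.R_setR_self, Function.update_self]
    change ((m.setR 0 acc _).setR 0 acc _ |>.setN 0 v i).setN 0 v (i + 1) = _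
    rw [hNN, hRR]
  · rintro m' - rfl; exact hpost

/-- The indicator of `a < b` for natural numbers. -/
def ltE (a b : NExp) : NExp := 1 - (1 - (b - a))

/-- The indicator of `a = b` for natural numbers. -/
def eqE (a b : NExp) : NExp := 1 - ((a - b) + (b - a))

/-- The absolute value. -/
def absE (a : RExp) : RExp := .sqrt (a * a)

@[simp] theorem eval_ltE (m : Mem) (a b : NExp) :
    (ltE a b).eval m = if a.eval m < b.eval m then 1 else 0 := by
  simp only [ltE, eval_nsub, eval_none]; split_ifs <;> omega

@[simp] theorem eval_eqE (m : Mem) (a b : NExp) :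
    (eqE a b).eval m = if a.eval m = b.eval m then 1 else 0 := by
  simp only [eqE, eval_nsub, eval_nadd, eval_none]; split_ifs <;> omega

@[simp] theorem eval_absE (m : Mem) (a : RExp) : (absE a).eval m = |a.eval m| := by
  simp [absE, Real.sqrt_mul_self_eq_abs]

end Bethe
end

noncomputable section
namespace Bethe

/-! ### The program: input and bounds -/

/-- A scalar variable for natural numbers. -/
def sn (c : ℕ) : NExp := nv 0 (.lit c)

/-- A scalar variable for real numbers. -/
def sr (c : ℕ) : RExp := rv 0 (.lit c)

@[simp] theorem eval_sn (m : Mem) (c : ℕ) : (sn c).eval m = m.N 0 c := rfl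
@[simp] theorem eval_sr (m : Mem) (c : ℕ) : (sr c).eval m = m.R 0 c := rfl

/-- The input is moved to the array `1`, from the last cell to the first: cell `x` goes to cell
`16 x + 1 > x`, so that no cell is overwritten before it is read. -/
def copyIn : Prog :=
  .seq (putN 0 1 (sn 0 * sn 0 + sn 0 + 1))
    (.loop (.natLt 0 (sn 1)) (.seq (putN 0 1 (sn 1 - 1)) (putR 1 (sn 1) (.cell (sn 1)))))

theorem runs_copyIn {m₀ : Mem} {k : ℕ} (hk : m₀.N 0 0 * m₀.N 0 0 + m₀.N 0 0 + 1 ≤ k) :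
    Runs copyIn k m₀ fun m => m.N 0 0 = m₀.N 0 0 ∧
      ∀ x, x ≤ m₀.N 0 0 * m₀.N 0 0 + m₀.N 0 0 → m.R 1 x = m₀.real x := by
  set L := m₀.N 0 0 * m₀.N 0 0 + m₀.N 0 0 with hL
  refine Runs.seq0 (Runs.putN ?_)
  refine Runs.mono (k := L + 1) ?_ hk fun _ h => h
  refine Runs.loop (I := fun c m => m.N 0 0 = m₀.N 0 0 ∧ m.N 0 1 = c ∧ c ≤ L + 1 ∧
    (∀ x, x < c → m.real x = m₀.real x) ∧ ∀ x, c ≤ x → x ≤ L → m.R 1 x = m₀.real x) ?_ ?_ ?_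
  · refine ⟨by simp, by simp [hL], le_rfl, fun x _ => rfl, fun x hx hx' => by omega⟩
  · rintro c m ⟨h0, h1, h2, h3, h4⟩ hc
    simp only [holds_natLt, eval_nzero, eval_sn, h1] at hc
    refine ⟨0, Runs.seq0 (Runs.putN (Runs.putR ⟨c - 1, by omega, by simpa using h0, by simp [h1], by omega,
      fun x hx => ?_, fun x hx hx' => ?_⟩))⟩
    · simp only [eval_none, eval_nsub, eval_sn, Mem.setR, Mem.N_setN_self, Function.update_self, h1]
      rw [Function.update_of_ne (by omega)]
      exact h3 x (by omega)
    · simp only [eval_none, eval_nsub, eval_sn, h1, Mem.N_setN_self, Function.update_self,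
        Mem.R_setR_self, Mem.R_setN, RExp.eval, Function.update_apply]
      split_ifs with h
      · subst h; exact h3 _ (by omega)
      · exact h4 x (by omega) hx'
  · rintro c m ⟨h0, h1, h2, h3, h4⟩ hc
    simp only [holds_natLt, eval_nzero, eval_sn, h1] at hc
    exact ⟨h0, fun x hx => h4 x (by omega) hx⟩

variable {n : ℕ} {M : MRF n} {ε : ℝ}

/-- The input data, at their place in the array `1`, and the indicator of the edges. -/
structure Base (M : MRF n) (ε : ℝ) (m : Mem) : Prop where
  size : m.N 0 0 = n
  eps : m.R 1 0 = ε
  theta : ∀ i : Fin n, m.R 1 (1 + i) = M.θ i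
  weight : ∀ i j : Fin n, m.R 1 (1 + n + (n * i + j)) = M.W i j
  supp : ∀ i j : Fin n, m.R 11 (n * i + j) = if M.W i j ≠ 0 then 1 else 0

/-- A memory that agrees on the cells in question keeps the property; the same holds for the similar
statements below. -/
theorem Base.congr {m m' : Mem} (h : Base M ε m) (h0 : m'.N 0 0 = m.N 0 0) (h1 : m'.R 1 = m.R 1)
    (h11 : m'.R 11 = m.R 11) : Base M ε m' :=
  ⟨h0.trans h.size, by rw [h1, h.eps], fun i => by rw [h1, h.theta], fun i j => by rw [h1, h.weight],
    fun i j => by rw [h11, h.supp]⟩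

theorem input_theta (i : Fin n) : (M.input ε).real (1 + i) = M.θ i := by
  simp only [MRF.input]
  rw [if_neg (by omega), Finset.sum_eq_single i, if_pos rfl, Finset.sum_eq_zero, add_zero]
  · intro a _
    refine Finset.sum_eq_zero fun b _ => if_neg ?_
    have := i.2; omega
  · intro b _ hb; exact if_neg fun h => hb (Fin.ext (by omega))
  · simp

/-- The cells of the input for different pairs are different, so that one term of the double sum is left. -/
theorem input_weight (i j : Fin n) : (M.input ε).real (1 + n + (n * i + j)) = M.W i j := by
  simp only [MRF.input]
  have hcell : ∀ a b : Fin n, n * (i : ℕ) + j = n * a + b → i = a ∧ j = b := by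
    intro a b h
    have h1 : (i : ℕ) = a := by
      have h2 := congrArg (· / n) h
      have hn : 0 < n := i.pos
      simpa [Nat.mul_add_div hn, Nat.div_eq_of_lt j.2, Nat.div_eq_of_lt b.2] using h2
    rw [h1] at h
    exact ⟨Fin.ext h1, Fin.ext (by omega)⟩
  rw [if_neg (by omega), Finset.sum_eq_zero, zero_add, Finset.sum_eq_single i,
    Finset.sum_eq_single j, if_pos rfl]
  · intro b _ hb; exact if_neg fun h => hb (hcell i b (by omega)).2.symm
  · simp
  · intro a _ ha
    exact Finset.sum_eq_zero fun b _ => if_neg fun h => ha (hcell a b (by omega)).1.symm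
  · simp
  · intro a _; refine if_neg ?_; have := a.2; omega

/-- The indicator of the edges, at the places of the weights. -/
def suppProg : Prog :=
  forUp 1 (sn 0 * sn 0) (.branch (.realEq (rv 1 (1 + sn 0 + sn 1)) 0)
    (putR 11 (sn 1) 0) (putR 11 (sn 1) 1))

theorem runs_suppProg {m : Mem} (h0 : m.N 0 0 = n)
    (h : ∀ x, x ≤ n * n + n → m.R 1 x = (M.input ε).real x) {k : ℕ} (hk : n * n ≤ k) :
    Runs suppProg k m (Base M ε) := by
  refine Runs.forUp (fun i m' => m'.N 0 0 = n ∧ m'.R 1 = m.R 1 ∧ ∀ x < i,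
    m'.R 11 x = if m.R 1 (1 + n + x) ≠ 0 then 1 else 0) (n * n) (fun _ => 0) (by simpa using hk)
    ⟨by simp [h0], by simp, by simp⟩ (fun i m' h => by simp [h.1]) ?_ ?_
  · rintro i m' hi hv ⟨h0, h1, h2⟩
    refine Runs.branch (fun hc => Runs.putR ?_) (fun hc => Runs.putR ?_) <;>
    · simp [BExp.Holds, h0, h1, hv] at hc
      refine ⟨by simp [hv], by simp [h0], by simp [h1], fun x hx => ?_⟩
      rcases Nat.lt_succ_iff_lt_or_eq.1 hx with hx | rfl
      · simpa [hv, hx.ne] using h2 x hx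
      · simp [hv, hc]
  · rintro m' - ⟨h0, h1, h2⟩
    have hcell : ∀ i j : Fin n, n * (i : ℕ) + j < n * n := fun i j => by
      have h3 := Nat.mul_le_mul_left n i.2
      rw [Nat.mul_succ] at h3
      have := j.2; omega
    have hw : ∀ i j : Fin n, m.R 1 (1 + n + (n * i + j)) = M.W i j := fun i j => by
      rw [h _ (by have := hcell i j; omega), input_weight]
    refine ⟨h0, ?_, fun i => ?_, fun i j => ?_, fun i j => ?_⟩
    · rw [h1, h 0 (Nat.zero_le _)]; simp [MRF.input]
    · rw [h1, h _ (by have := i.2; have := Nat.zero_le (n * n); omega), input_theta]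
    · rw [h1, hw]
    · rw [h2 _ (hcell i j), hw]

/-- The weight `Wᵢⱼ`. -/
def wE (i j : NExp) : RExp := rv 1 (1 + sn 0 + (sn 0 * i + j))

/-- The indicator of the edge between `i` and `j`. Sums over neighbours are computed as sums over all
variables with this factor; their terms are arranged so that no division by zero occurs for a non-edge. -/
def suppE (i j : NExp) : RExp := rv 11 (sn 0 * i + j)

/-- `αᵢⱼ`. -/
def alphaE (i j : NExp) : RExp := .exp (wE i j) - 1

/-- The logistic function. -/
def sigmoidE (a : RExp) : RExp := 1 / (1 + .exp (0 - a))

@[simp] theorem eval_sigmoidE (m : Mem) (a : RExp) : (sigmoidE a).eval m = Real.sigmoid (a.eval m) := by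
  simp [sigmoidE, Real.sigmoid_def]

theorem Base.eval_wE {m : Mem} (h : Base M ε m) {a b : NExp} (i j : Fin n) (ha : a.eval m = i)
    (hb : b.eval m = j) : (wE a b).eval m = M.W i j := by
  simp only [wE, eval_rv, eval_nadd, eval_none, eval_sn, eval_nmul, ha, hb, h.size]
  exact h.weight i j

theorem Base.eval_suppE {m : Mem} (h : Base M ε m) {a b : NExp} (i j : Fin n) (ha : a.eval m = i)
    (hb : b.eval m = j) : (suppE a b).eval m = if M.W i j ≠ 0 then 1 else 0 := by
  simp only [suppE, eval_rv, eval_nadd, eval_sn, eval_nmul, ha, hb, h.size]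
  exact h.supp i j

theorem Base.eval_alphaE {m : Mem} (h : Base M ε m) {a b : NExp} (i j : Fin n) (ha : a.eval m = i)
    (hb : b.eval m = j) : (alphaE a b).eval m = M.α i j := by
  simp [alphaE, h.eval_wE i j ha hb, MRF.α]

theorem Base.eval_theta {m : Mem} (h : Base M ε m) {a : NExp} (i : Fin n) (ha : a.eval m = i) :
    (rv 1 (1 + a)).eval m = M.θ i := by
  simp only [eval_rv, eval_nadd, eval_none, ha]; exact h.theta i

/-- Sums over `Fin n` of functions given on the natural numbers below `n`. -/
theorem sum_range_eq_sum_fin {f : ℕ → ℝ} {g : Fin n → ℝ} (h : ∀ i : Fin n, f i = g i) :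
    ∑ i ∈ Finset.range n, f i = ∑ i, g i := by
  rw [Finset.sum_range]; exact Finset.sum_congr rfl fun i _ => h i

/-- The extension by zero of a function on `Fin n` to the natural numbers. -/
def finExt (f : Fin n → ℝ) (j : ℕ) : ℝ := if h : j < n then f ⟨j, h⟩ else 0

theorem finExt_of_lt (f : Fin n → ℝ) {j : ℕ} (h : j < n) : finExt f j = f ⟨j, h⟩ := dif_pos h

theorem sum_finExt (f : Fin n → ℝ) : ∑ j ∈ Finset.range n, finExt f j = ∑ j, f j :=
  sum_range_eq_sum_fin fun j => finExt_of_lt f j.2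

theorem sum_nbrs_eq {f : Fin n → ℝ} (i : Fin n) :
    ∑ j ∈ M.nbrs i, f j = ∑ j, (if M.W i j ≠ 0 then 1 else 0) * f j := by
  rw [MRF.nbrs, Finset.sum_filter]
  exact Finset.sum_congr rfl fun j _ => by split_ifs <;> simp

/-- The sums `Wᵢ` and the degrees. -/
structure Degrees (M : MRF n) (m : Mem) : Prop where
  wsum : ∀ i : Fin n, m.R 6 i = M.Wsum i
  deg : ∀ i : Fin n, m.R 7 i = M.deg i

theorem Degrees.congr {m m' : Mem} (h : Degrees M m) (h6 : m'.R 6 = m.R 6) (h7 : m'.R 7 = m.R 7) :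
    Degrees M m' := ⟨fun i => by rw [h6, h.wsum], fun i => by rw [h7, h.deg]⟩

/-- The bounds after `k` rounds of Bethe bound propagation. -/
structure Bounds (M : MRF n) (k : ℕ) (m : Mem) : Prop where
  lower : ∀ i : Fin n, m.R 2 i = M.A k i
  upper : ∀ i : Fin n, m.R 3 i = M.B k i

theorem Bounds.congr {k : ℕ} {m m' : Mem} (h : Bounds M k m) (h2 : m'.R 2 = m.R 2) (h3 : m'.R 3 = m.R 3) :
    Bounds M k m' := ⟨fun i => by rw [h2, h.lower], fun i => by rw [h3, h.upper]⟩

/-- Degrees and initial bounds. -/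
def startProg : Prog :=
  forUp 1 (sn 0) (.seq (sumUp 2 (sn 0) 0 (wE (sn 1) (sn 2))) (.seq
    (sumUp 2 (sn 0) 1 (suppE (sn 1) (sn 2))) (.seq
    (putR 6 (sn 1) (sr 0)) (.seq (putR 7 (sn 1) (sr 1)) (.seq
    (putR 2 (sn 1) (sigmoidE (rv 1 (1 + sn 1))))
    (putR 3 (sn 1) (1 - sigmoidE (rv 1 (1 + sn 1) + sr 0))))))))

theorem runs_startProg {m : Mem} (hb : Base M ε m) {k : ℕ} (hk : n * (2 * n + 1) ≤ k) :
    Runs startProg k m fun m' => Base M ε m' ∧ Degrees M m' ∧ Bounds M 0 m' := by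
  refine Runs.forUp (fun i m => Base M ε m ∧ ∀ i' : Fin n, (i' : ℕ) < i →
    (m.R 6 i' = M.Wsum i' ∧ m.R 7 i' = M.deg i') ∧ m.R 2 i' = M.A 0 i' ∧ m.R 3 i' = M.B 0 i')
    n (fun _ => 2 * n) (by simpa using hk) ⟨hb.congr (by simp) (by simp) (by simp), fun i' h => by omega⟩
    (fun i m h => h.1.size) ?_ ?_
  · rintro i m hi hv ⟨hb, hI⟩
    have hsz := hb.size
    refine Runs.seq n n (Runs.sumUp n (fun j => m.R 1 (1 + n + (n * i + j))) le_rfl (fun a x => by simp [hsz])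
      (fun a x _ => by simp [wE, hsz, hv]) ?_) (by omega)
    refine Runs.seq n 0 (Runs.sumUp n (fun j => m.R 11 (n * i + j)) le_rfl
      (fun a x => by simp [hsz]) (fun a x _ => by simp [suppE, hsz, hv]) ?_) (by omega)
    refine Runs.seq0 (Runs.putR (Runs.seq0 (Runs.putR (Runs.seq0 (Runs.putR (Runs.putR ?_))))))
    refine ⟨by simp [hv], hb.congr (by simp) (by simp) (by simp), fun i' hi' => ?_⟩
    have e1 : ∑ j ∈ Finset.range n, m.R 1 (1 + n + (n * (⟨i, hi⟩ : Fin n) + j)) = M.Wsum ⟨i, hi⟩ := by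
      rw [sum_range_eq_sum_fin fun j => hb.weight _ j, MRF.Wsum, sum_nbrs_eq]
      exact Finset.sum_congr rfl fun j _ => by split_ifs with h <;> simp_all
    have e2 : ∑ j ∈ Finset.range n, m.R 11 (n * (⟨i, hi⟩ : Fin n) + j) = M.deg ⟨i, hi⟩ := by
      rw [sum_range_eq_sum_fin fun j => hb.supp _ j, MRF.deg, ← mul_one (Nat.cast _),
        ← nsmul_eq_mul, ← Finset.sum_const, sum_nbrs_eq]
      simp
    have e3 := hb.theta ⟨i, hi⟩
    simp only at e1 e2 e3
    simp [hv, Function.update_apply, e1, e2, e3]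
    by_cases h : (i' : ℕ) = i
    · have : i' = ⟨i, hi⟩ := Fin.ext h
      subst this
      simp [MRF.A_zero]
      rfl
    · simpa [h] using hI i' (by omega)
  · rintro m - ⟨hb, hI⟩
    exact ⟨hb, ⟨fun i => (hI i i.2).1.1, fun i => (hI i i.2).1.2⟩,
      ⟨fun i => (hI i i.2).2.1, fun i => (hI i i.2).2.2⟩⟩

/-- The logarithm of a factor of `L`, or of `U` when the roles of the two bounds are exchanged. -/
def bbpE (a b : Fin 16) (i j : NExp) : RExp :=
  .log (1 + alphaE i j * rv a j / (1 + alphaE i j * (1 - rv b i) * (1 - rv a j)))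

/-- A round of Bethe bound propagation. -/
def roundProg : Prog :=
  .seq (forUp 1 (sn 0) (.seq (sumUp 2 (sn 0) 0 (bbpE 2 3 (sn 1) (sn 2))) (.seq
    (sumUp 2 (sn 0) 1 (bbpE 3 2 (sn 1) (sn 2))) (.seq
    (putR 4 (sn 1) (1 / (1 + .exp (0 - rv 1 (1 + sn 1)) / .exp (sr 0))))
    (putR 5 (sn 1) (1 / (1 + .exp (rv 1 (1 + sn 1) + rv 6 (sn 1)) / .exp (sr 1))))))))
    (forUp 1 (sn 0) (.seq (putR 2 (sn 1) (rv 4 (sn 1))) (putR 3 (sn 1) (rv 5 (sn 1)))))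

/-- The products `L` and `U` are computed as exponentials of sums of logarithms; for `W i j = 0` the
summand is `log 1`. -/
theorem exp_sum_log_eq_bbpFactor (hM : M.Associative) {A B : Fin n → ℝ}
    (hA : ∀ i, A i ∈ Set.Ioo (0 : ℝ) 1) (hB : ∀ i, B i ∈ Set.Ioo (0 : ℝ) 1) (i : Fin n) :
    Real.exp (∑ j, Real.log (1 + M.α i j * A j / (1 + M.α i j * (1 - B i) * (1 - A j))))
      = M.bbpFactor A B i := by
  rw [Real.exp_sum, MRF.bbpFactor]
  have h : ∀ j, Real.exp (Real.log (1 + M.α i j * A j / (1 + M.α i j * (1 - B i) * (1 - A j))))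
      = if M.W i j ≠ 0 then 1 + M.α i j * A j / (1 + M.α i j * (1 - B i) * (1 - A j)) else 1 := by
    intro j
    rw [Real.exp_log (by have := MRF.bbp_term_nonneg (hM.α_nonneg i j) (hA j) (hB i); linarith)]
    split_ifs with h
    · rfl
    · rw [MRF.α, not_not.1 h]; simp
  simp only [h, MRF.nbrs, Finset.prod_filter]

theorem runs_roundProg (hM : M.Associative) {m : Mem} {k : ℕ} (hb : Base M ε m) (hd : Degrees M m)
    (hAB : Bounds M k m) {t : ℕ} (ht : n * (2 * n + 1) + n ≤ t) :
    Runs roundProg t m fun m' => Base M ε m' ∧ Degrees M m' ∧ Bounds M (k + 1) m' := by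
  obtain ⟨hA, hB⟩ := hM.bounds_mem k
  refine Runs.seq (n * (2 * n + 1)) n ?_ ht
  refine Runs.forUp (fun i m => Base M ε m ∧ Degrees M m ∧ Bounds M k m ∧ ∀ i' : Fin n, (i' : ℕ) < i →
    m.R 4 i' = M.A (k + 1) i' ∧ m.R 5 i' = M.B (k + 1) i')
    n (fun _ => 2 * n) (by simp) ⟨hb.congr (by simp) (by simp) (by simp), hd.congr (by simp) (by simp),
      hAB.congr (by simp) (by simp), fun i' h => by omega⟩
    (fun i m h => h.1.size) ?_ ?_
  · rintro i m hi hv ⟨hb, hd, hAB, hI⟩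
    have hsz := hb.size
    have hterm : ∀ (m' : Mem) (a b : Fin 16) (A B : Fin n → ℝ) (j : ℕ), Base M ε m' → m'.N 0 1 = i →
        m'.N 0 2 = j → (∀ i : Fin n, m'.R a i = A i) → (∀ i : Fin n, m'.R b i = B i) → j < n →
        (bbpE a b (sn 1) (sn 2)).eval m' = finExt (fun j => Real.log (1 + M.α ⟨i, hi⟩ j * A j /
          (1 + M.α ⟨i, hi⟩ j * (1 - B ⟨i, hi⟩) * (1 - A j)))) j := by
      intro m' a b A B j hb' h1 h2 hA' hB' hj
      have h3 := hA' ⟨j, hj⟩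
      have h4 := hB' ⟨i, hi⟩
      have h5 := hb'.eval_alphaE (a := sn 1) (b := sn 2) ⟨i, hi⟩ ⟨j, hj⟩ h1 h2
      simp only at h3 h4
      simp only [bbpE, eval_log, eval_radd, eval_rone, eval_rdiv, eval_rmul, eval_rsub, eval_rv, eval_sn,
        h1, h2, h3, h4, h5]
      rw [finExt_of_lt _ hj]
    refine Runs.seq n n (Runs.sumUp n _ le_rfl (fun a x => by simp [hsz])
      (fun j x hj => hterm _ 2 3 (M.A k) (M.B k) j (hb.congr (by simp) (by simp) (by simp)) (by simp [hv]) (by simp)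
        (by simpa using hAB.lower) (by simpa using hAB.upper) hj) ?_) (by omega)
    refine Runs.seq n 0 (Runs.sumUp n _ le_rfl (fun a x => by simp [hsz])
      (fun j x hj => hterm _ 3 2 (M.B k) (M.A k) j (hb.congr (by simp) (by simp) (by simp)) (by simp [hv]) (by simp)
        (by simpa using hAB.upper) (by simpa using hAB.lower) hj) ?_) (by omega)
    refine Runs.seq0 (Runs.putR (Runs.putR ?_))
    refine ⟨by simp [hv], hb.congr (by simp) (by simp) (by simp), hd.congr (by simp) (by simp),
      hAB.congr (by simp) (by simp), fun i' hi' => ?_⟩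
    simp only [sum_finExt]
    have e3 := hb.theta ⟨i, hi⟩
    have e4 := hd.wsum ⟨i, hi⟩
    simp only at e3 e4
    simp [hv, Function.update_apply, exp_sum_log_eq_bbpFactor hM hA hB, exp_sum_log_eq_bbpFactor hM hB hA,
      e3, e4]
    by_cases h : (i' : ℕ) = i
    · have : i' = ⟨i, hi⟩ := Fin.ext h
      subst this
      simp [MRF.A_succ, MRF.B_succ]
    · simpa [h] using hI i' (by omega)
  · rintro m - ⟨hb, hd, hAB, hI⟩
    refine Runs.forUp (fun i m => Base M ε m ∧ Degrees M m ∧ (∀ i' : Fin n,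
      m.R 4 i' = M.A (k + 1) i' ∧ m.R 5 i' = M.B (k + 1) i') ∧ ∀ i' : Fin n, (i' : ℕ) < i →
      m.R 2 i' = M.A (k + 1) i' ∧ m.R 3 i' = M.B (k + 1) i') n (fun _ => 0) (by simp)
      ⟨hb.congr (by simp) (by simp) (by simp), hd.congr (by simp) (by simp), by simpa using fun i => hI i i.2,
        fun i' h => by omega⟩ (fun i m h => h.1.size) ?_ ?_
    · rintro i m hi hv ⟨hb, hd, h45, hI⟩
      refine Runs.seq0 (Runs.putR (Runs.putR ⟨by simp [hv], hb.congr (by simp) (by simp) (by simp),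
        hd.congr (by simp) (by simp), by simpa using h45, fun i' hi' => ?_⟩))
      simp [hv, Function.update_apply]
      by_cases h : (i' : ℕ) = i
      · rw [if_pos h, if_pos h, ← h]; exact h45 i'
      · simpa [h] using hI i' (by omega)
    · rintro m - ⟨hb, hd, -, hI⟩
      exact ⟨hb, hd, ⟨fun i => (hI i i.2).1, fun i => (hI i i.2).2⟩⟩

/-- `k` rounds of Bethe bound propagation. -/
def roundsProg : ℕ → Prog
  | 0 => .skip
  | k + 1 => .seq (roundsProg k) roundProg

theorem runs_roundsProg (hM : M.Associative) {m : Mem} (hb : Base M ε m) (hd : Degrees M m)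
    (hAB : Bounds M 0 m) (k : ℕ) : Runs (roundsProg k) (k * (n * (2 * n + 1) + n)) m fun m' =>
      Base M ε m' ∧ Degrees M m' ∧ Bounds M k m' := by
  induction k with
  | zero => exact Runs.skip ⟨hb, hd, hAB⟩
  | succ k ih =>
    refine Runs.seq _ (n * (2 * n + 1) + n) (ih.mono le_rfl fun m' h => ?_) (Nat.succ_mul _ _).ge
    exact runs_roundProg hM h.1 h.2.1 h.2.2 le_rfl

end Bethe
end

noncomputable section
namespace Bethe

/-! ### The program: mesh width and layout of the nodes -/

variable {n : ℕ} {M : MRF n} {ε : ℝ} {k : ℕ}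

/-- The maximum of two real numbers. -/
def maxE (a b : RExp) : RExp := (a + b + absE (a - b)) / 2

/-- The minimum of two real numbers. -/
def minE (a b : RExp) : RExp := (a + b - absE (a - b)) / 2

@[simp] theorem eval_maxE (m : Mem) (a b : RExp) : (maxE a b).eval m = max (a.eval m) (b.eval m) := by
  simp only [maxE, eval_rdiv, eval_radd, eval_absE, eval_rsub, eval_rlit]
  rcases le_total (a.eval m) (b.eval m) with h | h
  · rw [max_eq_right h, abs_of_nonpos (by linarith)]; ring
  · rw [max_eq_left h, abs_of_nonneg (by linarith)]; ring

@[simp] theorem eval_minE (m : Mem) (a b : RExp) : (minE a b).eval m = min (a.eval m) (b.eval m) := by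
  simp only [minE, eval_rdiv, eval_radd, eval_absE, eval_rsub, eval_rlit]
  rcases le_total (a.eval m) (b.eval m) with h | h
  · rw [min_eq_left h, abs_of_nonpos (by linarith)]; ring
  · rw [min_eq_right h, abs_of_nonneg (by linarith)]; ring

/-- `ηᵢ`. -/
def etaE (i : NExp) : RExp := minE (rv 2 i) (rv 3 i)

theorem Bounds.eval_etaE {m : Mem} (h : Bounds M k m) {a : NExp} (i : Fin n) (ha : a.eval m = i) :
    (etaE a).eval m = M.η k i := by
  simp only [etaE, eval_minE, eval_rv, ha, h.lower, h.upper, MRF.η]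

/-- The bound for an off-diagonal entry of the Hessian; it is `0` for a non-edge. -/
def offE (i j : NExp) : RExp :=
  alphaE i j * (alphaE i j + 1) /
    (4 * (2 * alphaE i j + 1) * etaE i * etaE j * (1 - etaE i) * (1 - etaE j))

/-- The summands of the bound for a diagonal entry of the Hessian. -/
def diagTermE (i j : NExp) : RExp :=
  suppE i j * ((alphaE i j + 1) * (alphaE i j + 1) / (2 * alphaE i j + 1))

/-- The bound for a diagonal entry of the Hessian, from the sum in the accumulator `0`. -/
def diagE (i : NExp) : RExp := 1 / (etaE i * (1 - etaE i)) * (1 - rv 7 i + sr 0)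

/-- The computation of `Ω`. -/
def omegaProg : Prog :=
  .seq (putR 0 2 0) (forUp 1 (sn 0) (.seq (sumUp 2 (sn 0) 0 (diagTermE (sn 1) (sn 2))) (.seq
    (putR 0 2 (maxE (sr 2) (diagE (sn 1))))
    (forUp 2 (sn 0) (putR 0 2 (maxE (sr 2) (offE (sn 1) (sn 2))))))))

theorem runs_omegaProg (hM : M.Associative) (hn : 0 < n) {m : Mem} (hb : Base M ε m) (hd : Degrees M m)
    (hAB : Bounds M k m) {t : ℕ} (ht : n * (2 * n + 1) ≤ t) :
    Runs omegaProg t m fun m' => Base M ε m' ∧ Degrees M m' ∧ Bounds M k m' ∧ m'.R 0 2 = M.Ω k := by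
  have hoff : ∀ i j, M.offBound k i j ≤ M.Ω k := fun i j => by
    by_cases h : M.W i j = 0
    · simp only [MRF.offBound, MRF.α, h, Real.exp_zero, sub_self, zero_mul, zero_div]
      have := hM.Ω_ge k ⟨0, hn⟩; linarith
    · exact MRF.offBound_le_Ω h
  -- the running maximum stays below `Ω` and bounds all entries seen so far; it starts from `0 ≤ Ω`
  refine Runs.seq0 (Runs.putR (Runs.forUp (fun i m => (Base M ε m ∧ Degrees M m ∧ Bounds M k m) ∧
    m.R 0 2 ≤ M.Ω k ∧ 0 ≤ m.R 0 2 ∧ ∀ i' : Fin n, (i' : ℕ) < i → M.diagBound k i' ≤ m.R 0 2 ∧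
      ∀ j, M.offBound k i' j ≤ m.R 0 2)
    n (fun _ => 2 * n) (by simpa using ht) ⟨⟨hb.congr (by simp) (by simp) (by simp), hd.congr (by simp) (by simp),
      hAB.congr (by simp) (by simp)⟩, by
        simpa using le_trans (by norm_num) (hM.Ω_ge k ⟨0, hn⟩), by simp, fun i' h => by omega⟩
    (fun i m h => h.1.1.size) ?_ ?_))
  · rintro i m hi hv ⟨⟨hb, hd, hAB⟩, hle, h0, hI⟩
    have hsz := hb.size
    refine Runs.seq n n (Runs.sumUp n (finExt fun j => (if M.W ⟨i, hi⟩ j ≠ 0 then 1 else 0) *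
        ((M.α ⟨i, hi⟩ j + 1) ^ 2 / (2 * M.α ⟨i, hi⟩ j + 1))) le_rfl (fun a x => by simp [hsz])
      (fun j x hj => ?_) ?_) (by omega)
    · have hb' : Base M ε ((m.setR 0 0 x).setN 0 2 j) := hb.congr (by simp) (by simp) (by simp)
      have h5 := hb'.eval_alphaE (a := sn 1) (b := sn 2) ⟨i, hi⟩ ⟨j, hj⟩ (by simp [hv]) (by simp)
      have h6 := hb'.eval_suppE (a := sn 1) (b := sn 2) ⟨i, hi⟩ ⟨j, hj⟩ (by simp [hv]) (by simp)
      rw [finExt_of_lt _ hj]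
      simp only [diagTermE, eval_rmul, eval_rdiv, eval_radd, eval_rone, eval_rlit, h5, h6, sq]
    · rw [sum_finExt, ← sum_nbrs_eq (M := M)]
      set S := ∑ j ∈ M.nbrs ⟨i, hi⟩, (M.α ⟨i, hi⟩ j + 1) ^ 2 / (2 * M.α ⟨i, hi⟩ j + 1) with hS
      have hAB' : Bounds M k ((m.setR 0 0 S).setN 0 2 n) := hAB.congr (by simp) (by simp)
      have h7 := hAB'.eval_etaE (a := sn 1) ⟨i, hi⟩ (by simp [hv])
      have h8 := hd.deg ⟨i, hi⟩
      simp only at h8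
      have hdiag : (diagE (sn 1)).eval ((m.setR 0 0 S).setN 0 2 n) = M.diagBound k ⟨i, hi⟩ := by
        simp only [diagE, eval_rmul, eval_rdiv, eval_rone, eval_rsub, eval_radd, h7, MRF.diagBound]
        simp [hv, h8]
        exact Or.inl hS
      refine Runs.seq0 (Runs.putR ?_)
      rw [eval_maxE, hdiag]
      refine Runs.forUp (fun j m => (Base M ε m ∧ Degrees M m ∧ Bounds M k m) ∧ m.N 0 1 = i ∧
        m.R 0 2 ≤ M.Ω k ∧ 0 ≤ m.R 0 2 ∧ (∀ i' : Fin n, (i' : ℕ) < i → M.diagBound k i' ≤ m.R 0 2 ∧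
        ∀ j, M.offBound k i' j ≤ m.R 0 2) ∧ M.diagBound k ⟨i, hi⟩ ≤ m.R 0 2 ∧
          ∀ j' : Fin n, (j' : ℕ) < j → M.offBound k ⟨i, hi⟩ j' ≤ m.R 0 2) n (fun _ => 0) (by simp) ?_
        (fun _ m h => h.1.1.size) ?_ ?_
      · refine ⟨⟨hb.congr (by simp) (by simp) (by simp), hd.congr (by simp) (by simp), hAB.congr (by simp) (by simp)⟩,
          by simp [hv], ?_⟩
        simp only [Mem.R_setN, Mem.R_setR_self, Function.update_apply, eval_nlit, if_true, eval_sr]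
        norm_num
        exact ⟨⟨hle, MRF.diagBound_le_Ω k _⟩, Or.inl h0, fun i' h => ⟨Or.inl (hI i' h).1,
          fun j => Or.inl ((hI i' h).2 j)⟩⟩
      · rintro j m hj hvj ⟨⟨hb, hd, hAB⟩, hv, hle, h0, hI, hD, hJ⟩
        have h5 := hb.eval_alphaE (a := sn 1) (b := sn 2) ⟨i, hi⟩ ⟨j, hj⟩ hv hvj
        have h6 := hAB.eval_etaE (a := sn 1) ⟨i, hi⟩ hv
        have h7 := hAB.eval_etaE (a := sn 2) ⟨j, hj⟩ hvj
        have hoffe : (offE (sn 1) (sn 2)).eval m = M.offBound k ⟨i, hi⟩ ⟨j, hj⟩ := by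
          simp only [offE, eval_rmul, eval_rdiv, eval_rone, eval_rsub, eval_radd, h7, h5, h6, eval_rlit,
            MRF.offBound]
        refine Runs.putR ?_
        rw [eval_maxE, hoffe]
        refine ⟨by simp [hvj], ⟨hb.congr (by simp) (by simp) (by simp), hd.congr (by simp) (by simp),
          hAB.congr (by simp) (by simp)⟩, by simp [hv], ?_⟩
        simp only [Mem.R_setN, Mem.R_setR_self, Function.update_apply, eval_nlit, if_true, eval_sr]
        refine ⟨max_le hle (hoff _ _), le_max_of_le_left h0, fun i' h => ⟨le_max_of_le_left (hI i' h).1,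
          fun j => le_max_of_le_left ((hI i' h).2 j)⟩, le_max_of_le_left hD, fun j' hj' => ?_⟩
        rcases Nat.lt_succ_iff_lt_or_eq.1 hj' with h | h
        · exact le_max_of_le_left (hJ j' h)
        · obtain rfl : j' = ⟨j, hj⟩ := Fin.ext h
          exact le_max_right _ _
      · rintro m - ⟨hb, hv, hle, h0, hI, hD, hJ⟩
        refine ⟨hv, ⟨hb.1.congr (by simp) (by simp) (by simp), hb.2.1.congr (by simp) (by simp),
          hb.2.2.congr (by simp) (by simp)⟩, by simpa using hle, by simpa using h0, fun i' hi' => ?_⟩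
        rcases Nat.lt_succ_iff_lt_or_eq.1 hi' with h | h
        · simpa using hI i' h
        · obtain rfl : i' = ⟨i, hi⟩ := Fin.ext h
          exact ⟨by simpa using hD, fun j => by simpa using hJ j j.2⟩
  · rintro m - ⟨⟨hb, hd, hAB⟩, hle, h0, hI⟩
    refine ⟨hb, hd, hAB, le_antisymm hle (max_le ?_ ?_)⟩
    · exact Real.iSup_le (fun p => (hI p.1.1 p.1.1.2).2 p.1.2) h0
    · exact Real.iSup_le (fun i => (hI i i.2).1) h0

/-- The computation of the mesh width `γ`. -/
def widthProg : Prog :=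
  .seq (sumUp 1 (sn 0) 4 (rv 7 (sn 1))) (putR 0 3 (.sqrt (2 * rv 1 0 /
    (.ofNat (sn 0) * .ofNat (sn 0) * sr 2 *
      .sqrt ((.ofNat (sn 0) + sr 4) / (.ofNat (sn 0) * .ofNat (sn 0)))))))

theorem runs_widthProg {m : Mem} (hb : Base M ε m) (hd : Degrees M m)
    (hAB : Bounds M k m) (hΩ : m.R 0 2 = M.Ω k) :
    Runs widthProg n m fun m' => Base M ε m' ∧ Degrees M m' ∧ Bounds M k m' ∧
      m'.R 0 3 = M.meshWidth k ε := by
  refine Runs.seq n 0 (Runs.sumUp n (m.R 7) le_rfl (fun a x => by simp [hb.size]) (fun a x _ => by simp)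
    (Runs.putR ⟨hb.congr (by simp) (by simp) (by simp), hd.congr (by simp) (by simp), hAB.congr (by simp) (by simp),
      ?_⟩)) le_rfl
  have h1 := hb.size
  have h2 := hb.eps
  rw [sum_range_eq_sum_fin (f := m.R 7) (g := fun i => (M.deg i : ℝ)) hd.deg, ← MRF.card_edges_eq]
  simp [h1, h2, hΩ, MRF.meshWidth, MRF.density, sq]

/-- The number of the node for label `p.2` of variable `p.1`; the source is `0` and the sink `1`. -/
def nodeNum {N : Fin n → ℕ} (p : Σ i : Fin n, Fin (N i)) : ℕ := 2 + (finSigmaFinEquiv p : ℕ)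

/-- The extension by zero of a function on `Fin n` to the natural numbers. -/
def natExt (N : Fin n → ℕ) (j : ℕ) : ℕ := if h : j < n then N ⟨j, h⟩ else 0

theorem natExt_of_lt (N : Fin n → ℕ) {j : ℕ} (h : j < n) : natExt N j = N ⟨j, h⟩ := dif_pos h

theorem sum_natExt (N : Fin n → ℕ) : ∑ j ∈ Finset.range n, natExt N j = ∑ j, N j := by
  rw [Finset.sum_range]; exact Finset.sum_congr rfl fun i _ => natExt_of_lt N i.2

theorem nodeNum_eq {N : Fin n → ℕ} (p : Σ i : Fin n, Fin (N i)) :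
    nodeNum p = 2 + ∑ j ∈ Finset.range p.1, natExt N j + p.2 := by
  rw [nodeNum, finSigmaFinEquiv_apply, Finset.sum_range, add_assoc]
  congr 2
  exact Finset.sum_congr rfl fun i _ => (natExt_of_lt N (i.2.trans p.1.2)).symm

/-- What the construction of the network and the output need: input, degrees, Bethe box, mesh sizes, and
the number `V` of nodes with the variable and the label of each inner node. -/
structure Setup (M : MRF n) (k : ℕ) (ε : ℝ) (m : Mem) : Prop where
  base : Base M ε m
  deg : Degrees M m
  bounds : Bounds M k m
  count : ∀ i : Fin n, m.N 1 i = M.meshCount k ε i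
  nodes : m.N 0 3 = 2 + ∑ i, M.meshCount k ε i
  var : ∀ p : (Σ i, Fin (M.meshCount k ε i)), m.N 2 (nodeNum p) = p.1
  lab : ∀ p : (Σ i, Fin (M.meshCount k ε i)), m.N 3 (nodeNum p) = p.2

theorem Setup.congr {m m' : Mem} (h : Setup M k ε m) (h00 : m'.N 0 0 = m.N 0 0) (h03 : m'.N 0 3 = m.N 0 3)
    (hN : ∀ c ∈ ({1, 2, 3} : Finset (Fin 16)), m'.N c = m.N c)
    (hR : ∀ c ∈ ({1, 2, 3, 6, 7, 11} : Finset (Fin 16)), m'.R c = m.R c) : Setup M k ε m' := by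
  refine ⟨h.base.congr h00 (hR 1 (by decide)) (hR 11 (by decide)), h.deg.congr (hR 6 (by decide)) (hR 7 (by decide)),
    h.bounds.congr (hR 2 (by decide)) (hR 3 (by decide)), ?_, h03.trans h.nodes, ?_, ?_⟩
  · rw [hN 1 (by decide)]; exact h.count
  · rw [hN 2 (by decide)]; exact h.var
  · rw [hN 3 (by decide)]; exact h.lab

/-- The mesh sizes by counting, and the numbering of the nodes. -/
def layoutProg : Prog :=
  .seq (putN 0 3 2) (forUp 1 (sn 0) (.seq (putN 0 4 1) (.seq
    (.loop (.realLt (sr 3 * (.ofNat (sn 4) + 1)) (1 - rv 3 (sn 1) - rv 2 (sn 1))) (putN 0 4 (sn 4 + 1)))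
    (.seq (putN 1 (sn 1) (sn 4)) (forUp 2 (sn 4) (.seq (putN 2 (sn 3) (sn 1)) (.seq
      (putN 3 (sn 3) (sn 2)) (putN 0 3 (sn 3 + 1)))))))))

theorem runs_layoutProg {m : Mem} (hb : Base M ε m) (hd : Degrees M m) (hAB : Bounds M k m)
    (hγ : 0 < M.meshWidth k ε) (hw : m.R 0 3 = M.meshWidth k ε) :
    Runs layoutProg (2 * (∑ i, M.meshCount k ε i) + n) m (Setup M k ε) := by
  set N := M.meshCount k ε with hN
  refine Runs.seq0 (Runs.putN (Runs.forUp (fun i m => (Base M ε m ∧ Degrees M m ∧ Bounds M k m) ∧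
    m.R 0 3 = M.meshWidth k ε ∧ m.N 0 3 = 2 + ∑ j ∈ Finset.range i, natExt N j ∧
    (∀ i' : Fin n, (i' : ℕ) < i → m.N 1 i' = N i') ∧
    ∀ p : (Σ i, Fin (N i)), (p.1 : ℕ) < i → m.N 2 (nodeNum p) = p.1 ∧ m.N 3 (nodeNum p) = p.2)
    n (fun i => 2 * natExt N i) ?_ ⟨⟨hb.congr (by simp) (by simp) (by simp), hd.congr (by simp) (by simp),
      hAB.congr (by simp) (by simp)⟩, by simpa using hw, by simp, fun i' h => by omega, fun i' h => by omega⟩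
    (fun i m h => h.1.1.size) ?_ ?_))
  · rw [Finset.sum_add_distrib, ← Finset.mul_sum, sum_natExt]; simp
  · rintro i m hi hv ⟨⟨hb, hd, hAB⟩, hw, hV, hI, hJ⟩
    have hcnt := natExt_of_lt N hi
    rw [hcnt]
    set c := N ⟨i, hi⟩ with hc
    have hc1 : 1 ≤ c := MRF.meshCount_pos k ε ⟨i, hi⟩
    have e2 := hAB.lower ⟨i, hi⟩
    have e3 := hAB.upper ⟨i, hi⟩
    simp only at e2 e3
    refine Runs.seq0 (Runs.putN (Runs.seq c c ?_ (by omega)))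
    -- counting
    refine Runs.loop (I := fun φ m' => ∃ x, 1 ≤ x ∧ x ≤ c ∧ φ = c - x + 1 ∧ m' = m.setN 0 4 x)
      ⟨1, le_rfl, hc1, by omega, by simp⟩ ?_ ?_
    · rintro φ _ ⟨x, hx1, hxc, rfl, rfl⟩ hcond
      simp [hv, e2, e3, hw] at hcond
      refine ⟨0, Runs.putN ⟨c - x, by omega, x + 1, by omega, ?_, ?_, ?_⟩⟩
      · by_contra hlt
        have := MRF.le_meshCount hγ ⟨i, hi⟩
        rw [← hN, ← hc, show c = x by omega] at this
        linarith
      · have : x ≠ c := by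
          rintro rfl
          have := MRF.le_meshCount hγ ⟨i, hi⟩
          rw [← hN, ← hc] at this
          linarith
        omega
      · simp [Mem.setN, Mem.N]
    · rintro φ _ ⟨x, hx1, hxc, rfl, rfl⟩ hcond
      simp [hv, e2, e3, hw] at hcond
      have hxc' : x = c := le_antisymm hxc (MRF.meshCount_le hγ _ hx1 (by linarith))
      subst hxc'
      refine Runs.seq0 (Runs.putN (Runs.forUp (fun r m => (Base M ε m ∧ Degrees M m ∧ Bounds M k m) ∧
        m.N 0 1 = i ∧ m.N 0 4 = c ∧
        m.R 0 3 = M.meshWidth k ε ∧ m.N 0 3 = 2 + ∑ j ∈ Finset.range i, natExt N j + r ∧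
        (∀ i' : Fin n, (i' : ℕ) ≤ i → m.N 1 i' = N i') ∧
        ∀ p : (Σ i, Fin (N i)), (p.1 : ℕ) < i ∨ (p.1 : ℕ) = i ∧ (p.2 : ℕ) < r →
          m.N 2 (nodeNum p) = p.1 ∧ m.N 3 (nodeNum p) = p.2)
        c (fun _ => 0) (by simp) ?_ (fun r m h => h.2.2.1) ?_ ?_))
      · refine ⟨⟨hb.congr (by simp) (by simp) (by simp), hd.congr (by simp) (by simp),
          hAB.congr (by simp) (by simp)⟩, by simp [hv], by simp, by simpa using hw, by simp [hV],
          fun i' hi' => ?_, fun p hp => ?_⟩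
        · simp [hv, Function.update_apply]
          by_cases h : (i' : ℕ) = i
          · obtain rfl : i' = ⟨i, hi⟩ := Fin.ext h
            simp [hc]
          · rw [if_neg h]; exact hI i' (by omega)
        · simpa using hJ p (by omega)
      · rintro r m hr hv2 ⟨⟨hb, hd, hAB⟩, hv, hx, hw, hV, hI, hJ⟩
        refine Runs.seq0 (Runs.putN (Runs.seq0 (Runs.putN (Runs.putN ?_))))
        refine ⟨by simp [hv2], ⟨hb.congr (by simp) (by simp) (by simp), hd.congr (by simp) (by simp),
          hAB.congr (by simp) (by simp)⟩, by simp [hv], by simp [hx], by simpa using hw, by simp [hV]; ring,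
          by simpa using hI, fun p hp => ?_⟩
        simp [hv, hv2, hV, Function.update_apply]
        rw [nodeNum_eq p]
        by_cases h : (p.1 : ℕ) = i ∧ (p.2 : ℕ) = r
        · simp [h.1, h.2]
        · have hne : 2 + ∑ j ∈ Finset.range p.1, natExt N j + p.2
              ≠ 2 + ∑ j ∈ Finset.range i, natExt N j + r := by
            rcases hp with hp | hp
            · have h1 : ∑ j ∈ Finset.range (p.1 + 1), natExt N j ≤ ∑ j ∈ Finset.range i, natExt N j :=
                Finset.sum_le_sum_of_subset (Finset.range_mono hp)
              rw [Finset.sum_range_succ, natExt_of_lt N p.1.2] at h1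
              have := p.2.2
              simp only [Fin.eta] at h1
              omega
            · rw [hp.1]; omega
          rw [if_neg hne, if_neg hne, ← nodeNum_eq p]
          exact hJ p (by omega)
      · rintro m - ⟨⟨hb, hd, hAB⟩, hv, hx, hw, hV, hI, hJ⟩
        refine ⟨hv, ⟨hb.congr (by simp) (by simp) (by simp), hd.congr (by simp) (by simp),
          hAB.congr (by simp) (by simp)⟩, by simpa using hw, ?_, fun i' hi' => ?_, fun p hp => ?_⟩
        · rw [Finset.sum_range_succ, hcnt]; simpa [add_assoc] using hV
        · simpa using hI i' (by omega)
        · simp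
          refine hJ p ?_
          rcases Nat.lt_succ_iff_lt_or_eq.1 hp with h | h
          · exact Or.inl h
          · refine Or.inr ⟨h, ?_⟩
            have := p.2.2
            exact this.trans_eq (congrArg N (Fin.ext h : p.1 = ⟨i, hi⟩))
  · rintro m - ⟨⟨hb, hd, hAB⟩, hw, hV, hI, hJ⟩
    exact ⟨hb, hd, hAB, fun i => hI i i.2, by rw [hV, sum_natExt], fun p => (hJ p p.1.2).1,
      fun p => (hJ p p.1.2).2⟩

end Bethe
end

noncomputable section
namespace Bethe

/-! ### The program: capacities of the network -/

section Nodes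

variable {n : ℕ} {N : Fin n → ℕ}

/-- The numbering of the nodes of the network. -/
def nodeEquiv : CutNode N ≃ Fin (2 + ∑ i, N i) :=
  (Equiv.sumCongr (Equiv.boolNot.trans finTwoEquiv.symm) finSigmaFinEquiv).trans finSumFinEquiv

/-- The number of a node. -/
def num (x : CutNode N) : ℕ := nodeEquiv x

theorem num_source : num (Sum.inl true : CutNode N) = 0 := rfl

theorem num_sink : num (Sum.inl false : CutNode N) = 1 := rfl

theorem num_inr (p : Σ i, Fin (N i)) : num (Sum.inr p : CutNode N) = nodeNum p := rfl

theorem two_le_nodeNum (p : Σ i, Fin (N i)) : 2 ≤ nodeNum p := Nat.le_add_right _ _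

theorem num_lt (x : CutNode N) : num x < 2 + ∑ i, N i := (nodeEquiv x).2

theorem num_inj {x y : CutNode N} : num x = num y ↔ x = y := by
  rw [num, num, ← Fin.ext_iff, nodeEquiv.injective.eq_iff]

theorem exists_num {u : ℕ} (h : u < 2 + ∑ i, N i) : ∃ x : CutNode N, num x = u :=
  ⟨nodeEquiv.symm ⟨u, h⟩, by simp [num]⟩

/-- The node with a given number. -/
def node (N : Fin n → ℕ) (u : ℕ) : CutNode N :=
  if h : u < 2 + ∑ i, N i then nodeEquiv.symm ⟨u, h⟩ else Sum.inl true

@[simp] theorem node_num (x : CutNode N) : node N (num x) = x := by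
  rw [node, dif_pos (num_lt x)]; simp [num]

theorem sum_num (F : ℕ → ℝ) : ∑ u ∈ Finset.range (2 + ∑ i, N i), F u = ∑ x : CutNode N, F (num x) := by
  rw [Finset.sum_range, ← nodeEquiv.sum_comp]; rfl

theorem nodeNum_succ (p : Σ i, Fin (N i)) (h : (p.2 : ℕ) + 1 < N p.1) :
    nodeNum (⟨p.1, ⟨p.2 + 1, h⟩⟩ : Σ i, Fin (N i)) = nodeNum p + 1 := by
  rw [nodeNum_eq, nodeNum_eq]; rfl

theorem eq_chainNext_iff (p : Σ i, Fin (N i)) (y : CutNode N) :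
    y = chainNext p ↔ num y = if (p.2 : ℕ) + 1 < N p.1 then nodeNum p + 1 else 1 := by
  unfold chainNext
  split_ifs with h
  · rw [← num_inj, num_inr, nodeNum_succ]
  · rw [← num_inj, num_sink]

end Nodes

variable {n : ℕ} {M : MRF n} {ε : ℝ} {k : ℕ}

/-- The function `x ↦ - x log x`. -/
def negMulLogE (x : RExp) : RExp := (0 - x) * .log x

@[simp] theorem eval_negMulLogE (m : Mem) (x : RExp) :
    (negMulLogE x).eval m = Real.negMulLog (x.eval m) := by
  simp [negMulLogE, Real.negMulLog]

/-- The lower root `ξ`, in the form without division by zero. -/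
def xiE (a x y : RExp) : RExp :=
  2 * (1 + a) * (x * y) / (1 + a * (x + y)
    + .sqrt ((1 + a * (x + y)) * (1 + a * (x + y)) - 4 * a * (1 + a) * (x * y)))

theorem eval_xiE {m : Mem} {a x y : RExp} (ha : 0 < a.eval m) (hx : x.eval m ∈ Set.Icc (0 : ℝ) 1)
    (hy : y.eval m ∈ Set.Icc (0 : ℝ) 1) :
    (xiE a x y).eval m = MRF.xi (a.eval m) (x.eval m) (y.eval m) := by
  rw [xi_eq_conj ha hx hy]
  simp [xiE, sq]

/-- The pairwise terms of the free energy for weights `w ≠ 0`. -/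
def edgeE (w x y : RExp) : RExp :=
  0 - w * xiE (.exp w - 1) x y - (negMulLogE (1 + xiE (.exp w - 1) x y - x - y)
    + negMulLogE (x - xiE (.exp w - 1) x y) + negMulLogE (y - xiE (.exp w - 1) x y)
    + negMulLogE (xiE (.exp w - 1) x y))

theorem eval_edgeE {m : Mem} {w x y : RExp} (hw : 0 < w.eval m) (hx : x.eval m ∈ Set.Ioo (0 : ℝ) 1)
    (hy : y.eval m ∈ Set.Ioo (0 : ℝ) 1) :
    (edgeE w x y).eval m = edgeFn (w.eval m) (x.eval m) (y.eval m) := by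
  have ha : 0 < (RExp.exp w - 1).eval m := by simpa using hw
  simp only [edgeE, eval_rsub, eval_rmul, eval_radd, eval_negMulLogE, eval_xiE ha (Set.Ioo_subset_Icc_self hx) (Set.Ioo_subset_Icc_self hy),
    eval_rzero, eval_rone,
    eval_exp, edgeFn, MRF.pairEntropy]
  ring

/-- The mesh as a function of a natural number. -/
def meshFn (M : MRF n) (k : ℕ) (ε : ℝ) (i : Fin n) (r : ℕ) : ℝ :=
  M.A k i + (r + 1 : ℝ) * ((1 - M.B k i - M.A k i) / ((M.meshCount k ε i : ℝ) + 1))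

theorem meshFn_mem (hM : M.Associative) (i : Fin n) {r : ℕ} (hr : r < M.meshCount k ε i) :
    meshFn M k ε i r ∈ Set.Ioo (0 : ℝ) 1 := hM.side_subset k i (hM.mesh_mem_side k ε i ⟨r, hr⟩)

/-- The mesh point with label `r` for variable `i`. -/
def meshE (i r : NExp) : RExp :=
  rv 2 i + (.ofNat r + 1) * ((1 - rv 3 i - rv 2 i) / (.ofNat (nv 1 i) + 1))

theorem Setup.eval_meshE {m : Mem} (h : Setup M k ε m) {a b : NExp} (i : Fin n) (ha : a.eval m = i) :
    (meshE a b).eval m = meshFn M k ε i (b.eval m) := by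
  simp only [meshE, meshFn, eval_radd, eval_rv, eval_rmul, eval_rdiv, eval_rsub, eval_ofNat, eval_nv, ha,
    h.bounds.lower, h.bounds.upper, h.count, eval_rone]

/-- The unary costs of the network of the mesh. -/
def unaryCost (M : MRF n) (k : ℕ) (ε : ℝ) : (Σ i, Fin (M.meshCount k ε i)) → ℝ :=
  M.netUnary (M.meshCount k ε) (meshFn M k ε)

/-- The summands of a unary cost that belong to the edges. -/
def unaryTermE (i r j : NExp) : RExp :=
  suppE i j * edgeE (wE i j) (meshE i r) (meshE j (ltE i j * (nv 1 j - 1)))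

/-- The unary cost of label `r` for variable `i`, from the sum in the accumulator `0`. -/
def unaryE (i r : NExp) : RExp :=
  0 - rv 1 (1 + i) * meshE i r
    + (rv 7 i - 1) * (negMulLogE (meshE i r) + negMulLogE (1 - meshE i r)) + sr 0

/-- The computation of the unary costs and of the sum of their absolute values. -/
def unaryProg : Prog :=
  .seq (putR 0 5 0) (forUp 5 (sn 3 - 2) (.seq
    (sumUp 2 (sn 0) 0 (unaryTermE (nv 2 (sn 5 + 2)) (nv 3 (sn 5 + 2)) (sn 2))) (.seq
    (putR 10 (sn 5 + 2) (unaryE (nv 2 (sn 5 + 2)) (nv 3 (sn 5 + 2))))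
    (putR 0 5 (sr 5 + absE (rv 10 (sn 5 + 2)))))))

/-- The unary costs, and the constant which makes them non-negative. -/
structure Costs (M : MRF n) (k : ℕ) (ε : ℝ) (m : Mem) : Prop where
  cost : ∀ p, m.R 10 (nodeNum p) = unaryCost M k ε p
  shift : m.R 0 5 = ∑ p, |unaryCost M k ε p|

theorem runs_unaryProg (hM : M.Associative) {m : Mem} (hs : Setup M k ε m) {t : ℕ}
    (ht : (∑ i, M.meshCount k ε i) * (n + 1) ≤ t) :
    Runs unaryProg t m fun m' => Setup M k ε m' ∧ Costs M k ε m' := by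
  set N := M.meshCount k ε with hN
  set P := ∑ i, N i with hP
  set c : ℕ → ℝ := finExt fun t => unaryCost M k ε (finSigmaFinEquiv.symm t) with hc
  have hcp : ∀ p, c (finSigmaFinEquiv p : Fin P) = unaryCost M k ε p := fun p => by
    rw [hc, finExt_of_lt _ (finSigmaFinEquiv p).2, Fin.eta, Equiv.symm_apply_apply]
  refine Runs.seq0 (Runs.putR (Runs.forUp (fun t m => Setup M k ε m ∧
    m.R 0 5 = ∑ s ∈ Finset.range t, |c s| ∧ ∀ s < t, m.R 10 (2 + s) = c s) P (fun _ => n)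
    (by simpa using ht) ⟨hs.congr (by simp) (by simp) (by simp) (by simp), by simp, by simp⟩
    (fun t m h => by simp [h.1.nodes, ← hN, ← hP]) ?_ ?_))
  · rintro t m hlt hv ⟨hs, h5, h10⟩
    set p := finSigmaFinEquiv.symm ⟨t, hlt⟩ with hp
    have hpt : 2 + t = nodeNum p := by simp [nodeNum, hp]
    have hv2 := hs.var p
    have hv3 := hs.lab p
    refine Runs.seq n 0 (Runs.sumUp n (finExt fun j => (if M.W p.1 j ≠ 0 then 1 else 0) *
      edgeFn (M.W p.1 j) (meshFn M k ε p.1 p.2) (meshFn M k ε j (if p.1 < j then N j - 1 else 0))) le_rfl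
      (fun a x => by simp [hs.base.size]) (fun j x hj => ?_) ?_) le_rfl
    · rw [finExt_of_lt _ hj]
      have hs' : Setup M k ε ((m.setR 0 0 x).setN 0 2 j) :=
        hs.congr (by simp) (by simp) (by simp) (by simp)
      have e2 : (nv 2 (sn 5 + 2)).eval ((m.setR 0 0 x).setN 0 2 j) = p.1 := by
        simpa [hv, add_comm t 2, hpt] using hv2
      have e3 : (nv 3 (sn 5 + 2)).eval ((m.setR 0 0 x).setN 0 2 j) = p.2 := by
        simpa [hv, add_comm t 2, hpt] using hv3
      have e4 : (sn 2).eval ((m.setR 0 0 x).setN 0 2 j) = (⟨j, hj⟩ : Fin n) := by simp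
      have e5 := hs'.base.eval_wE p.1 ⟨j, hj⟩ e2 e4
      have e6 : (ltE (nv 2 (sn 5 + 2)) (sn 2) * (nv 1 (sn 2) - 1)).eval ((m.setR 0 0 x).setN 0 2 j)
          = if p.1 < ⟨j, hj⟩ then N ⟨j, hj⟩ - 1 else 0 := by
        rw [eval_nmul, eval_ltE, e2, e4, eval_nsub, eval_nv, e4, hs'.count, eval_none]
        simp only [Fin.lt_def]
        split_ifs <;> simp [hN]
      rw [unaryTermE, eval_rmul, hs'.base.eval_suppE _ _ e2 e4]
      by_cases h : M.W p.1 ⟨j, hj⟩ = 0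
      · simp [h]
      · have hj' : 0 < N ⟨j, hj⟩ := M.meshCount_pos k ε ⟨j, hj⟩
        rw [if_pos h, eval_edgeE (by rw [e5]; exact hM.W_pos h)
          (by rw [hs'.eval_meshE _ e2, e3]; exact meshFn_mem hM _ p.2.2)
          (by rw [hs'.eval_meshE _ e4, e6]; exact meshFn_mem hM _ (by
            rw [← hN]; split_ifs <;> omega)), e5,
          hs'.eval_meshE _ e2, hs'.eval_meshE _ e4, e6, e3]
    · rw [sum_finExt, ← sum_nbrs_eq]
      set S := ∑ j ∈ M.nbrs p.1, edgeFn (M.W p.1 j) (meshFn M k ε p.1 p.2)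
        (meshFn M k ε j (if p.1 < j then N j - 1 else 0)) with hS
      have hs' : Setup M k ε ((m.setR 0 0 S).setN 0 2 n) :=
        hs.congr (by simp) (by simp) (by simp) (by simp)
      have e2 : (nv 2 (sn 5 + 2)).eval ((m.setR 0 0 S).setN 0 2 n) = p.1 := by
        simpa [hv, add_comm t 2, hpt] using hv2
      have e3 : (nv 3 (sn 5 + 2)).eval ((m.setR 0 0 S).setN 0 2 n) = p.2 := by
        simpa [hv, add_comm t 2, hpt] using hv3
      have e7 : (unaryE (nv 2 (sn 5 + 2)) (nv 3 (sn 5 + 2))).eval ((m.setR 0 0 S).setN 0 2 n) = c t := by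
        rw [hc, finExt_of_lt _ hlt, ← hp, unaryE, unaryCost, MRF.netUnary,
          Real.binEntropy_eq_negMulLog_add_negMulLog_one_sub]
        simp only [eval_radd, eval_rsub, eval_rmul, eval_negMulLogE, hs'.eval_meshE _ e2, e3, eval_rone,
          eval_rzero, hs'.base.eval_theta _ e2, eval_rv, e2, hs'.deg.deg]
        simp
        rfl
      refine Runs.seq0 (Runs.putR (Runs.putR ?_))
      rw [e7]
      refine ⟨by simp [hv], hs.congr (by simp) (by simp) (by simp) (by simp), ?_, fun s hs => ?_⟩
      · rw [Finset.sum_range_succ]; simp [hv, h5]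
      · rcases Nat.lt_succ_iff_lt_or_eq.1 hs with h | rfl
        · have := h10 s h
          simp [hv, add_comm t 2, h.ne, this]
        · simp [hv, add_comm s 2]
  · rintro m - ⟨hs, h5, h10⟩
    refine ⟨hs, fun p => ?_, ?_⟩
    · rw [nodeNum, h10 _ (finSigmaFinEquiv p).2, hcp]
    · rw [h5, Finset.sum_range, ← finSigmaFinEquiv.sum_comp]
      exact Finset.sum_congr rfl fun p _ => by rw [hcp]

/-- The shifted unary costs. -/
def shiftedCost (M : MRF n) (k : ℕ) (ε : ℝ) (p : Σ i, Fin (M.meshCount k ε i)) : ℝ :=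
  unaryCost M k ε p + ∑ q, |unaryCost M k ε q|

/-- The interactions of the network of the mesh. -/
def pairCost (M : MRF n) (k : ℕ) (ε : ℝ) : (Σ i, Fin (M.meshCount k ε i)) → (Σ i, Fin (M.meshCount k ε i)) → ℝ :=
  M.netPair (M.meshCount k ε) (meshFn M k ε)

/-- The capacities of the network of the mesh. -/
def meshCap (M : MRF n) (k : ℕ) (ε : ℝ) : CutNode (M.meshCount k ε) → CutNode (M.meshCount k ε) → ℝ :=
  netCap (shiftedCost M k ε) (pairCost M k ε) (softTotal (shiftedCost M k ε) (pairCost M k ε) + 1)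

/-- The indicator of the arcs along the chains. -/
def chainE (u v : NExp) : NExp :=
  ltE 1 u * (ltE (nv 3 u + 1) (nv 1 (nv 2 u)) * eqE v (u + 1)
    + (1 - ltE (nv 3 u + 1) (nv 1 (nv 2 u))) * eqE v 1)

/-- The indicator of the arcs that carry interactions. -/
def pairE (u v : NExp) : NExp :=
  ltE 1 u * ltE 1 v * ltE (nv 2 u) (nv 2 v) * ltE 0 (nv 3 u) * ltE 0 (nv 3 v)

/-- The indicator of the rigid arcs. -/
def rigidE (u v : NExp) : NExp :=
  ltE 1 v * (eqE u 0 * eqE (nv 3 v) 0 + ltE 1 u * eqE (nv 2 u) (nv 2 v) * eqE (nv 3 u) (nv 3 v + 1))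

/-- The mixed difference of a pairwise term. -/
def mixedE (i r j s : NExp) : RExp :=
  edgeE (wE i j) (meshE i (r - 1)) (meshE j s) + edgeE (wE i j) (meshE i r) (meshE j (s - 1))
    - edgeE (wE i j) (meshE i r) (meshE j s) - edgeE (wE i j) (meshE i (r - 1)) (meshE j (s - 1))

/-- The capacities that are not rigid. -/
def softE (u v : NExp) : RExp :=
  .ofNat (chainE u v) * (rv 10 u + sr 5)
    + .ofNat (pairE u v) * (suppE (nv 2 u) (nv 2 v) * mixedE (nv 2 u) (nv 3 u) (nv 2 v) (nv 3 v))

/-- The capacities, with the sum of the soft ones in a scalar variable. -/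
def capE (u v : NExp) : RExp := softE u v + .ofNat (rigidE u v) * (sr 6 + 1)

/-- The expression agrees with the soft capacities on all pairs of nodes, including the source and the sink,
for which the indicators vanish. -/
theorem Setup.eval_softE (hM : M.Associative) {m : Mem} (hs : Setup M k ε m) (hc : Costs M k ε m) {u v : NExp}
    (x y : CutNode (M.meshCount k ε)) (hu : u.eval m = num x) (hv : v.eval m = num y) :
    (softE u v).eval m = chainCap (shiftedCost M k ε) x y + pairCap (pairCost M k ε) x y := by
  have h1 : ((chainE u v).eval m : ℝ) * (m.R 10 (u.eval m) + m.R 0 5) = chainCap (shiftedCost M k ε) x y := by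
    rcases x with (_ | _) | p
    · rw [num_sink] at hu; simp [chainE, hu, chainCap]
    · rw [num_source] at hu; simp [chainE, hu, chainCap]
    · have hp : 1 < nodeNum p := two_le_nodeNum p
      rw [num_inr] at hu
      simp only [chainE, eval_nmul, eval_ltE, eval_nadd, eval_nsub, eval_eqE, eval_none, eval_nv, hu, hv,
        chainCap, eq_chainNext_iff, hs.var, hs.lab, hs.count, hc.cost, hc.shift, if_pos hp, shiftedCost]
      split_ifs <;> simp_all
  have h2 : ((pairE u v).eval m : ℝ) * (suppE (nv 2 u) (nv 2 v) *
      mixedE (nv 2 u) (nv 3 u) (nv 2 v) (nv 3 v)).eval m = pairCap (pairCost M k ε) x y := by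
    rcases x with (_ | _) | p
    · rw [num_sink] at hu; simp [pairE, hu, pairCap]
    · rw [num_source] at hu; simp [pairE, hu, pairCap]
    · rcases y with (_ | _) | q
      · rw [num_sink] at hv; simp [pairE, hv, pairCap]
      · rw [num_source] at hv; simp [pairE, hv, pairCap]
      · have hp : 1 < nodeNum p := two_le_nodeNum p
        have hq : 1 < nodeNum q := two_le_nodeNum q
        rw [num_inr] at hu hv
        have e1 : (nv 2 u).eval m = p.1 := by rw [eval_nv, hu, hs.var]
        have e2 : (nv 2 v).eval m = q.1 := by rw [eval_nv, hv, hs.var]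
        have e3 : (nv 3 u).eval m = p.2 := by rw [eval_nv, hu, hs.lab]
        have e4 : (nv 3 v).eval m = q.2 := by rw [eval_nv, hv, hs.lab]
        have e5 := hs.base.eval_wE p.1 q.1 e1 e2
        simp only [pairE, eval_nmul, eval_ltE, eval_none, e1, e2, e3, e4, hu, hv, eval_nzero, eval_rmul,
          hs.base.eval_suppE _ _ e1 e2, pairCap, pairCost, MRF.netPair, if_pos hp, if_pos hq]
        by_cases hW : M.W p.1 q.1 = 0
        · simp [hW]
        · have e6 : (mixedE (nv 2 u) (nv 3 u) (nv 2 v) (nv 3 v)).eval m = mixedDiff (fun r s =>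
              edgeFn (M.W p.1 q.1) (meshFn M k ε p.1 r) (meshFn M k ε q.1 s)) p.2 q.2 := by
            have hw : 0 < (wE (nv 2 u) (nv 2 v)).eval m := by rw [e5]; exact hM.W_pos hW
            have hxm : ∀ {a : NExp}, a.eval m ≤ p.2 → (meshE (nv 2 u) a).eval m ∈ Set.Ioo (0 : ℝ) 1 :=
              fun ha => by rw [hs.eval_meshE _ e1]; exact meshFn_mem hM _ (ha.trans_lt p.2.2)
            have hym : ∀ {a : NExp}, a.eval m ≤ q.2 → (meshE (nv 2 v) a).eval m ∈ Set.Ioo (0 : ℝ) 1 :=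
              fun ha => by rw [hs.eval_meshE _ e2]; exact meshFn_mem hM _ (ha.trans_lt q.2.2)
            have e3' : (nv 3 u - 1).eval m ≤ p.2 := by rw [eval_nsub, e3]; exact Nat.sub_le _ _
            have e4' : (nv 3 v - 1).eval m ≤ q.2 := by rw [eval_nsub, e4]; exact Nat.sub_le _ _
            rw [mixedE, eval_rsub, eval_rsub, eval_radd, eval_edgeE hw (hxm e3') (hym e4.le),
              eval_edgeE hw (hxm e3.le) (hym e4'), eval_edgeE hw (hxm e3.le) (hym e4.le),
              eval_edgeE hw (hxm e3') (hym e4')]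
            simp only [hs.eval_meshE _ e1, hs.eval_meshE _ e2, eval_nsub, e3, e4, e5, eval_none, mixedDiff]
          rw [e6]
          simp only [Fin.lt_def, Nat.one_le_iff_ne_zero, Nat.pos_iff_ne_zero]
          split_ifs <;> simp_all
  simp only [softE, eval_radd, eval_rmul, eval_ofNat, eval_rv, eval_sr] at h2 ⊢
  rw [h1, h2]

open Classical in
theorem Setup.eval_capE (hM : M.Associative) {m : Mem} (hs : Setup M k ε m) (hc : Costs M k ε m)
    (h6 : m.R 0 6 = softTotal (shiftedCost M k ε) (pairCost M k ε)) {u v : NExp}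
    (x y : CutNode (M.meshCount k ε)) (hu : u.eval m = num x) (hv : v.eval m = num y) :
    (capE u v).eval m = meshCap M k ε x y := by
  have h : ((rigidE u v).eval m : ℝ) * (m.R 0 6 + 1)
      = if IsRigid x y then softTotal (shiftedCost M k ε) (pairCost M k ε) + 1 else 0 := by
    rw [h6]
    rcases y with (_ | _) | q
    · rw [num_sink] at hv
      rcases x with (_ | _) | p <;> simp [rigidE, hv, IsRigid]
    · rw [num_source] at hv
      rcases x with (_ | _) | p <;> simp [rigidE, hv, IsRigid]
    · have hq : 1 < nodeNum q := two_le_nodeNum q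
      rw [num_inr] at hv
      rcases x with (_ | _) | p
      · rw [num_sink] at hu; simp [rigidE, hu, hv, IsRigid]
      · rw [num_source] at hu
        by_cases h0 : (q.2 : ℕ) = 0 <;> simp [rigidE, hu, hv, IsRigid, hs.lab, hq, h0]
      · have hp : 1 < nodeNum p := two_le_nodeNum p
        have hp' : nodeNum p ≠ 0 := by omega
        rw [num_inr] at hu
        simp only [rigidE, eval_nmul, eval_nadd, eval_ltE, eval_eqE, eval_none, eval_nzero, eval_nv, hu, hv,
          IsRigid, hs.lab, hs.var, if_pos hp, if_pos hq, if_neg hp', Fin.ext_iff]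
        split_ifs <;> simp_all
  rw [capE, eval_radd, hs.eval_softE hM hc x y hu hv, eval_rmul, eval_ofNat, eval_radd, eval_sr, eval_rone, h,
    meshCap, netCap]

end Bethe
end

noncomputable section
namespace Bethe

/-! ### The program: push-relabel -/

variable {n : ℕ} {M : MRF n} {ε : ℝ} {k : ℕ}

/-- An injective function that addresses the entries of an infinite matrix. -/
def pr (u v : ℕ) : ℕ := (u + v) * (u + v) + u

theorem pr_inj {a b c d : ℕ} : pr a b = pr c d ↔ a = c ∧ b = d := by
  unfold pr
  refine ⟨fun h => ?_, by rintro ⟨rfl, rfl⟩; rfl⟩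
  have h1 : a + b = c + d := by
    rcases lt_trichotomy (a + b) (c + d) with h1 | h1 | h1
    · have := Nat.mul_le_mul (show a + b + 1 ≤ c + d from h1) (show a + b + 1 ≤ c + d from h1)
      have e : (a + b + 1) * (a + b + 1) = (a + b) * (a + b) + 2 * (a + b) + 1 := by ring
      omega
    · exact h1
    · have := Nat.mul_le_mul (show c + d + 1 ≤ a + b from h1) (show c + d + 1 ≤ a + b from h1)
      have e : (c + d + 1) * (c + d + 1) = (c + d) * (c + d) + 2 * (c + d) + 1 := by ring
      omega
  rw [h1] at h
  omega

/-- The address of an entry of the residual matrix. -/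
def prE (u v : NExp) : NExp := (u + v) * (u + v) + u

@[simp] theorem eval_prE (m : Mem) (u v : NExp) : (prE u v).eval m = pr (u.eval m) (v.eval m) := rfl

/-- The state of the push-relabel algorithm in memory. -/
def flowOf (m : Mem) : Flow where
  res := fun u v => m.R 8 (pr u v)
  exc := m.R 9
  ht := m.N 4
  cur := m.N 5
  pos := m.N 0 7
  act := m.N 0 8
  run := m.N 0 9

/-- The total of the soft capacities. -/
def totalProg : Prog :=
  .seq (putR 0 6 0) (forUp 5 (sn 3) (.seq (sumUp 6 (sn 3) 0 (softE (sn 5) (sn 6)))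
    (putR 0 6 (sr 6 + sr 0))))

theorem Costs.congr {m m' : Mem} (h : Costs M k ε m) (h10 : m'.R 10 = m.R 10) (h5 : m'.R 0 5 = m.R 0 5) :
    Costs M k ε m' := ⟨fun p => by rw [h10, h.cost], by rw [h5, h.shift]⟩

theorem runs_totalProg (hM : M.Associative) {m : Mem} (hs : Setup M k ε m) (hc : Costs M k ε m) {V t : ℕ}
    (hV : V = 2 + ∑ i, M.meshCount k ε i) (ht : V * (V + 1) ≤ t) :
    Runs totalProg t m fun m' => Setup M k ε m' ∧ Costs M k ε m' ∧
      m'.R 0 6 = softTotal (shiftedCost M k ε) (pairCost M k ε) := by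
  set soft : ℕ → ℕ → ℝ := fun u v => chainCap (shiftedCost M k ε) (node _ u) (node _ v)
    + pairCap (pairCost M k ε) (node _ u) (node _ v) with hsoft
  refine Runs.seq0 (Runs.putR (Runs.forUp (fun u m => Setup M k ε m ∧ Costs M k ε m ∧
    m.R 0 6 = ∑ u' ∈ Finset.range u, ∑ v ∈ Finset.range V, soft u' v) V (fun _ => V) (by simpa using ht)
    ⟨hs.congr (by simp) (by simp) (by simp) (by simp), hc.congr (by simp) (by simp), by simp⟩
    (fun u m h => by simp [h.1.nodes, hV]) ?_ ?_))
  · rintro u m hu hv ⟨hs, hc, h6⟩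
    refine Runs.seq V 0 (Runs.sumUp V (soft u) le_rfl (fun a x => by simp [hs.nodes, hV])
      (fun v x hv' => ?_) ?_) le_rfl
    · have hs' : Setup M k ε ((m.setR 0 0 x).setN 0 6 v) := hs.congr (by simp) (by simp) (by simp) (by simp)
      have hc' : Costs M k ε ((m.setR 0 0 x).setN 0 6 v) := hc.congr (by simp) (by simp)
      rw [hV] at hu hv'
      obtain ⟨a, rfl⟩ := exists_num hu
      obtain ⟨b, rfl⟩ := exists_num hv'
      rw [hs'.eval_softE hM hc' a b (by simp [hv]) (by simp), hsoft]
      simp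
    · refine Runs.putR ⟨by simp [hv], hs.congr (by simp) (by simp) (by simp) (by simp),
        hc.congr (by simp) (by simp), ?_⟩
      rw [Finset.sum_range_succ]; simp [h6]
  · rintro m - ⟨hs, hc, h6⟩
    refine ⟨hs, hc, ?_⟩
    rw [h6, hV, sum_num, softTotal]
    refine Finset.sum_congr rfl fun x _ => ?_
    rw [sum_num]
    simp [hsoft]

/-- The capacities as a function of the numbers of the nodes. -/
def numCap (M : MRF n) (k : ℕ) (ε : ℝ) (u v : ℕ) : ℝ := meshCap M k ε (node _ u) (node _ v)

/-- The initial preflow, which saturates the arcs at the source. -/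
def initProg : Prog :=
  .seq (forUp 5 (sn 3) (.seq (putR 9 (sn 5) (capE 0 (sn 5))) (.seq
    (putN 4 (sn 5) (eqE (sn 5) 0 * sn 3)) (.seq (putN 5 (sn 5) 0)
    (forUp 6 (sn 3) (putR 8 (prE (sn 5) (sn 6)) (.ofNat (1 - eqE (sn 5) 0) *
      (capE (sn 5) (sn 6) + .ofNat (eqE (sn 6) 0) * capE (sn 6) (sn 5)))))))))
    (.seq (putN 0 7 0) (.seq (putN 0 8 0) (putN 0 9 1)))

theorem runs_initProg (hM : M.Associative) {m : Mem} (hs : Setup M k ε m) (hc : Costs M k ε m)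
    (h6 : m.R 0 6 = softTotal (shiftedCost M k ε) (pairCost M k ε)) {V t : ℕ}
    (hV : V = 2 + ∑ i, M.meshCount k ε i) (ht : V * (V + 1) ≤ t)
    (hcap : ∀ u v, 0 ≤ meshCap M k ε u v) :
    Runs initProg t m fun m' => Setup M k ε m' ∧ (flowOf m').Inv V (numCap M k ε) := by
  set tot := softTotal (shiftedCost M k ε) (pairCost M k ε) with htot
  have heval : ∀ {m : Mem}, Setup M k ε m → Costs M k ε m → m.R 0 6 = tot → ∀ {a b : NExp} {u v : ℕ},
      u < V → v < V → a.eval m = u → b.eval m = v → (capE a b).eval m = numCap M k ε u v := by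
    intro m hs hc h6 a b u v hu hv ha hb
    rw [hV] at hu hv
    obtain ⟨x, rfl⟩ := exists_num hu
    obtain ⟨y, rfl⟩ := exists_num hv
    rw [hs.eval_capE hM hc h6 x y ha hb, numCap, node_num, node_num]
  set r : ℕ → ℕ → ℝ := fun u v => if u = 0 then 0
    else if v = 0 then numCap M k ε u 0 + numCap M k ε 0 u else numCap M k ε u v with hr
  refine Runs.seq t 0 (Runs.forUp (fun u m => (Setup M k ε m ∧ Costs M k ε m ∧ m.R 0 6 = tot) ∧
    ∀ u' < u, m.R 9 u' = numCap M k ε 0 u' ∧ m.N 4 u' = (if u' = 0 then V else 0) ∧ m.N 5 u' = 0 ∧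
      ∀ v < V, m.R 8 (pr u' v) = r u' v) V (fun _ => V) (by simpa using ht)
    ⟨⟨hs.congr (by simp) (by simp) (by simp) (by simp), hc.congr (by simp) (by simp), by simpa using h6⟩,
      fun u' h => by omega⟩
    (fun u m h => by simp [h.1.1.nodes, hV]) ?_ ?_) le_rfl
  · rintro u m hu hv ⟨⟨hs, hc, h6⟩, hI⟩
    refine Runs.seq0 (Runs.putR (Runs.seq0 (Runs.putN (Runs.seq0 (Runs.putN ?_)))))
    rw [heval hs hc h6 (u := 0) (v := u) (by omega) hu (by simp) (by simp [hv])]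
    refine Runs.forUp (fun v m => (Setup M k ε m ∧ Costs M k ε m ∧ m.R 0 6 = tot) ∧ m.N 0 5 = u ∧
      (m.R 9 u = numCap M k ε 0 u ∧ m.N 4 u = (if u = 0 then V else 0) ∧ m.N 5 u = 0 ∧
        ∀ v' < v, m.R 8 (pr u v') = r u v') ∧
      ∀ u' < u, m.R 9 u' = numCap M k ε 0 u' ∧ m.N 4 u' = (if u' = 0 then V else 0) ∧ m.N 5 u' = 0 ∧
        ∀ v < V, m.R 8 (pr u' v) = r u' v) V (fun _ => 0) (by simp) ?_
      (fun v m h => by simp [h.1.1.nodes, hV]) ?_ ?_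
    · refine ⟨⟨hs.congr (by simp) (by simp) (by simp) (by simp), hc.congr (by simp) (by simp),
        by simpa using h6⟩, by simp [hv], by simp [hv, hs.nodes, hV], fun u' hu' => ?_⟩
      have := hI u' hu'
      simpa [hv, hu'.ne] using this
    · rintro v m hvV hv6 ⟨⟨hs, hc, h6⟩, hv, ⟨h9, h4, h5, h8⟩, hI⟩
      have e1 := heval hs hc h6 (a := sn 5) (b := sn 6) hu hvV hv hv6
      have e2 := heval hs hc h6 (a := sn 6) (b := sn 5) hvV hu hv6 hv
      have e3 : (RExp.ofNat (1 - eqE (sn 5) 0) *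
          (capE (sn 5) (sn 6) + RExp.ofNat (eqE (sn 6) 0) * capE (sn 6) (sn 5))).eval m = r u v := by
        simp only [eval_rmul, eval_radd, eval_ofNat, e1, e2, eval_nsub, eval_eqE, eval_sn, hv, hv6,
          eval_none, eval_nzero, hr]
        split_ifs with h1 h2 h2 <;> simp [h2]
      refine Runs.putR ?_
      rw [e3]
      refine ⟨by simp [hv6], ⟨hs.congr (by simp) (by simp) (by simp) (by simp), hc.congr (by simp) (by simp),
        by simpa using h6⟩, by simp [hv], ⟨by simpa using h9, by simpa using h4, by simpa using h5,
        fun v' hv' => ?_⟩, fun u' hu' => ?_⟩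
      · rcases Nat.lt_succ_iff_lt_or_eq.1 hv' with h | rfl
        · simpa [hv, hv6, Function.update_apply, pr_inj, h.ne] using h8 v' h
        · simp [hv, hv6]
      · simpa [hv, hv6, Function.update_apply, pr_inj, hu'.ne] using hI u' hu'
    · rintro m - ⟨⟨hs, hc, h6⟩, hv, hU, hI⟩
      refine ⟨hv, ⟨hs.congr (by simp) (by simp) (by simp) (by simp), hc.congr (by simp) (by simp),
        by simpa using h6⟩, fun u' hu' => ?_⟩
      rcases Nat.lt_succ_iff_lt_or_eq.1 hu' with h | rfl
      · simpa using hI u' h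
      · simpa using hU
  · rintro m - ⟨⟨hs, hc, -⟩, hI⟩
    refine Runs.seq0 (Runs.putN (Runs.seq0 (Runs.putN (Runs.putN
      ⟨hs.congr (by simp) (by simp) (by simp) (by simp), ?_⟩))))
    refine Flow.inv_of_saturated (fun u v _ _ => hcap _ _) ?_ (by omega) (fun u v hu hv => ?_)
      (fun v hv => ?_) (fun v hv => ?_) (fun v hv => ?_) ?_ ?_ ?_
    · have : node (M.meshCount k ε) 0 = Sum.inl true := node_num (Sum.inl true)
      simp [numCap, this, meshCap, netCap, chainCap, pairCap, IsRigid]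
    · simpa [flowOf] using (hI u hu).2.2.2 v hv
    · simpa [flowOf] using (hI v hv).1
    · simpa [flowOf] using (hI v hv).2.1
    · simpa [flowOf] using (hI v hv).2.2.1
    all_goals simp [flowOf]

/-- Sending the flow in the accumulator `0` along the current arc of the node at the current position. -/
def pushProg : Prog :=
  .seq (putR 8 (prE (sn 7) (nv 5 (sn 7))) (rv 8 (prE (sn 7) (nv 5 (sn 7))) - sr 0)) (.seq
    (putR 8 (prE (nv 5 (sn 7)) (sn 7)) (rv 8 (prE (nv 5 (sn 7)) (sn 7)) + sr 0)) (.seq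
    (putR 9 (sn 7) (rv 9 (sn 7) - sr 0)) (putR 9 (nv 5 (sn 7)) (rv 9 (nv 5 (sn 7)) + sr 0))))

section FlowOf

variable (m : Mem)

theorem flowOf_setR_zero (i : ℕ) (v : ℝ) : flowOf (m.setR 0 i v) = flowOf m := by simp [flowOf]

theorem flowOf_setN_current (i v : ℕ) :
    flowOf (m.setN 5 i v) = { flowOf m with cur := Function.update (flowOf m).cur i v } := by simp [flowOf]

theorem flowOf_setN_pos (v : ℕ) : flowOf (m.setN 0 7 v) = { flowOf m with pos := v } := by simp [flowOf]

theorem flowOf_setN_act (v : ℕ) : flowOf (m.setN 0 8 v) = { flowOf m with act := v } := by simp [flowOf]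

end FlowOf

theorem runs_pushProg {m : Mem} {Q : Mem → Prop} {u w : ℕ} {δ : ℝ} (hs : Setup M k ε m) (hu : m.N 0 7 = u)
    (hw : m.N 5 u = w) (hδ : m.R 0 0 = δ) (h : w ≠ u)
    (hQ : ∀ m', Setup M k ε m' → flowOf m' = (flowOf m).push u w δ → m'.N = m.N → Q m') :
    Runs pushProg 0 m Q := by
  refine Runs.seq0 (Runs.putR (Runs.seq0 (Runs.putR (Runs.seq0 (Runs.putR (Runs.putR
    (hQ _ (hs.congr (by simp) (by simp) (by simp) (by simp)) ?_ (by simp))))))))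
  have hpr : pr w u ≠ pr u w := by rw [Ne, pr_inj]; tauto
  simp only [eval_prE, eval_sn, eval_nv, eval_rsub, eval_radd, eval_rv, Mem.N_setR, hu, hw, hδ, eval_sr,
    Mem.R_setR_self, ne_eq, Fin.reduceEq, not_false_eq_true, Mem.R_setR_of_ne, Function.update_of_ne hpr,
    Function.update_of_ne h]
  simp only [flowOf, Flow.push, Flow.mk.injEq, Mem.R_setR_self, ne_eq, Fin.reduceEq, not_false_eq_true,
    Mem.R_setR_of_ne, Mem.N_setR, and_true]
  refine ⟨?_, ?_⟩
  · funext a b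
    simp only [Function.update_apply, pr_inj]
    by_cases h1 : a = w ∧ b = u
    · have h2 : ¬ (a = u ∧ b = w) := by rintro ⟨rfl, rfl⟩; exact h h1.1.symm
      rw [if_pos h1, if_neg h2, if_pos h1]
    · rw [if_neg h1, if_neg h1]
  · funext a
    simp only [Function.update_apply]
    by_cases h1 : a = w
    · have h2 : a ≠ u := by rintro rfl; exact h h1.symm
      rw [if_pos h1, if_neg h2, if_pos h1]
    · rw [if_neg h1, if_neg h1]

/-- One step of the push-relabel algorithm. -/
def stepProg : Prog :=
  .branch (.natLt (sn 7) (sn 3))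
    (.branch (.conj (.natLt 1 (sn 7)) (.conj (.realLt 0 (rv 9 (sn 7))) (.natLt (nv 4 (sn 7)) (sn 3))))
      (.seq (putN 0 8 1) (.branch (.natLt (nv 5 (sn 7)) (sn 3))
        (.branch (.conj (.realLt 0 (rv 8 (prE (sn 7) (nv 5 (sn 7)))))
            (.natEq (nv 4 (sn 7)) (nv 4 (nv 5 (sn 7)) + 1)))
          (.branch (.realLt (rv 8 (prE (sn 7) (nv 5 (sn 7)))) (rv 9 (sn 7)))
            (.seq (putR 0 0 (rv 8 (prE (sn 7) (nv 5 (sn 7)))))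
              (.seq pushProg (putN 5 (sn 7) (nv 5 (sn 7) + 1))))
            (.seq (putR 0 0 (rv 9 (sn 7))) (.seq pushProg (putN 0 7 (sn 7 + 1)))))
          (putN 5 (sn 7) (nv 5 (sn 7) + 1)))
        (.seq (putN 4 (sn 7) (nv 4 (sn 7) + 1)) (putN 5 (sn 7) 0))))
      (putN 0 7 (sn 7 + 1)))
    (.branch (.natEq (sn 8) 1) (.seq (putN 0 7 0) (putN 0 8 0)) (putN 0 9 0))

/-- The program simulates a step of the algorithm, without loops. -/
theorem runs_stepProg {m : Mem} (hs : Setup M k ε m) {V : ℕ} (hV : V = 2 + ∑ i, M.meshCount k ε i) :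
    Runs stepProg 0 m fun m' => Setup M k ε m' ∧ flowOf m' = (flowOf m).step V := by
  have h3 : m.N 0 3 = V := hs.nodes.trans hV.symm
  have hcong : ∀ {m' : Mem}, m'.N 0 0 = m.N 0 0 → m'.N 0 3 = m.N 0 3 →
    (∀ c ∈ ({1, 2, 3} : Finset (Fin 16)), m'.N c = m.N c) →
    (∀ c ∈ ({1, 2, 3, 6, 7, 11} : Finset (Fin 16)), m'.R c = m.R c) → Setup M k ε m' := hs.congr
  refine Runs.branch (fun h1 => ?_) (fun h1 => ?_)
  · simp only [holds_natLt, eval_sn, h3] at h1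
    have h1' : (flowOf m).pos < V := h1
    refine Runs.branch (fun h2 => ?_) (fun h2 => ?_)
    · simp only [holds_natLt, holds_conj, holds_realLt, eval_sn, eval_nv, eval_rv, h3, eval_none,
        eval_rzero] at h2
      have hact : (flowOf m).Active V (flowOf m).pos := ⟨⟨h2.1, h1⟩, h2.2.1, h2.2.2⟩
      refine Runs.seq0 (Runs.putN (Runs.branch (fun h4 => ?_) (fun h4 => ?_)))
      · have h4' : (flowOf m).cur (flowOf m).pos < V := by simpa [flowOf, h3] using h4
        refine Runs.branch (fun h5 => ?_) (fun h5 => ?_)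
        · have h5' : 0 < (flowOf m).res (flowOf m).pos ((flowOf m).cur (flowOf m).pos) ∧
              (flowOf m).ht (flowOf m).pos = (flowOf m).ht ((flowOf m).cur (flowOf m).pos) + 1 := by
            simpa [flowOf] using h5
          have hne : (flowOf m).cur (flowOf m).pos ≠ (flowOf m).pos := fun h => by rw [h] at h5'; omega
          refine Runs.branch (fun h6 => ?_) (fun h6 => ?_)
          · have h6' : ¬ (flowOf m).exc (flowOf m).pos
                ≤ (flowOf m).res (flowOf m).pos ((flowOf m).cur (flowOf m).pos) := by
              simpa [flowOf] using h6
            refine Runs.seq0 (Runs.putR (Runs.seq0 (runs_pushProg (u := (flowOf m).pos)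
              (w := (flowOf m).cur (flowOf m).pos)
              (δ := (flowOf m).res (flowOf m).pos ((flowOf m).cur (flowOf m).pos))
              (hcong (by simp) (by simp) (by simp) (by simp)) (by simp [flowOf]) (by simp [flowOf])
              (by simp [flowOf]) hne (fun m' hs' hf hN => ?_))))
            refine Runs.putN ⟨hs'.congr (by simp) (by simp) (by simp) (by simp), ?_⟩
            rw [Flow.step, if_pos h1', if_pos hact, if_pos h4', if_pos h5', if_neg h6', flowOf_setN_current, hf,
              flowOf_setR_zero]
            simp only [eval_sn, eval_nv, eval_nadd, hN, eval_nlit, flowOf_setN_act]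
            simp [Flow.push, flowOf]
          · have h6' : (flowOf m).exc (flowOf m).pos
                ≤ (flowOf m).res (flowOf m).pos ((flowOf m).cur (flowOf m).pos) := by
              simpa [flowOf] using h6
            refine Runs.seq0 (Runs.putR (Runs.seq0 (runs_pushProg (u := (flowOf m).pos)
              (w := (flowOf m).cur (flowOf m).pos) (δ := (flowOf m).exc (flowOf m).pos)
              (hcong (by simp) (by simp) (by simp) (by simp)) (by simp [flowOf]) (by simp [flowOf])
              (by simp [flowOf]) hne (fun m' hs' hf hN => ?_))))
            refine Runs.putN ⟨hs'.congr (by simp) (by simp) (by simp) (by simp), ?_⟩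
            rw [Flow.step, if_pos h1', if_pos hact, if_pos h4', if_pos h5', if_pos h6', eval_nlit,
              flowOf_setN_pos, hf, flowOf_setR_zero]
            simp only [eval_sn, eval_nadd, hN, eval_nlit, flowOf_setN_act]
            simp [Flow.push, flowOf]
        · have h5' : ¬ (0 < (flowOf m).res (flowOf m).pos ((flowOf m).cur (flowOf m).pos) ∧
              (flowOf m).ht (flowOf m).pos = (flowOf m).ht ((flowOf m).cur (flowOf m).pos) + 1) := by
            simpa [flowOf] using h5
          refine Runs.putN ⟨hcong (by simp) (by simp) (by simp) (by simp), ?_⟩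
          rw [Flow.step, if_pos h1', if_pos hact, if_pos h4', if_neg h5']
          simp [flowOf]
      · have h4' : ¬ (flowOf m).cur (flowOf m).pos < V := by simpa [flowOf, h3] using h4
        refine Runs.seq0 (Runs.putN (Runs.putN ⟨hcong (by simp) (by simp) (by simp) (by simp), ?_⟩))
        rw [Flow.step, if_pos h1', if_pos hact, if_neg h4']
        simp [flowOf]
    · have hact : ¬ (flowOf m).Active V (flowOf m).pos := fun h => h2 (by
        simpa [h3] using ⟨h.1.1, h.2.1, h.2.2⟩)
      refine Runs.putN ⟨hcong (by simp) (by simp) (by simp) (by simp), ?_⟩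
      rw [Flow.step, if_pos h1', if_neg hact]
      simp [flowOf]
  · have h1' : ¬ (flowOf m).pos < V := by simpa [flowOf, h3] using h1
    refine Runs.branch (fun h2 => ?_) (fun h2 => ?_)
    · have h2' : (flowOf m).act = 1 := by simpa [flowOf] using h2
      refine Runs.seq0 (Runs.putN (Runs.putN ⟨hcong (by simp) (by simp) (by simp) (by simp), ?_⟩))
      rw [Flow.step, if_neg h1', if_pos h2']
      simp [flowOf]
    · have h2' : ¬ (flowOf m).act = 1 := by simpa [flowOf] using h2
      refine Runs.putN ⟨hcong (by simp) (by simp) (by simp) (by simp), ?_⟩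
      rw [Flow.step, if_neg h1', if_neg h2']
      simp [flowOf]

/-- The push-relabel algorithm. -/
def flowProg : Prog := .loop (.natEq (sn 9) 1) stepProg

theorem runs_flowProg {m : Mem} (hs : Setup M k ε m) {V : ℕ} (hV : V = 2 + ∑ i, M.meshCount k ε i)
    (hf : (flowOf m).Inv V (numCap M k ε)) : Runs flowProg (16 * V ^ 3) m fun m' =>
      Setup M k ε m' ∧ (flowOf m').Inv V (numCap M k ε) ∧ (flowOf m').run = 0 := by
  refine Runs.loop (I := fun φ m => Setup M k ε m ∧ (flowOf m).Inv V (numCap M k ε) ∧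
    (flowOf m).potential V ≤ φ) ⟨hs, hf, Flow.potential_le hf (by omega)⟩ ?_ ?_
  · rintro φ m ⟨hs, hf, hφ⟩ hc
    refine ⟨0, (runs_stepProg hs hV).mono le_rfl ?_⟩
    rintro m' ⟨hs', he⟩
    refine ⟨(flowOf m').potential V, ?_, hs', ?_, le_rfl⟩
    · rw [he]
      have := Flow.potential_step hf hc
      omega
    · rw [he]; exact hf.step hc
  · rintro φ m ⟨hs, hf, hφ⟩ hc
    have h1 : (flowOf m).run ≠ 1 := hc
    have := hf.run_le
    exact ⟨hs, hf, by omega⟩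

end Bethe
end

noncomputable section
namespace Bethe

/-! ### The program: output -/

variable {n : ℕ} {M : MRF n} {ε : ℝ} {k : ℕ}

/-- The search for a height `1 ≤ h < V` which no node has. -/
def gapProg : Prog :=
  .seq (putN 0 10 0) (forUp 1 (sn 3) (.seq (sumUp 6 (sn 3) 0 (.ofNat (eqE (nv 4 (sn 6)) (sn 1))))
    (.branch (.conj (.natLt 0 (sn 1)) (.realLt (sr 0) 1)) (putN 0 10 (sn 1)) .skip)))

theorem runs_gapProg {m : Mem} (hs : Setup M k ε m) {V t : ℕ} (hV : V = 2 + ∑ i, M.meshCount k ε i)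
    (ht : V * (V + 1) ≤ t) (hgap : ∃ h, 1 ≤ h ∧ h < V ∧ ∀ v, v < V → m.N 4 v ≠ h) :
    Runs gapProg t m fun m' => Setup M k ε m' ∧ m'.N 4 = m.N 4 ∧ m'.N 0 10 < V ∧
      ∀ v, v < V → m.N 4 v ≠ m'.N 0 10 := by
  set Good : ℕ → Prop := fun h => 1 ≤ h ∧ h < V ∧ ∀ v, v < V → m.N 4 v ≠ h with hGood
  refine Runs.seq0 (Runs.putN (Runs.forUp (fun i m' => (Setup M k ε m' ∧ m'.N 4 = m.N 4) ∧
    (m'.N 0 10 = 0 ∨ Good (m'.N 0 10)) ∧ ∀ h < i, Good h → m'.N 0 10 ≠ 0) V (fun _ => V) (by simpa using ht)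
    ⟨⟨hs.congr (by simp) (by simp) (by simp) (by simp), by simp⟩, by simp, by simp⟩
    (fun i m h => by simp [h.1.1.nodes, hV]) ?_ ?_))
  · rintro i m' hi hv ⟨⟨hs, h4⟩, h1, h2⟩
    refine Runs.seq V 0 (Runs.sumUp V (fun v => if m.N 4 v = i then 1 else 0) le_rfl
      (fun a x => by simp [hs.nodes, hV]) (fun v x hv' => by simp [h4, hv]) ?_) le_rfl
    have hsum : (∑ v ∈ Finset.range V, if m.N 4 v = i then (1 : ℝ) else 0) < 1 ↔
        ∀ v, v < V → m.N 4 v ≠ i := by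
      rw [Finset.sum_boole, Nat.cast_lt_one, Finset.card_eq_zero, Finset.filter_eq_empty_iff]
      simp
    refine Runs.branch (fun hc => ?_) (fun hc => ?_)
    · simp [hv] at hc
      refine Runs.putN ⟨by simp [hv], ⟨hs.congr (by simp) (by simp) (by simp) (by simp), by simp [h4]⟩,
        Or.inr ?_, fun h hh hg => ?_⟩
      · simp [hv]; exact ⟨hc.1, hi, hc.2⟩
      · simp [hv]; omega
    · simp [hv] at hc
      refine Runs.skip ⟨by simp [hv], ⟨hs.congr (by simp) (by simp) (by simp) (by simp), by simp [h4]⟩,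
        by simpa using h1, fun h hh hg => ?_⟩
      rcases Nat.lt_succ_iff_lt_or_eq.1 hh with h' | rfl
      · simpa using h2 h h' hg
      · obtain ⟨x, hx, hx'⟩ := hc hg.1
        exact absurd hx' (hg.2.2 x hx)
  · rintro m' - ⟨⟨hs, h4⟩, h1, h2⟩
    obtain ⟨h, hg⟩ := hgap
    have h3 := h1.resolve_left (h2 h hg.2.1 hg)
    exact ⟨hs, h4, h3.2.1, h3.2.2⟩

/-- The number of the successor of an inner node in its chain. -/
def nextE (u : NExp) : NExp :=
  ltE (nv 3 u + 1) (nv 1 (nv 2 u)) * u + 1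

theorem Setup.eval_nextE {m : Mem} (hs : Setup M k ε m) {u : NExp} (p : Σ i, Fin (M.meshCount k ε i))
    (hu : u.eval m = nodeNum p) : (nextE u).eval m = num (chainNext p) := by
  rw [(eq_chainNext_iff p _).1 rfl]
  simp only [nextE, eval_nadd, eval_nmul, eval_ltE, eval_nv, eval_none, hu, hs.lab, hs.var, hs.count]
  split_ifs <;> simp

/-- The mesh points of the nodes at which the cut leaves the chains. -/
def outProg : Prog :=
  .seq (forUp 5 (sn 3 - 2) (.branch (.conj (.natLt (sn 10) (nv 4 (sn 5 + 2)))
      (.neg (.natLt (sn 10) (nv 4 (nextE (sn 5 + 2))))))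
    (putR 15 (nv 2 (sn 5 + 2)) (meshE (nv 2 (sn 5 + 2)) (nv 3 (sn 5 + 2)))) .skip))
    (forUp 1 (sn 0) (.setReal (sn 1) (rv 15 (sn 1))))

theorem runs_outProg {m : Mem} (hs : Setup M k ε m) {t : ℕ} (ht : (∑ i, M.meshCount k ε i) + n ≤ t)
    (x : ∀ i, Fin (M.meshCount k ε i))
    (hx : ∀ y : CutNode (M.meshCount k ε), m.N 0 10 < m.N 4 (num y) ↔ y ∈ labelCut x) :
    Runs outProg t m fun m' => m'.output n = fun i => M.mesh k ε i (x i) := by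
  set P := ∑ i, M.meshCount k ε i with hP
  refine Runs.seq P n (Runs.forUp (fun t m' => (Setup M k ε m' ∧ m'.N 4 = m.N 4 ∧ m'.N 0 10 = m.N 0 10) ∧
    ∀ i, nodeNum ⟨i, x i⟩ < t + 2 → m'.R 15 i = M.mesh k ε i (x i)) P (fun _ => 0) (by simp)
    ⟨⟨hs.congr (by simp) (by simp) (by simp) (by simp), by simp, by simp⟩, fun i h =>
      absurd h (not_lt.2 (two_le_nodeNum _))⟩
    (fun t m h => by simp [h.1.1.nodes, ← hP]) ?_ ?_) ht
  · rintro t m' hlt hv ⟨⟨hs, h4, h10⟩, hI⟩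
    set p := finSigmaFinEquiv.symm ⟨t, hlt⟩ with hp
    have hpt : 2 + t = nodeNum p := by simp [nodeNum, hp]
    have hu : (sn 5 + 2).eval m' = nodeNum p := by simp [hv, ← hpt, add_comm]
    have hnext := hs.eval_nextE p hu
    have e2 : (nv 2 (sn 5 + 2)).eval m' = p.1 := by rw [eval_nv, hu, hs.var]
    have e3 : (nv 3 (sn 5 + 2)).eval m' = p.2 := by rw [eval_nv, hu, hs.lab]
    have hcond : (BExp.conj (.natLt (sn 10) (nv 4 (sn 5 + 2)))
        (.neg (.natLt (sn 10) (nv 4 (nextE (sn 5 + 2)))))).Holds m' ↔ p.2 = x p.1 := by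
      rw [← mem_labelCut_chainNext x p, ← hx, ← hx, num_inr]
      simp only [holds_conj, holds_neg, holds_natLt, eval_nv, eval_sn, hu, hnext, h4, h10]
    have hlast : ∀ i, nodeNum ⟨i, x i⟩ < t + 1 + 2 → p ≠ ⟨i, x i⟩ → nodeNum ⟨i, x i⟩ < t + 2 := by
      intro i hi hne
      rcases Nat.lt_succ_iff_lt_or_eq.1 (show nodeNum ⟨i, x i⟩ < (t + 2) + 1 by omega) with h | h
      · exact h
      · refine absurd ?_ hne
        have h' : nodeNum p = nodeNum ⟨i, x i⟩ := by omega
        rw [← num_inr, ← num_inr, num_inj] at h'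
        exact Sum.inr_injective h'
    refine Runs.branch (fun hc => ?_) (fun hc => ?_)
    · rw [hcond] at hc
      refine Runs.putR ⟨by simp [hv], ⟨hs.congr (by simp) (by simp) (by simp) (by simp), by simp [h4],
        by simp [h10]⟩, fun i hi => ?_⟩
      rw [e2, hs.eval_meshE p.1 e2, e3, hc]
      by_cases h : p.1 = i
      · subst h; simp; rfl
      · have h' : (i : ℕ) ≠ p.1 := fun h' => h (Fin.ext h'.symm)
        have := hI i (hlast i hi fun hpi => h (by rw [hpi]))
        simpa [Function.update_apply, h'] using this
    · rw [hcond] at hc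
      refine Runs.skip ⟨by simp [hv], ⟨hs.congr (by simp) (by simp) (by simp) (by simp), by simp [h4],
        by simp [h10]⟩, fun i hi => ?_⟩
      have := hI i (hlast i hi fun hpi => hc (by rw [hpi]))
      simpa using this
  · rintro m' - ⟨⟨hs, h4, h10⟩, hI⟩
    -- the copy runs upwards: cell `i` comes from cell `16 i + 15 > i`, so nothing unread is overwritten
    refine Runs.forUp (fun i m => m.N 0 0 = n ∧ (∀ j : Fin n, (j : ℕ) < i → m.real j = M.mesh k ε j (x j)) ∧
      ∀ j : Fin n, i ≤ j → m.R 15 j = M.mesh k ε j (x j)) n (fun _ => 0) (by simp)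
      ⟨by simp [hs.base.size], fun j h => by omega, fun j _ => ?_⟩ (fun i m h => h.1) ?_ ?_
    · have : nodeNum (⟨j, x j⟩ : Σ i, Fin (M.meshCount k ε i)) < P + 2 := by
        have := num_lt (Sum.inr ⟨j, x j⟩ : CutNode (M.meshCount k ε))
        rw [num_inr] at this; omega
      simpa using hI j this
    · rintro i m hi hv ⟨h0, h1, h2⟩
      refine Runs.setReal ⟨hv, h0, fun j hj => ?_, fun j hj => ?_⟩
      · simp only [Mem.setN, eval_sn, hv, eval_rv]
        rcases Nat.lt_succ_iff_lt_or_eq.1 hj with h | h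
        · rw [Function.update_of_ne h.ne]; exact h1 j h
        · rw [← h, Function.update_self]; exact h2 j h.ge
      · simp only [Mem.setN, eval_sn, hv, eval_rv, Mem.R]
        rw [Function.update_of_ne (by simp; omega)]
        exact h2 j (by omega)
    · rintro m - ⟨-, h1, -⟩
      exact funext fun j => h1 j j.2

/-! ### The algorithm -/

/-- The network that the program builds represents the free energy on the mesh. -/
theorem meshCap_represents (hM : M.Associative) :
    (∀ u v, 0 ≤ meshCap M k ε u v) ∧
      (∃ c : ℝ, ∀ x : (∀ i, Fin (M.meshCount k ε i)),
        cutValue (meshCap M k ε) (labelCut x) = M.F (fun i => M.mesh k ε i (x i)) + c) ∧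
      ∀ S, IsMinCut (meshCap M k ε) S → ∃ x, S = labelCut x := by
  refine MRF.netCap_represents (d := meshFn M k ε) hM (M.meshCount_pos k ε) (fun i r hr => ?_)
    (fun i r s hrs hs => ?_) (fun p => ?_) (lt_add_one _)
  · exact hM.side_subset k i (hM.mesh_mem_side k ε i ⟨r, hr⟩)
  · exact hM.mesh_mono k ε i (a := ⟨r, hrs.trans_lt hs⟩) (b := ⟨s, hs⟩) hrs
  · have := Finset.single_le_sum (f := fun p => |unaryCost M k ε p|) (fun p _ => abs_nonneg _)
      (Finset.mem_univ p)
    have := neg_abs_le (unaryCost M k ε p)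
    simp only [unaryCost] at *
    linarith

/-- Cuts of the numbered network are cuts of the network. -/
theorem cutCap_numCap {V : ℕ} (hV : V = 2 + ∑ i, M.meshCount k ε i) (P : ℕ → Prop)
    [DecidablePred P] : Flow.cutCap V (numCap M k ε) P
      = cutValue (meshCap M k ε) (Finset.univ.filter fun y => P (num y)) := by
  rw [cutValue_eq, Flow.cutCap, hV, sum_num]
  refine Finset.sum_congr rfl fun x _ => ?_
  rw [sum_num]
  refine Finset.sum_congr rfl fun y _ => ?_
  simp [numCap]

/-- A minimum cut of the network of the mesh is the cut of a minimizer of the free energy. -/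
theorem exists_minimizer_of_gap (hM : M.Associative) {V : ℕ} (hV : V = 2 + ∑ i, M.meshCount k ε i)
    {s : Flow} (hs : s.Inv V (numCap M k ε)) (hrun : s.run = 0) {h : ℕ} (hh : h < V)
    (hgap : ∀ v, v < V → s.ht v ≠ h) :
    ∃ x : (∀ i, Fin (M.meshCount k ε i)), (∀ y : CutNode (M.meshCount k ε), h < s.ht (num y) ↔ y ∈ labelCut x) ∧
      ∀ y : (∀ i, Fin (M.meshCount k ε i)),
        M.F (fun i => M.mesh k ε i (x i)) ≤ M.F fun i => M.mesh k ε i (y i) := by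
  obtain ⟨-, ⟨c, hc⟩, hlab⟩ := meshCap_represents (k := k) (ε := ε) hM
  have hmin : IsMinCut (meshCap M k ε) (Finset.univ.filter fun y => h < s.ht (num y)) := by
    refine ⟨⟨?_, ?_⟩, fun T hT0 hT1 => ?_⟩
    · simp [num_source, hs.ht_source, hh]
    · simp [num_sink, hs.ht_sink]
    · have hnode0 : node (M.meshCount k ε) 0 = Sum.inl true := node_num (Sum.inl true)
      have hnode1 : node (M.meshCount k ε) 1 = Sum.inl false := node_num (Sum.inl false)
      have := hs.isMin_of_gap (by omega) hrun hh hgap (T := fun v => node _ v ∈ T) (by rwa [hnode0])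
        (by rwa [hnode1])
      rw [cutCap_numCap hV, cutCap_numCap hV] at this
      simpa using this
  obtain ⟨x, hx⟩ := hlab _ hmin
  refine ⟨x, fun y => by rw [← hx]; simp, fun y => ?_⟩
  have := hmin.2 (labelCut y) (by simp) (by simp)
  rw [hx, hc, hc] at this
  linarith

/-- The program: bounds, mesh, network, minimum cut, output. -/
def betheProg (k : ℕ) : Prog :=
  .seq copyIn (.seq suppProg (.seq startProg (.seq (roundsProg k) (.seq omegaProg (.seq widthProg (.seq layoutProg
    (.seq unaryProg (.seq totalProg (.seq initProg (.seq flowProg (.seq gapProg outProg)))))))))))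

/-- All phases take at most `O(V ^ 3)` passes, where `V` is the number of nodes; the rounds of bound
propagation contribute the factor that depends on `k`. -/
theorem runs_betheProg (hM : M.Associative) (hn : 0 < n) (hε : 0 < ε) :
    Runs (betheProg k) ((40 + 4 * k) * (2 + ∑ i, M.meshCount k ε i) ^ 3) (M.input ε) fun m =>
      ∃ x : (∀ i, Fin (M.meshCount k ε i)), m.output n = (fun i => M.mesh k ε i (x i)) ∧
        ∀ y : (∀ i, Fin (M.meshCount k ε i)),
          M.F (fun i => M.mesh k ε i (x i)) ≤ M.F fun i => M.mesh k ε i (y i) := by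
  set P := ∑ i, M.meshCount k ε i with hP
  obtain ⟨V, hV⟩ : ∃ V, V = 2 + P := ⟨_, rfl⟩
  rw [← hV]
  have hsize : (M.input ε).N 0 0 = n := by simp [MRF.input, Mem.N]
  have hγ := hM.meshWidth_pos hn k hε
  refine Runs.mono (k := (n * n + n + 1) + (n * n + (n * (2 * n + 1) + (k * (n * (2 * n + 1) + n) +
    (n * (2 * n + 1) + (n + ((2 * P + n) + (P * (n + 1) + (V * (V + 1) + (V * (V + 1) +
      (16 * V ^ 3 + (V * (V + 1) + (P + n))))))))))))) ?_ ?_ fun _ h => h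
  · refine Runs.seq _ _ ((runs_copyIn (by rw [hsize])).mono le_rfl fun m h => ?_) le_rfl
    refine Runs.seq _ _ ((runs_suppProg (M := M) (ε := ε) (h.1.trans hsize)
      (by simpa only [hsize] using h.2) le_rfl).mono le_rfl fun m h => ?_) le_rfl
    refine Runs.seq _ _ ((runs_startProg h le_rfl).mono le_rfl fun m h => ?_) le_rfl
    refine Runs.seq _ _ ((runs_roundsProg hM h.1 h.2.1 h.2.2 k).mono le_rfl fun m h => ?_) le_rfl
    refine Runs.seq _ _ ((runs_omegaProg hM hn h.1 h.2.1 h.2.2 le_rfl).mono le_rfl fun m h => ?_) le_rfl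
    refine Runs.seq _ _ ((runs_widthProg h.1 h.2.1 h.2.2.1 h.2.2.2).mono le_rfl fun m h => ?_) le_rfl
    refine Runs.seq _ _ ((runs_layoutProg h.1 h.2.1 h.2.2.1 hγ h.2.2.2).mono le_rfl fun m h => ?_) le_rfl
    refine Runs.seq _ _ ((runs_unaryProg hM h le_rfl).mono le_rfl fun m h => ?_) le_rfl
    refine Runs.seq _ _ ((runs_totalProg hM h.1 h.2 hV le_rfl).mono le_rfl fun m h => ?_) le_rfl
    refine Runs.seq _ _ ((runs_initProg hM h.1 h.2.1 h.2.2 hV le_rfl (meshCap_represents hM).1).mono le_rfl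
      fun m h => ?_) le_rfl
    refine Runs.seq _ _ ((runs_flowProg h.1 hV h.2).mono le_rfl fun m h => ?_) le_rfl
    obtain ⟨hs, hf, hrun⟩ := h
    refine Runs.seq _ _ ((runs_gapProg hs hV le_rfl (hf.exists_gap (by omega))).mono le_rfl
      fun m' h => ?_) le_rfl
    obtain ⟨hs', h4, hlt, hgap⟩ := h
    obtain ⟨x, hx, hmin⟩ := exists_minimizer_of_gap hM hV hf hrun hlt hgap
    refine (runs_outProg hs' le_rfl x fun y => ?_).mono le_rfl fun m'' h => ⟨x, h, hmin⟩
    rw [h4]; exact hx y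
  · have hnP : n ≤ P := by
      have := Finset.sum_le_sum fun (i : Fin n) (_ : i ∈ Finset.univ) =>
        Nat.succ_le_of_lt (MRF.meshCount_pos (M := M) k ε i)
      simpa using this
    have hnV : n ≤ V := by omega
    have hPV : P ≤ V := by omega
    have h1 : V ≤ V ^ 3 := Nat.le_self_pow (by norm_num) V
    have h2 : V * V ≤ V ^ 3 := by
      rw [pow_succ, sq]; exact Nat.le_mul_of_pos_right _ (by omega)
    have h3 : n * n ≤ V * V := Nat.mul_le_mul hnV hnV
    have h4 : P * n ≤ V * V := Nat.mul_le_mul hPV hnV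
    have h5 : k * (n * (2 * n + 1) + n) ≤ k * (4 * V ^ 3) := Nat.mul_le_mul_left _ (by nlinarith)
    nlinarith

end Bethe
end

open Bethe in
theorem mainTheorem1 (k : ℕ) :
    -- every mesh in the Bethe box: graph cuts apply, and a fine mesh is accurate
    (∀ (n : ℕ) (M : MRF n), 2 ≤ n → M.graph.Connected → M.Associative →
      ∀ (N : Fin n → ℕ) (d : ∀ i, Fin (N i) → ℝ), (∀ i, 0 < N i) → (∀ i, StrictMono (d i)) →
        (∀ i r, d i r ∈ M.side k i) →
          (∀ i j, M.graph.Adj i j → Submodular fun r s => M.edgeTerm i j (d i r) (d j s)) ∧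
          IsGraphCutProblem N (fun x => M.F fun i => d i (x i)) ∧
          ∀ ε γ : ℝ, 0 < ε → (∀ i, ∀ y ∈ M.side k i, ∃ r, |y - d i r| ≤ γ) →
            (n : ℝ) * γ ^ 2 ≤ 2 * ε / ((n : ℝ) * M.Ω k * √M.density) →
            ∀ x : (∀ i, Fin (N i)),
              (∀ y : (∀ i, Fin (N i)), M.F (fun i => d i (x i)) ≤ M.F fun i => d i (y i)) →
              M.WithinOfMin (fun i => d i (x i)) ε) ∧
    -- one algorithm, which finds the best point of the equally spaced mesh
    (∃ (P : Prog) (C : ℝ), ∀ (n : ℕ) (M : MRF n), 2 ≤ n → M.graph.Connected → M.Associative →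
      ∀ ε : ℝ, 0 < ε →
        (∀ i r, M.mesh k ε i r ∈ M.side k i) ∧
        ∃ (t : ℕ) (m : Mem) (x : ∀ i, Fin (M.meshCount k ε i)),
          Exec P (M.input ε) t m ∧
          m.output n = (fun i => M.mesh k ε i (x i)) ∧
          (∀ y : (∀ i, Fin (M.meshCount k ε i)),
            M.F (m.output n) ≤ M.F fun i => M.mesh k ε i (y i)) ∧
          M.WithinOfMin (m.output n) ε ∧
          (M.meshWidth k ε ≤ 1 → (t : ℝ) ≤ C * M.timeBound k ε)) ∧
    -- ranges of the parameters for which the time is polynomial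
    (∀ c Wmax θmax : ℝ, ∃ (K : ℝ) (e : ℕ), ∀ (n : ℕ) (M : MRF n), 2 ≤ n → M.graph.Connected →
      M.Associative → (∀ i, (M.deg i : ℝ) ≤ c * Real.log n) → (∀ i j, M.W i j ≤ Wmax) →
      ((∀ i, |M.θ i| ≤ θmax) ∨ ∀ i, |M.θ i + M.Wsum i / 2| ≤ θmax) →
      ∀ ε : ℝ, 0 < ε → M.timeBound k ε ≤ K * (n : ℝ) ^ e * ε ^ (-(3 / 2) : ℝ)) := by
  refine ⟨fun n M hn _ hM N d hN hmono hside => ⟨fun i j hij => ?_, ?_, fun ε γ hε hcov hγ x hx => ?_⟩,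
    ⟨betheProg k, (betheProg k).size * (41 + 4 * k) * 8, fun n M hn _ hM ε hε => ?_⟩,
    MRF.timeBound_polynomial k⟩
  · exact MRF.edgeTerm_submodular hM hij (hmono i).monotone (hmono j).monotone (hside i) (hside j)
  · exact MRF.isGraphCutProblem hM hN (fun i => (hmono i).monotone) hside
  · exact MRF.withinOfMin_of_mesh hM (by omega) hside hcov hγ x hx
  · obtain ⟨t, m, hexec, ht, x, hout, hmin⟩ := runs_betheProg (k := k) hM (by omega : 0 < n) hε
    refine ⟨hM.mesh_mem_side k ε, t, m, x, hexec, hout, ?_, ?_, fun hγ => ?_⟩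
    · rw [hout]; exact hmin
    · rw [hout]; exact MRF.withinOfMin_of_equally_spaced hM (by omega) hε x hmin
    · have hV := hM.sum_meshCount_le hn hε hγ
      generalize (betheProg k).size = S at ht ⊢
      set V := 2 + ∑ i, M.meshCount k ε i
      have h1 : 1 ≤ V ^ 3 := Nat.one_le_pow _ _ (by omega)
      have h2 : t ≤ S * ((41 + 4 * k) * V ^ 3) :=
        ht.trans (Nat.mul_le_mul_left _ (by linarith))
      calc (t : ℝ) ≤ (S * ((41 + 4 * k) * V ^ 3) : ℕ) := by exact_mod_cast h2
        _ = S * (41 + 4 * k) * (V : ℝ) ^ 3 := by push_cast; ring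
        _ ≤ S * (41 + 4 * k) * (8 * M.timeBound k ε) :=
          mul_le_mul_of_nonneg_left hV (by positivity)
        _ = _ := by ring
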